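/- Let $d\ge 1$ and let $\pi$ be a probability density on $\mathbb R^d$ with respect to Lebesgue measure; write $|\cdot|$ for the Euclidean norm and $\pi(f)=\int f(x)\pi(x)\,dx$. Assume that $\pi$ is positive, bounded and differentiable, that for some $\rho>1$ $$\lim_{r\to\infty}\ \sup_{|x|\ge r}\ \frac{x}{|x|^{\rho}}\cdot\nabla\log\pi(x)=-\infty ,$$ and that for some $R>0$ $$\sup_{|x|\ge R}\ \frac{x}{|x|}\cdot\frac{\nabla\pi(x)}{|\nabla\pi(x)|}<0 .$$ Let $s\in(0,1)$ and $W(x)=\pi(x)^{-s}\,\sup_{y}\pi(y)^{s}$. For a positive semidefinite symmetric $d\times d$ matrix $\Gamma$ let $Q_\Gamma(x,\cdot)$ be the Gaussian law with mean $x$ and covariance matrix $(2.38)^2d^{-1}\Gamma$ (with density $y\mapsto q_\Gamma(y-x)$ when $\Gamma$ is positive definite), and let $P_\Gamma$ be the Metropolis kernel $$P_\Gamma(x,A)=\int_A\Big(1\wedge\frac{\pi(y)}{\pi(x)}\Big)Q_\Gamma(x,dy)+\mathbf 1_A(x)\Big[1-\int\Big(1\wedge\frac{\pi(y)}{\pi(x)}\Big)Q_\Gamma(x,dy)\Big].$$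 Let $\kappa>0$, let $(\Omega,\mathcal A,(\mathcal F_n)_{n\ge0},\mathbb P)$ be a filtered probability space, and let $(X_n,\mu_n,\Gamma_n)_{n\ge 0}$ be an adaptive Metropolis chain on it, that is, an $\mathcal F_n$-adapted process, with $X_n,\mu_n\in\mathbb R^d$ and $\Gamma_n\in\mathbb R^{d\times d}$, such that $\mathbb E[g(X_{n+1})\mid\mathcal F_n]=\int g(y)\,P_{\Gamma_n}(X_n,dy)$ a.s. for all $n\ge 0$ and all bounded measurable $g$, where $\mu_0=0$, $\Gamma_0$ is positive semidefinite, and $$\mu_{n+1}=\mu_n+\tfrac1{n+1}(X_{n+1}-\mu_n),\qquad \Gamma_{n+1}=\tfrac{n}{n+1}\Gamma_n+\tfrac1{n+1}\big\{(X_{n+1}-\mu_n)(X_{n+1}-\mu_n)^T+\kappa I_d\big\}.$$ Assume $\mathbb E[W(X_0)]<\infty$. Then for every $a\in(0,1)$ and every measurable $f:\mathbb R^d\to\mathbb R$ with $\sup_x|f(x)|/W(x)^a<\infty$, $f$ is $\pi$-integrable and $$\frac1n\sum_{k=1}^n f(X_k)\longrightarrow\pi(f)\qquad\mathbb P\text{-a.s.}$$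 -/

import Mathlib

open MeasureTheory ProbabilityTheory Filter Topology
open scoped ENNReal

namespace AdaptiveMetropolis

/-- The state space `ℝ^d` with its Euclidean norm. -/
abbrev State (d : ℕ) : Type := EuclideanSpace ℝ (Fin d)

/-- `p` is a probability density with respect to Lebesgue measure. -/
structure IsProbDensity {d : ℕ} (p : State d → ℝ) : Prop where
  measurable : Measurable p
  nonneg : ∀ x, 0 ≤ p x
  lintegral_eq_one : ∫⁻ x, ENNReal.ofReal (p x) = 1

/-- The target distribution: the measure with Lebesgue density `p`. -/
noncomputable def target {d : ℕ} (p : State d → ℝ) : Measure (State d) :=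
  volume.withDensity fun x => ENNReal.ofReal (p x)

/-- The density `p` is positive, bounded and differentiable, it is super-exponential, i.e.
`lim_{r → ∞} sup_{|x| ≥ r} x / |x|^ρ · ∇ log p(x) = -∞` for some `ρ > 1`, and it has regular
contours, i.e. `sup_{|x| ≥ R} x / |x| · ∇p(x) / |∇p(x)| < 0` for some `R > 0`.
The suprema are taken in the extended reals. -/
structure SuperExpRegularContours {d : ℕ} (p : State d → ℝ) : Prop where
  pos : ∀ x, 0 < p x
  bounded : ∃ C : ℝ, ∀ x, p x ≤ C
  differentiable : Differentiable ℝ p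
  superExp : ∃ ρ : ℝ, 1 < ρ ∧
    Tendsto
      (fun r : ℝ => ⨆ (x : State d) (_ : r ≤ ‖x‖),
        ((inner ℝ ((‖x‖ ^ ρ)⁻¹ • x) (gradient (fun y => Real.log (p y)) x) : ℝ) : EReal))
      atTop (𝓝 ⊥)
  regularContours : ∃ R : ℝ, 0 < R ∧
    (⨆ (x : State d) (_ : R ≤ ‖x‖),
      ((inner ℝ (‖x‖⁻¹ • x) (‖gradient p x‖⁻¹ • gradient p x) : ℝ) : EReal)) < 0

/-- The weight `W = p^{-s} ‖p^s‖_∞`. -/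
noncomputable def weight {d : ℕ} (p : State d → ℝ) (s : ℝ) (x : State d) : ℝ :=
  p x ^ (-s) * ⨆ y, |p y ^ s|

/-- The `V`-norm `sup_x |f x| / V x`, as an extended nonnegative real. -/
noncomputable def vNorm {d : ℕ} (V f : State d → ℝ) : ℝ≥0∞ :=
  ⨆ x, ENNReal.ofReal (|f x| / V x)

/-- The Gaussian random-walk proposal from `x`: the law of `x + Z`, where `Z` is a centered
Gaussian vector with covariance matrix `(2.38)^2 d⁻¹ Γ`. If `Γ` is positive definite, this is
the measure `q_Γ(y - x) dy`, where `q_Γ` is the density of `Z`. -/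
noncomputable def proposal {d : ℕ} (Γ : Matrix (Fin d) (Fin d) ℝ) (x : State d) :
    Measure (State d) :=
  multivariateGaussian x (((2.38 : ℝ) ^ 2 * (d : ℝ)⁻¹) • Γ)

/-- The Metropolis acceptance probability `1 ∧ p(y) / p(x)`. -/
noncomputable def accept {d : ℕ} (p : State d → ℝ) (x y : State d) : ℝ :=
  min 1 (p y / p x)

/-- The random-walk Metropolis transition probability `P_Γ(x, ·)`:
`P_Γ(x, A) = ∫_A (1 ∧ p(y)/p(x)) q_Γ(y - x) dy
  + 1_A(x) [1 - ∫ (1 ∧ p(y)/p(x)) q_Γ(y - x) dy]`. -/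
noncomputable def metropolis {d : ℕ} (p : State d → ℝ) (Γ : Matrix (Fin d) (Fin d) ℝ)
    (x : State d) : Measure (State d) :=
  (proposal Γ x).withDensity (fun y => ENNReal.ofReal (accept p x y))
    + ENNReal.ofReal (1 - ∫ y, accept p x y ∂(proposal Γ x)) • Measure.dirac x

/-- `(X, μ, Γ)` is an adaptive Metropolis chain with target density `p` and regularization
constant `κ`, on the probability space `(Ω, P)` with filtration `ℱ`: the process is adapted,
given the past up to time `n` the state `X (n + 1)` is drawn from `P_{Γ n}(X n, ·)`, and
`(μ n, Γ n)` are the recursively computed sample mean and regularized sample covariance matrix,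
started at `μ 0 = 0` and at a positive semidefinite `Γ 0`. -/
structure IsAMChain {d : ℕ} {Ω : Type*} {mΩ : MeasurableSpace Ω} (p : State d → ℝ) (κ : ℝ)
    (P : Measure Ω) (ℱ : Filtration ℕ mΩ) (X : ℕ → Ω → State d) (μ : ℕ → Ω → State d)
    (Γ : ℕ → Ω → Matrix (Fin d) (Fin d) ℝ) : Prop where
  adapted_state : ∀ n, Measurable[ℱ n] (X n)
  adapted_mean : ∀ n, Measurable[ℱ n] (μ n)
  adapted_cov : ∀ n i j, Measurable[ℱ n] fun ω => Γ n ω i j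
  markov : ∀ n, ∀ f : State d → ℝ, Measurable f → (∃ C : ℝ, ∀ x, |f x| ≤ C) →
    P[fun ω => f (X (n + 1) ω) | ℱ n] =ᵐ[P]
      fun ω => ∫ y, f y ∂(metropolis p (Γ n ω) (X n ω))
  mean_zero : ∀ ω, μ 0 ω = 0
  mean_succ : ∀ n ω, μ (n + 1) ω = μ n ω + (1 / ((n : ℝ) + 1)) • (X (n + 1) ω - μ n ω)
  cov_zero : ∀ ω, (Γ 0 ω).PosSemidef
  cov_succ : ∀ n ω, Γ (n + 1) ω =
    ((n : ℝ) / ((n : ℝ) + 1)) • Γ n ω +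
      (1 / ((n : ℝ) + 1)) •
        (Matrix.vecMulVec (X (n + 1) ω - μ n ω).ofLp (X (n + 1) ω - μ n ω).ofLp
          + κ • (1 : Matrix (Fin d) (Fin d) ℝ))

end AdaptiveMetropolis

open MeasureTheory ProbabilityTheory Filter Topology
open scoped ENNReal

namespace AdaptiveMetropolis

/-! Write `V_t = p ^ (-t)` and let `S` be the covariance matrix of the proposal. From time `1` on
the recursion gives `Γ ≥ κ I`, hence `S ≥ k I` for a fixed `k > 0`, but nothing bounds `S` from
above a priori. The proof rests on a drift inequality that needs no upper bound.

Drift (`exists_drift`): for `0 < t < 1`, `P_S V_t + c * gaussPeak S * V_t ≤ V_t + b` with the same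
`c` and `b` for all `S ≥ k I`. The Gaussian normalization `gaussPeak S`, of order `det S ^ (-1/2)`,
is factored out, and it remains to show that far from the origin the unnormalized gain from moves to
higher density exceeds the loss from moves to lower density by a fixed amount. In polar coordinates
each ray crosses the contour of `p` through `x` once far out. By superexponential decay the loss
beyond the crossing is at most half the gain just before it, up to `ε` (`exists_ray_comparison`).
Regularity of the contours gives a ball of fixed radius close to `x` where `log p` is much larger,
so the gain is bounded below (`exists_gain_ge`).

Stability (`ae_exists_forall_mem_covSet`): the drift gives linear growth of `E V_s(X n)`. With `U =
V_{s/4}`, a martingale law of large numbers bounds the averages of `gaussPeak (S k) * U (X k)`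
(`ae_sum_le_mul_of_drift`). Since `U` dominates `‖x‖ ^ (4 * d)`, while `1 / gaussPeak` is at most of
order `M ^ d` when the entries of the covariance are of order `M`, the empirical second moment `A N`
satisfies `A N ^ (2 * d) ≤ C * (c₀ + 4 * M) ^ d`, with `M ≥ 1` bounding it up to time `N`. Comparing
exponents, `A` is bounded (`exists_bound_of_pow_le`), and so are the covariances.

Ergodicity: over a compact set of covariances the drift is geometric and there is a common
minorization, so Harris' theorem gives uniform geometric convergence (`exists_uniform_ergodicity`).
On paths confined to such a set, `V_{s/q}` has bounded averages for `1 < q < 2`.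

Law of large numbers: for bounded `f`, the partial sum `h_N = ∑_{j<N} P_S^j f` satisfies `f = h_N -
P_S h_N + P_S^N f`. The average of `f - π(f)` then splits into a martingale average, a telescoping
term, a term measuring the change of `S` between consecutive steps, and a remainder of order `q ^ N`
with `q < 1` the Harris rate (`tendsto_average_of_innovation`). The third term vanishes because `S`
changes by `o(1)` per step and Gaussian densities depend continuously on `S` in `L¹`. Truncation
extends the result to `|f| ≤ C * V_{sa}`, which is sublinear in `V_{s/q}` once `a * q < 1`. -/

/-! ### Gaussian densities as functions of the covariance matrix -/

/-- The quadratic form of a matrix. -/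
noncomputable def quadForm {d : ℕ} (S : Matrix (Fin d) (Fin d) ℝ) (z : State d) : ℝ :=
  z.ofLp ⬝ᵥ S.mulVec z.ofLp

/-- The Lebesgue density of the centered Gaussian law with covariance matrix `S`. -/
noncomputable def gaussDens {d : ℕ} (S : Matrix (Fin d) (Fin d) ℝ) (z : State d) : ℝ :=
  (√((2 * Real.pi) ^ d * S.det))⁻¹ * Real.exp (-quadForm S⁻¹ z / 2)

/-- Symmetric matrices bounded below by `k • 1`. -/
structure UniformlyElliptic {d : ℕ} (k : ℝ) (S : Matrix (Fin d) (Fin d) ℝ) : Prop where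
  symm : S.transpose = S
  lower : ∀ z : State d, k * ‖z‖ ^ 2 ≤ quadForm S z

variable {d : ℕ}

lemma pi_gaussianReal_eq_withDensity {ι : Type*} [Fintype ι] :
    Measure.pi (fun _ : ι => gaussianReal 0 1) =
      volume.withDensity fun x : ι → ℝ => ENNReal.ofReal (∏ i, gaussianPDFReal 0 1 (x i)) := by
  refine Measure.pi_eq fun s hs => ?_
  have hint : ∀ i, Integrable (gaussianPDFReal 0 1) (volume.restrict (s i)) := fun i =>
    (integrable_gaussianPDFReal 0 1).restrict
  rw [withDensity_apply _ (MeasurableSet.univ_pi hs), volume_pi, Measure.restrict_pi_pi,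
    ← ofReal_integral_eq_lintegral_ofReal, integral_fintype_prod_eq_prod,
    ENNReal.ofReal_prod_of_nonneg]
  · refine Finset.prod_congr rfl fun i _ => ?_
    rw [gaussianReal_apply _ one_ne_zero, ofReal_integral_eq_lintegral_ofReal (hint i)]
    · rfl
    · exact ae_of_all _ fun x => gaussianPDFReal_nonneg _ _ _
  · exact fun i _ => integral_nonneg fun x => gaussianPDFReal_nonneg _ _ _
  · exact Integrable.fintype_prod_dep hint
  · exact ae_of_all _ fun x => Finset.prod_nonneg fun i _ => gaussianPDFReal_nonneg _ _ _

lemma stdGaussian_eq_withDensity :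
    stdGaussian (State d) = volume.withDensity fun x : State d =>
      ENNReal.ofReal ((√((2 * Real.pi) ^ d))⁻¹ * Real.exp (-‖x‖ ^ 2 / 2)) := by
  rw [← map_pi_eq_stdGaussian, pi_gaussianReal_eq_withDensity]
  have key : (fun x : Fin d → ℝ => ENNReal.ofReal (∏ i, gaussianPDFReal 0 1 (x i))) =
      (fun x : State d => ENNReal.ofReal ((√((2 * Real.pi) ^ d))⁻¹ * Real.exp (-‖x‖ ^ 2 / 2))) ∘
        (WithLp.toLp 2) := by
    funext x
    simp only [gaussianPDFReal, Function.comp, EuclideanSpace.real_norm_sq_eq]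
    rw [Finset.prod_mul_distrib, ← Real.exp_sum]
    congr 2
    · rw [Finset.prod_const, Finset.card_fin, inv_pow]
      congr 1
      rw [eq_comm, Real.sqrt_eq_iff_mul_self_eq (by positivity) (by positivity), ← mul_pow,
        Real.mul_self_sqrt (by simpa using Real.pi_pos.le)]
      simp
    · simp [Finset.sum_div, neg_div]
  rw [key]
  have hmp := PiLp.volume_preserving_toLp (Fin d)
  ext s hs
  rw [Measure.map_apply (by fun_prop) hs, withDensity_apply _ (hmp.measurable hs),
    withDensity_apply _ hs]
  exact hmp.setLIntegral_comp_preimage hs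
    (f := fun x : State d =>
      ENNReal.ofReal ((√((2 * Real.pi) ^ d))⁻¹ * Real.exp (-‖x‖ ^ 2 / 2))) (by fun_prop)

lemma quadForm_eq_inner (S : Matrix (Fin d) (Fin d) ℝ) (z : State d) :
    quadForm S z = inner ℝ z (Matrix.toEuclideanCLM (𝕜 := ℝ) S z) := by
  rw [Matrix.inner_toEuclideanCLM]; rfl

lemma norm_sq_eq_dotProduct (z : State d) : ‖z‖ ^ 2 = z.ofLp ⬝ᵥ z.ofLp := by
  rw [EuclideanSpace.real_norm_sq_eq]
  simp [dotProduct, sq]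

-- The Gaussian law is the image of the standard one under `z ↦ x + √S z`. The change of variables
-- contributes `det √S = √(det S)`, and the form of `S⁻¹` evaluated at `√S z` is `‖z‖ ^ 2`.
open scoped MatrixOrder in
lemma multivariateGaussian_eq_withDensity {S : Matrix (Fin d) (Fin d) ℝ} (hS : S.PosDef)
    (x : State d) :
    multivariateGaussian x S =
      volume.withDensity fun y => ENNReal.ofReal (gaussDens S (y - x)) := by
  set A := CFC.sqrt S with hA
  have hAA : A * A = S := CFC.sqrt_mul_sqrt_self _ hS.posSemidef.nonneg
  have hAsymm : A.transpose = A := by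
    have := (CFC.sqrt_nonneg S).isSelfAdjoint
    rw [← hA] at this
    simpa [IsSelfAdjoint, Matrix.star_eq_conjTranspose] using this
  have hdet : A.det * A.det = S.det := by rw [← Matrix.det_mul, hAA]
  have hSpos : 0 < S.det := hS.det_pos
  have hA0 : A.det ≠ 0 := by
    rintro h; rw [h] at hdet; simp at hdet; exact hSpos.ne hdet
  have hAu : IsUnit A.det := isUnit_iff_ne_zero.2 hA0
  have habs : |A.det| = √S.det := by
    rw [← hdet, Real.sqrt_mul_self_eq_abs]
  set g : State d → ℝ≥0∞ := fun y => ENNReal.ofReal (gaussDens S (y - x)) with hg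
  have hgm : Measurable g := by
    unfold g gaussDens
    simp only [quadForm_eq_inner]
    fun_prop
  set T : State d → State d := fun z => x + Matrix.toEuclideanCLM (𝕜 := ℝ) A z with hT
  set f : State d →ₗ[ℝ] State d :=
    ((Matrix.toEuclideanCLM (n := Fin d) (𝕜 := ℝ) A : State d →L[ℝ] State d) :
      State d →ₗ[ℝ] State d) with hf
  have hfdet : LinearMap.det f = A.det := by
    rw [hf, Matrix.coe_toEuclideanCLM_eq_toEuclideanLin]
    rw [Matrix.toEuclideanLin_eq_toLin_orthonormal, LinearMap.det_toLin]
  have hmapvol : Measure.map T volume = ENNReal.ofReal |A.det|⁻¹ • (volume : Measure (State d)) := by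
    have h1 : Measure.map f (volume : Measure (State d)) = ENNReal.ofReal |A.det|⁻¹ • volume := by
      rw [Measure.map_linearMap_addHaar_eq_smul_addHaar _ (by rwa [hfdet]), hfdet, abs_inv]
    have h2 : T = (fun z => x + z) ∘ f := by
      funext z; simp [hT, hf]
    rw [h2, ← Measure.map_map (by fun_prop) (LinearMap.continuous_of_finiteDimensional f).measurable,
      h1, Measure.map_smul, map_add_left_eq_self]
  have hTm : Measurable T := by fun_prop
  have hcomp : (fun z : State d =>
      ENNReal.ofReal ((√((2 * Real.pi) ^ d))⁻¹ * Real.exp (-‖z‖ ^ 2 / 2))) =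
      fun z => ENNReal.ofReal |A.det| * g (T z) := by
    funext z
    have hq : quadForm S⁻¹ (T z - x) = ‖z‖ ^ 2 := by
      have h1 : (T z - x).ofLp = A.mulVec z.ofLp := by
        simp [hT]
      have h2 : A * (S⁻¹ * A) = 1 := by
        rw [← hAA, Matrix.mul_inv_rev, Matrix.mul_assoc, Matrix.nonsing_inv_mul _ hAu,
          Matrix.mul_one, Matrix.mul_nonsing_inv _ hAu]
      rw [quadForm, h1, norm_sq_eq_dotProduct, Matrix.mulVec_mulVec, Matrix.dotProduct_mulVec,
        ← Matrix.mulVec_transpose, Matrix.mulVec_mulVec, Matrix.transpose_mul,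
        dotProduct_comm]
      have h3 : (A.transpose * (S⁻¹).transpose) * A = 1 := by
        rw [hAsymm, Matrix.transpose_nonsing_inv, ← hAA, Matrix.transpose_mul, hAsymm, hAA,
          Matrix.mul_assoc, h2]
      rw [h3, Matrix.one_mulVec]
    simp only [hg, gaussDens, hq]
    rw [← ENNReal.ofReal_mul (abs_nonneg _), habs]
    congr 1
    rw [Real.sqrt_mul (by positivity), mul_inv, neg_div]
    have : √S.det ≠ 0 := (Real.sqrt_pos.2 hSpos).ne'
    field_simp
  rw [multivariateGaussian, stdGaussian_eq_withDensity, hcomp]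
  ext s hs
  rw [Measure.map_apply hTm hs, withDensity_apply _ (hTm hs), withDensity_apply _ hs,
    lintegral_const_mul _ (show Measurable fun z => g (T z) from hgm.comp hTm), ← setLIntegral_map hs hgm hTm, hmapvol,
    Measure.restrict_smul, lintegral_smul_measure, smul_eq_mul, ← mul_assoc,
    ← ENNReal.ofReal_mul (abs_nonneg _), mul_inv_cancel₀ (abs_ne_zero.2 hA0)]
  simp

/-- With the adjugate in place of the inverse, the matrix enters only through polynomials and the
scalar `(det S)⁻¹`. Measurability and continuity in the matrix are read off from this form. -/
lemma gaussDens_eq (S : Matrix (Fin d) (Fin d) ℝ) (z : State d) :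
    gaussDens S z = (√((2 * Real.pi) ^ d * S.det))⁻¹ *
      Real.exp (-((S.det)⁻¹ * quadForm S.adjugate z) / 2) := by
  rw [gaussDens, Matrix.inv_def, Ring.inverse_eq_inv']
  simp [quadForm, Matrix.smul_mulVec]

lemma continuous_quadForm_adjugate :
    Continuous fun q : (Fin d → Fin d → ℝ) × State d =>
      quadForm (Matrix.of q.1).adjugate q.2 := by
  unfold quadForm
  have h1 : Continuous fun q : (Fin d → Fin d → ℝ) × State d => Matrix.of q.1 :=
    continuous_fst
  have h2 := h1.matrix_adjugate
  have h3 : Continuous fun q : (Fin d → Fin d → ℝ) × State d => q.2.ofLp := by fun_prop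
  exact h3.dotProduct (h2.matrix_mulVec h3)

lemma continuous_det_of :
    Continuous fun a : Fin d → Fin d → ℝ => (Matrix.of a).det :=
  Continuous.matrix_det (A := fun a : Fin d → Fin d → ℝ => Matrix.of a) continuous_id

lemma measurable_gaussDens :
    Measurable fun q : (Fin d → Fin d → ℝ) × State d => gaussDens (Matrix.of q.1) q.2 := by
  simp only [gaussDens_eq]
  have h1 := (continuous_quadForm_adjugate (d := d)).measurable
  have h2 : Measurable fun q : (Fin d → Fin d → ℝ) × State d => (Matrix.of q.1).det :=
    continuous_det_of.measurable.comp measurable_fst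
  fun_prop

lemma continuous_gaussDens (S : Matrix (Fin d) (Fin d) ℝ) : Continuous (gaussDens S) := by
  unfold gaussDens
  simp only [quadForm_eq_inner]
  fun_prop

lemma gaussDens_nonneg (S : Matrix (Fin d) (Fin d) ℝ) (z : State d) : 0 ≤ gaussDens S z := by
  unfold gaussDens; positivity

lemma continuousOn_gaussDens (z : State d) :
    ContinuousOn (fun a : Fin d → Fin d → ℝ => gaussDens (Matrix.of a) z)
      {a | 0 < (Matrix.of a).det} := by
  simp only [gaussDens_eq]
  have h1 : Continuous fun a : Fin d → Fin d → ℝ => quadForm (Matrix.of a).adjugate z :=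
    continuous_quadForm_adjugate.comp (continuous_id.prodMk continuous_const)
  have h2 := continuous_det_of (d := d)
  intro a ha
  have ha : 0 < (Matrix.of a).det := ha
  have h3 : √((2 * Real.pi) ^ d * (Matrix.of a).det) ≠ 0 :=
    (Real.sqrt_pos.2 (mul_pos (by positivity) ha)).ne'
  apply ContinuousAt.continuousWithinAt
  refine ContinuousAt.mul (ContinuousAt.inv₀ (by fun_prop) h3) ?_
  have h4 := h2.continuousAt (x := a) |>.inv₀ ha.ne'
  exact ((h4.mul h1.continuousAt).neg.div_const 2).rexp

lemma quadForm_neg (S : Matrix (Fin d) (Fin d) ℝ) (z : State d) :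
    quadForm S (-z) = quadForm S z := by
  simp [quadForm, Matrix.mulVec_neg]

lemma gaussDens_neg (S : Matrix (Fin d) (Fin d) ℝ) (z : State d) :
    gaussDens S (-z) = gaussDens S z := by
  rw [gaussDens, gaussDens, quadForm_neg]

/-- Along a ray the Gaussian exponent is a quadratic polynomial in the radius. Only its leading and
constant coefficients need a name. -/
lemma quadForm_smul_sub (S : Matrix (Fin d) (Fin d) ℝ) (θ x : State d) :
    ∃ b : ℝ, ∀ r : ℝ,
      quadForm S (r • θ - x) = r ^ 2 * quadForm S θ - 2 * r * b + quadForm S x := by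
  refine ⟨(θ.ofLp ⬝ᵥ S.mulVec x.ofLp + x.ofLp ⬝ᵥ S.mulVec θ.ofLp) / 2, fun r => ?_⟩
  simp only [quadForm, WithLp.ofLp_sub, WithLp.ofLp_smul, Matrix.mulVec_sub, Matrix.mulVec_smul,
    dotProduct_sub, sub_dotProduct, smul_dotProduct, dotProduct_smul, smul_eq_mul]
  ring

/-! ### Covariance matrices bounded below -/

namespace UniformlyElliptic

variable {k : ℝ} {S : Matrix (Fin d) (Fin d) ℝ}

lemma posDef (h : UniformlyElliptic k S) (hk : 0 < k) : S.PosDef := by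
  refine Matrix.PosDef.of_dotProduct_mulVec_pos ?_ fun v hv => ?_
  · rw [Matrix.IsHermitian, Matrix.conjTranspose_eq_transpose_of_trivial, h.symm]
  · have := h.lower (WithLp.toLp 2 v)
    have h0 : 0 < ‖(WithLp.toLp 2 v : State d)‖ ^ 2 := by
      have : (WithLp.toLp 2 v : State d) ≠ 0 := by simpa using hv
      positivity
    simp only [star_trivial]
    exact lt_of_lt_of_le (mul_pos hk h0) this

lemma det_pos (h : UniformlyElliptic k S) (hk : 0 < k) : 0 < S.det := (h.posDef hk).det_pos

lemma quadForm_nonneg (h : UniformlyElliptic k S) (hk : 0 < k) (z : State d) :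
    0 ≤ quadForm S z := le_trans (by positivity) (h.lower z)

/-- The solution `w` of `S w = z` computes the quadratic form of the inverse. -/
lemma exists_preimage (h : UniformlyElliptic k S) (hk : 0 < k) (z : State d) :
    ∃ w : State d, S.mulVec w.ofLp = z.ofLp ∧ quadForm S⁻¹ z = inner ℝ w z ∧
      quadForm S w = inner ℝ w z := by
  refine ⟨WithLp.toLp 2 (S⁻¹.mulVec z.ofLp), ?_, ?_, ?_⟩
  · simp [Matrix.mulVec_mulVec, Matrix.mul_nonsing_inv _ (h.det_pos hk).ne'.isUnit]
  · simp [quadForm, PiLp.inner_apply, dotProduct]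
  · simp [quadForm, PiLp.inner_apply, dotProduct, Matrix.mulVec_mulVec,
      Matrix.mul_nonsing_inv _ (h.det_pos hk).ne'.isUnit, mul_comm]

/-- With `S w = z`, ellipticity and Cauchy–Schwarz give `k ‖w‖ ^ 2 ≤ ⟪w, z⟫ ≤ ‖w‖ ‖z‖`. -/
lemma quadForm_inv_le (h : UniformlyElliptic k S) (hk : 0 < k) (z : State d) :
    quadForm S⁻¹ z ≤ ‖z‖ ^ 2 / k := by
  obtain ⟨w, -, h2, h3⟩ := h.exists_preimage hk z
  have h4 := h.lower w
  have h5 := real_inner_le_norm w z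
  rw [h2, le_div_iff₀ hk]
  rw [h3] at h4
  have h6 : k * ‖w‖ ≤ ‖z‖ := by
    by_contra! hc
    have : 0 < ‖w‖ := by
      by_contra! h0
      have : ‖w‖ = 0 := le_antisymm h0 (norm_nonneg _)
      rw [this] at hc
      have := norm_nonneg z
      linarith
    nlinarith
  nlinarith [norm_nonneg z, norm_nonneg w]

lemma quadForm_inv_nonneg (h : UniformlyElliptic k S) (hk : 0 < k) (z : State d) :
    0 ≤ quadForm S⁻¹ z := by
  obtain ⟨w, -, h2, h3⟩ := h.exists_preimage hk z
  rw [h2, ← h3]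
  exact h.quadForm_nonneg hk w

/-- Expand the nonnegative number `quadForm S (w - Λ⁻¹ z)` with `S w = z`. -/
lemma le_quadForm_inv (h : UniformlyElliptic k S) (hk : 0 < k) {Λ : ℝ} (hΛ : 0 < Λ)
    (hup : ∀ z : State d, quadForm S z ≤ Λ * ‖z‖ ^ 2) (z : State d) :
    ‖z‖ ^ 2 / Λ ≤ quadForm S⁻¹ z := by
  obtain ⟨w, h1, h2, h3⟩ := h.exists_preimage hk z
  have h4 := h.quadForm_nonneg hk (w - Λ⁻¹ • z)
  have h5 := hup z
  have h6 : quadForm S (w - Λ⁻¹ • z) =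
      inner ℝ w z - 2 * Λ⁻¹ * ‖z‖ ^ 2 + Λ⁻¹ ^ 2 * quadForm S z := by
    have h7 : w.ofLp ⬝ᵥ S.mulVec z.ofLp = z.ofLp ⬝ᵥ S.mulVec w.ofLp := by
      rw [Matrix.dotProduct_mulVec, ← Matrix.mulVec_transpose, h.symm, dotProduct_comm]
    rw [← h3, norm_sq_eq_dotProduct]
    simp only [quadForm, WithLp.ofLp_sub, WithLp.ofLp_smul, Matrix.mulVec_sub, Matrix.mulVec_smul,
      dotProduct_sub, sub_dotProduct, smul_dotProduct, dotProduct_smul, smul_eq_mul, h7]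
    rw [h1]
    ring
  rw [h6] at h4
  rw [h2, div_eq_inv_mul]
  have h8 : Λ⁻¹ ^ 2 * quadForm S z ≤ Λ⁻¹ * ‖z‖ ^ 2 := by
    calc Λ⁻¹ ^ 2 * quadForm S z ≤ Λ⁻¹ ^ 2 * (Λ * ‖z‖ ^ 2) := by gcongr
      _ = Λ⁻¹ * ‖z‖ ^ 2 := by field_simp
  linarith

end UniformlyElliptic

lemma quadForm_le_of_entry_le {S : Matrix (Fin d) (Fin d) ℝ} {M : ℝ} (hM : 0 ≤ M)
    (hS : ∀ i j, |S i j| ≤ M) (z : State d) : quadForm S z ≤ d ^ 2 * M * ‖z‖ ^ 2 := by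
  have hz : ∀ i, |z i| ≤ ‖z‖ := fun i => PiLp.norm_apply_le z i
  have h1 : quadForm S z = ∑ i, ∑ j, z i * (S i j * z j) := by
    simp [quadForm, dotProduct, Matrix.mulVec, Finset.mul_sum]
  rw [h1]
  calc ∑ i, ∑ j, z i * (S i j * z j) ≤ ∑ i : Fin d, ∑ j : Fin d, M * ‖z‖ ^ 2 := by
        refine Finset.sum_le_sum fun i _ => Finset.sum_le_sum fun j _ => ?_
        refine (le_abs_self _).trans ?_
        rw [abs_mul, abs_mul]
        calc |z i| * (|S i j| * |z j|) ≤ ‖z‖ * (M * ‖z‖) := by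
              gcongr
              · exact hz i
              · exact hS i j
              · exact hz j
          _ = M * ‖z‖ ^ 2 := by ring
    _ = d ^ 2 * M * ‖z‖ ^ 2 := by simp; ring

lemma det_le_of_entry_le {S : Matrix (Fin d) (Fin d) ℝ} {M : ℝ}
    (hS : ∀ i j, |S i j| ≤ M) : S.det ≤ d.factorial * M ^ d := by
  have := Matrix.det_le (abv := AbsoluteValue.abs) hS
  simp only [Fintype.card_fin, nsmul_eq_mul] at this
  exact (le_abs_self _).trans this

/-! ### Tail behaviour of the target density -/

variable {d : ℕ} {p : State d → ℝ}

namespace SuperExpRegularContours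

lemma differentiable_log (hM : SuperExpRegularContours p) :
    Differentiable ℝ fun y => Real.log (p y) :=
  hM.differentiable.log fun x => (hM.pos x).ne'

lemma continuous (hM : SuperExpRegularContours p) : Continuous p := hM.differentiable.continuous

lemma exists_inner_gradient_log_le (hM : SuperExpRegularContours p) :
    ∃ ρ : ℝ, 1 < ρ ∧ ∀ K : ℝ, ∃ R : ℝ, ∀ x : State d, R ≤ ‖x‖ → x ≠ 0 →
      inner ℝ x (gradient (fun y => Real.log (p y)) x) ≤ -K * ‖x‖ ^ ρ := by
  obtain ⟨ρ, hρ, h⟩ := hM.superExp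
  refine ⟨ρ, hρ, fun K => ?_⟩
  have h1 := (EReal.tendsto_nhds_bot_iff_real.1 h (-K)).exists
  obtain ⟨R, hR⟩ := h1
  refine ⟨R, fun x hx hx0 => ?_⟩
  have h2 : ((inner ℝ ((‖x‖ ^ ρ)⁻¹ • x) (gradient (fun y => Real.log (p y)) x) : ℝ) : EReal)
      < ((-K : ℝ) : EReal) :=
    lt_of_le_of_lt (le_iSup₂ (f := fun (x : State d) (_ : R ≤ ‖x‖) =>
      ((inner ℝ ((‖x‖ ^ ρ)⁻¹ • x) (gradient (fun y => Real.log (p y)) x) : ℝ) : EReal)) x hx) hR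
  rw [EReal.coe_lt_coe_iff, real_inner_smul_left] at h2
  have h3 : 0 < ‖x‖ ^ ρ := Real.rpow_pos_of_pos (norm_pos_iff.2 hx0) _
  rw [inv_mul_lt_iff₀ h3] at h2
  linarith

lemma hasDerivAt_log_ray (hM : SuperExpRegularContours p) (z θ : State d) (r : ℝ) :
    HasDerivAt (fun r : ℝ => Real.log (p (z + r • θ)))
      (inner ℝ (gradient (fun y => Real.log (p y)) (z + r • θ)) θ) r := by
  have h1 := (hM.differentiable_log (z + r • θ)).hasGradientAt.hasFDerivAt
  have h2 : HasDerivAt (fun r : ℝ => z + r • θ) θ r := by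
    simpa using ((hasDerivAt_id r).smul_const θ).const_add z
  have := h1.comp_hasDerivAt r h2
  simpa [Function.comp_def] using this

/-- Along rays, `log p` decreases superlinearly. -/
lemma exists_radial_decay (hM : SuperExpRegularContours p) :
    ∃ ρ : ℝ, 1 < ρ ∧ ∀ K : ℝ, 0 ≤ K → ∃ R : ℝ, 1 ≤ R ∧ ∀ θ : State d, ‖θ‖ = 1 →
      ∀ r₁ r₂ : ℝ, R ≤ r₁ → r₁ ≤ r₂ →
        Real.log (p (r₂ • θ)) - Real.log (p (r₁ • θ)) ≤ -(K * r₁ ^ (ρ - 1)) * (r₂ - r₁) := by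
  obtain ⟨ρ, hρ, h⟩ := hM.exists_inner_gradient_log_le
  refine ⟨ρ, hρ, fun K hK => ?_⟩
  obtain ⟨R, hR⟩ := h K
  refine ⟨max R 1, le_max_right _ _, fun θ hθ r₁ r₂ h1 h2 => ?_⟩
  have hder : ∀ r : ℝ, HasDerivAt (fun r : ℝ => Real.log (p (r • θ)))
      (inner ℝ (gradient (fun y => Real.log (p y)) (r • θ)) θ) r := fun r => by
    simpa using hM.hasDerivAt_log_ray 0 θ r
  refine Convex.image_sub_le_mul_sub_of_deriv_le (convex_Icc r₁ r₂)
    (fun r _ => (hder r).continuousAt.continuousWithinAt)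
    (fun r _ => (hder r).differentiableAt.differentiableWithinAt) ?_ r₁ ⟨le_rfl, h2⟩ r₂
    ⟨h2, le_rfl⟩ h2
  intro r hr
  rw [interior_Icc] at hr
  have hr1 : max R 1 ≤ r := h1.trans hr.1.le
  have hr0 : 0 < r := lt_of_lt_of_le one_pos ((le_max_right _ _).trans hr1)
  have hn : ‖r • θ‖ = r := by rw [norm_smul, hθ, mul_one, Real.norm_of_nonneg hr0.le]
  have h3 := hR (r • θ) (by rw [hn]; exact (le_max_left _ _).trans hr1)
    (by rw [← norm_pos_iff, hn]; exact hr0)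
  rw [hn, real_inner_smul_left, real_inner_comm] at h3
  rw [(hder r).deriv]
  have h4 : r ^ ρ = r * r ^ (ρ - 1) := by
    rw [← Real.rpow_one_add' hr0.le (by linarith)]; congr 1; ring
  have h5 : inner ℝ (gradient (fun y => Real.log (p y)) (r • θ)) θ ≤ -K * r ^ (ρ - 1) := by
    rw [h4] at h3
    have : r * inner ℝ (gradient (fun y => Real.log (p y)) (r • θ)) θ ≤
      r * (-K * r ^ (ρ - 1)) := by linarith
    exact le_of_mul_le_mul_left this hr0
  have h6 : r₁ ^ (ρ - 1) ≤ r ^ (ρ - 1) :=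
    Real.rpow_le_rpow (by linarith [le_max_right R 1]) hr.1.le (by linarith)
  nlinarith

/-- Beyond a radius `R ≥ 1` the radial slope of `log p` is at most `-K`, and inside that radius
boundedness of `p` suffices. -/
lemma exists_le_exp_neg (hM : SuperExpRegularContours p) (K : ℝ) (hK : 0 ≤ K) :
    ∃ C : ℝ, 0 < C ∧ ∀ x, p x ≤ C * Real.exp (-K * ‖x‖) := by
  obtain ⟨ρ, hρ, h⟩ := hM.exists_radial_decay
  obtain ⟨R, hR1, hR⟩ := h K hK
  obtain ⟨B, hB⟩ := hM.bounded
  have hB0 : 0 < B := (hM.pos 0).trans_le (hB 0)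
  refine ⟨B * Real.exp (K * R), by positivity, fun x => ?_⟩
  rw [mul_assoc, ← Real.exp_add]
  rcases le_total ‖x‖ R with hx | hx
  · calc p x ≤ B * 1 := by simpa using hB x
      _ ≤ _ := by gcongr; rw [← Real.exp_zero]; gcongr; nlinarith
  · have hx0 : 0 < ‖x‖ := by linarith
    set θ := ‖x‖⁻¹ • x
    have hθ : ‖θ‖ = 1 := by simp [θ, norm_smul, hx0.ne']
    have hxθ : ‖x‖ • θ = x := by simp [θ, smul_smul, hx0.ne']
    have h1 := hR θ hθ R ‖x‖ le_rfl hx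
    rw [hxθ] at h1
    have h2 : Real.log (p (R • θ)) ≤ Real.log B := Real.log_le_log (hM.pos _) (hB _)
    have h3 : (1 : ℝ) ≤ R ^ (ρ - 1) := Real.one_le_rpow hR1 (by linarith)
    have h4 : Real.log (p x) ≤ Real.log B + (K * R + -K * ‖x‖) := by
      have : K * (‖x‖ - R) ≤ K * R ^ (ρ - 1) * (‖x‖ - R) := by
        have : 0 ≤ ‖x‖ - R := by linarith
        have := mul_le_mul_of_nonneg_left h3 hK
        nlinarith
      linarith
    calc p x = Real.exp (Real.log (p x)) := (Real.exp_log (hM.pos x)).symm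
      _ ≤ Real.exp (Real.log B + (K * R + -K * ‖x‖)) := Real.exp_le_exp.2 h4
      _ = _ := by rw [Real.exp_add, Real.exp_log hB0]

/-- The gradients of `p` and of `log p = ∇p / p` point the same way. Strict negativity of the
supremum also forces `∇p ≠ 0` far out, so dividing by its norm is legitimate. -/
lemma exists_regular (hM : SuperExpRegularContours p) :
    ∃ η R : ℝ, 0 < η ∧ 0 < R ∧ ∀ x : State d, R ≤ ‖x‖ →
      inner ℝ (‖x‖⁻¹ • x) (gradient (fun y => Real.log (p y)) x) ≤
        -η * ‖gradient (fun y => Real.log (p y)) x‖ := by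
  obtain ⟨R, hR, h⟩ := hM.regularContours
  obtain ⟨b, hb1, hb2⟩ := EReal.lt_iff_exists_real_btwn.1 h
  refine ⟨-b, R, by simpa using (EReal.coe_lt_coe_iff.1 hb2), hR, fun x hx => ?_⟩
  have h2 := lt_of_le_of_lt (le_iSup₂ (f := fun (x : State d) (_ : R ≤ ‖x‖) =>
      ((inner ℝ (‖x‖⁻¹ • x) (‖gradient p x‖⁻¹ • gradient p x) : ℝ) : EReal)) x hx) hb1
  rw [EReal.coe_lt_coe_iff, real_inner_smul_right] at h2
  have hg : gradient (fun y => Real.log (p y)) x = (p x)⁻¹ • gradient p x := by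
    have h3 := (hM.differentiable x).hasGradientAt.hasFDerivAt.log (hM.pos x).ne'
    have h4 : HasGradientAt (fun y => Real.log (p y)) ((p x)⁻¹ • gradient p x) x := by
      rw [hasGradientAt_iff_hasFDerivAt]
      rw [map_smulₛₗ]
      exact h3
    exact h4.gradient
  have hb0 : b < 0 := by simpa using (EReal.coe_lt_coe_iff.1 hb2)
  have hg0 : 0 < ‖gradient p x‖ := by
    rw [norm_pos_iff]; intro h0; rw [h0] at h2; simp at h2; linarith
  rw [hg, real_inner_smul_right, norm_smul, Real.norm_of_nonneg (inv_nonneg.2 (hM.pos x).le)]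
  rw [inv_mul_lt_iff₀ hg0] at h2
  have := inv_pos.2 (hM.pos x)
  nlinarith

end SuperExpRegularContours

/-! ### Losses against gains along a single ray -/

lemma lintegral_exp_shift {E κ r₀ : ℝ} (hE : 0 ≤ E) (hκ : 0 < κ) :
    ∫⁻ r in Set.Ioi r₀, ENNReal.ofReal (E * Real.exp (-κ * (r - r₀))) = ENNReal.ofReal (E / κ) := by
  have h1 : (fun r : ℝ => E * Real.exp (-κ * (r - r₀))) =
      fun r => (E * Real.exp (κ * r₀)) * Real.exp (-κ * r) := by
    funext r; rw [mul_assoc, ← Real.exp_add]; congr 2; ring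
  have hint : IntegrableOn (fun r : ℝ => E * Real.exp (-κ * (r - r₀))) (Set.Ioi r₀) := by
    rw [h1]
    exact (integrableOn_exp_mul_Ioi (by linarith) r₀).const_mul _
  rw [← ofReal_integral_eq_lintegral_ofReal hint (ae_of_all _ fun r => by positivity), h1,
    integral_const_mul, integral_exp_mul_Ioi (by linarith)]
  congr 1
  rw [mul_assoc, neg_div_neg_eq, ← mul_div_assoc, ← Real.exp_add]
  simp
  ring

set_option maxHeartbeats 400000 in
/-- One-dimensional comparison, along a ray, between the mass of a superexponentially decaying
function beyond the radius `r₀` and the mass just below `r₀`, uniformly over Gaussian weights. -/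
lemma exists_ray_comparison {t β ρ ε : ℝ} (ht : t ∈ Set.Ioo (0 : ℝ) 1) (hβ : 0 < β) (hρ : 1 < ρ)
    (hε : 0 < ε) (n : ℕ) :
    ∃ K R₀ : ℝ, 0 < K ∧ 2 ≤ R₀ ∧ ∀ r₀, R₀ ≤ r₀ → ∀ ℓ : ℝ → ℝ, ∀ a b c : ℝ,
      0 ≤ a → 2 * a ≤ β → (∀ r, 0 ≤ a * r ^ 2 - b * r + c) →
      (∀ r, r₀ < r → ℓ r ≤ -(K * r₀ ^ (ρ - 1)) * (r - r₀)) →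
      (∀ r, r₀ / 2 ≤ r → r ≤ r₀ → K * (r₀ / 2) ^ (ρ - 1) * (r₀ - r) ≤ ℓ r) →
      ∫⁻ r in Set.Ioi r₀, ENNReal.ofReal
          (Real.exp ((1 - t) * ℓ r) * Real.exp (-(a * r ^ 2 - b * r + c)) * r ^ n) ≤
        2⁻¹ * (∫⁻ r in Set.Ioo (r₀ / 2) r₀, ENNReal.ofReal
          ((1 - Real.exp (-(t * ℓ r))) * Real.exp (-(a * r ^ 2 - b * r + c)) * r ^ n)) +
        ENNReal.ofReal ε := by
  obtain ⟨ht0, ht1⟩ := ht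
  have h1t : 0 < 1 - t := by linarith
  set γ : ℝ := (2⁻¹ : ℝ) ^ (ρ - 1) with hγ
  have hγ0 : 0 < γ := Real.rpow_pos_of_pos (by norm_num) _
  -- `G` bounds the variation of the Gaussian weight over the strip just below `r₀`: `1` from the
  -- linear term, `β / 2` from the quadratic one.
  set G : ℝ := Real.exp (1 + β / 2) with hG
  have hG0 : 0 < G := Real.exp_pos _
  -- One summand per requirement: the decay beyond `r₀` must beat `r ^ n` and the growth of the
  -- weight, the outer mass must be at most half the inner one, and `t * ℓ ≥ 1` must hold on the
  -- strip.
  set K : ℝ := 2 * (n + 4) / (1 - t) + 16 * 2 ^ n * G / (1 - t) + 2 / (t * γ) with hK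
  have hK0 : 0 < K := by positivity
  have hK1 : 2 * (n + 4) ≤ (1 - t) * K := by
    have : 0 ≤ 16 * 2 ^ n * G / (1 - t) + 2 / (t * γ) := by positivity
    calc (2 * (n + 4) : ℝ) = (1 - t) * (2 * (n + 4) / (1 - t)) := by field_simp
      _ ≤ _ := by gcongr; linarith
  have hK2 : 16 * 2 ^ n * G ≤ (1 - t) * K := by
    have : 0 ≤ 2 * (n + 4) / (1 - t) + 2 / (t * γ) := by positivity
    calc (16 * 2 ^ n * G : ℝ) = (1 - t) * (16 * 2 ^ n * G / (1 - t)) := by field_simp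
      _ ≤ _ := by gcongr; linarith
  have hK3 : 2 ≤ t * γ * K := by
    have : 0 ≤ 2 * (n + 4) / (1 - t) + 16 * 2 ^ n * G / (1 - t) := by positivity
    calc (2 : ℝ) = t * γ * (2 / (t * γ)) := by field_simp
      _ ≤ _ := by gcongr; linarith
  have hlim : Tendsto (fun r : ℝ => 2 * r ^ n * Real.exp (-(r ^ (ρ - 1)))) atTop (𝓝 0) := by
    have h1 := (tendsto_rpow_mul_exp_neg_mul_atTop_nhds_zero (n / (ρ - 1)) 1 one_pos).comp
      (tendsto_rpow_atTop (y := ρ - 1) (by linarith))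
    have h2 := h1.const_mul 2
    rw [mul_zero] at h2
    refine h2.congr' ?_
    filter_upwards [eventually_gt_atTop 0] with r hr
    simp only [Function.comp, neg_mul, one_mul, mul_assoc]
    rw [← Real.rpow_mul hr.le, mul_div_cancel₀ _ (by linarith), Real.rpow_natCast]
  have hev : ∀ᶠ r : ℝ in atTop, 2 * r ^ n * Real.exp (-(r ^ (ρ - 1))) ≤ ε ∧ 4 * β ≤ r ^ (ρ - 1) :=
    (hlim.eventually (eventually_le_nhds hε)).and
      ((tendsto_rpow_atTop (y := ρ - 1) (by linarith)).eventually_ge_atTop _)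
  obtain ⟨R₁, hR₁⟩ := eventually_atTop.1 hev
  refine ⟨K, max R₁ 2, hK0, le_max_right _ _, fun r₀ hr₀ ℓ a b c ha haβ hφ hout hin => ?_⟩
  have hr2 : 2 ≤ r₀ := (le_max_right _ _).trans hr₀
  have hr0 : 0 < r₀ := by linarith
  obtain ⟨hR1, hR2⟩ := hR₁ r₀ ((le_max_left _ _).trans hr₀)
  set lam : ℝ := r₀ ^ (ρ - 1) with hlam
  have hlam1 : 1 ≤ lam := Real.one_le_rpow (by linarith) (by linarith)
  have hlam0 : 0 < lam := by linarith
  set φ : ℝ → ℝ := fun r => a * r ^ 2 - b * r + c with hφdef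
  set g : ℝ := 2 * a * r₀ - b with hg
  have hexp : ∀ τ, φ (r₀ + τ) = φ r₀ + g * τ + a * τ ^ 2 := fun τ => by simp only [φ, hg]; ring
  have hpow : ∀ r, r₀ < r → r ^ n ≤ r₀ ^ n * Real.exp (n * (r - r₀)) := fun r hr => by
    rw [Real.exp_nat_mul, ← mul_pow]
    apply pow_le_pow_left₀ (by linarith)
    have h1 := mul_le_mul_of_nonneg_left (Real.add_one_le_exp (r - r₀)) hr0.le
    have h2 : 0 ≤ (r₀ - 1) * (r - r₀) := mul_nonneg (by linarith) (by linarith)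
    linarith
  have hu : ∀ r, r₀ < r → Real.exp ((1 - t) * ℓ r) ≤
      Real.exp (-((1 - t) * K * lam * (r - r₀))) := fun r hr => by
    apply Real.exp_le_exp.2
    have := mul_le_mul_of_nonneg_left (hout r hr) h1t.le
    linarith
  change ∫⁻ r in Set.Ioi r₀, ENNReal.ofReal
          (Real.exp ((1 - t) * ℓ r) * Real.exp (-φ r) * r ^ n) ≤
        2⁻¹ * (∫⁻ r in Set.Ioo (r₀ / 2) r₀, ENNReal.ofReal
          ((1 - Real.exp (-(t * ℓ r))) * Real.exp (-φ r) * r ^ n)) + ENNReal.ofReal ε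
  -- `g` is the slope of the Gaussian exponent `φ` at `r₀`. If `g ≥ -lam`, the weight grows at rate
  -- at most `lam` beyond `r₀`, which the decay of `ℓ` absorbs. Otherwise `φ` falls steeply while
  -- staying nonnegative with bounded curvature, so the weight is tiny near `r₀` and the outer mass
  -- is below `ε`.
  rcases le_total (-lam) g with hgl | hgl
  · set E : ℝ := Real.exp (-φ r₀) * r₀ ^ n with hE
    have hE0 : 0 ≤ E := by positivity
    set κ : ℝ := (1 - t) * K / 2 * lam with hκ
    have hκ0 : 0 < κ := by positivity
    have houter : ∫⁻ r in Set.Ioi r₀, ENNReal.ofReal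
          (Real.exp ((1 - t) * ℓ r) * Real.exp (-φ r) * r ^ n) ≤ ENNReal.ofReal (E / κ) := by
      rw [← lintegral_exp_shift hE0 hκ0 (r₀ := r₀)]
      refine setLIntegral_mono' measurableSet_Ioi fun r hr => ENNReal.ofReal_le_ofReal ?_
      have hr : r₀ < r := hr
      have hφr : -φ r ≤ -φ r₀ + lam * (r - r₀) := by
        have := hexp (r - r₀)
        rw [add_sub_cancel] at this
        have h1 : 0 ≤ a * (r - r₀) ^ 2 := by positivity
        have h2 : 0 ≤ (g + lam) * (r - r₀) := mul_nonneg (by linarith) (by linarith)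
        linarith
      calc Real.exp ((1 - t) * ℓ r) * Real.exp (-φ r) * r ^ n
          ≤ Real.exp (-((1 - t) * K * lam * (r - r₀))) * Real.exp (-φ r₀ + lam * (r - r₀)) *
            (r₀ ^ n * Real.exp (n * (r - r₀))) := by
            gcongr
            · have : 0 < r := by linarith
              positivity
            · exact Real.exp_le_exp.1 (hu r hr)
            · exact hpow r hr
        _ = E * Real.exp (-((1 - t) * K * lam * (r - r₀)) + lam * (r - r₀) + n * (r - r₀)) := by
            rw [hE, Real.exp_add, Real.exp_add, Real.exp_add]; ring
        _ ≤ E * Real.exp (-κ * (r - r₀)) := by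
            gcongr
            have h1 : lam + n ≤ (1 - t) * K / 2 * lam := by
              have h3 : (n : ℝ) ≤ n * lam := le_mul_of_one_le_right (Nat.cast_nonneg n) hlam1
              have h4 := mul_le_mul_of_nonneg_right hK1 hlam0.le
              linarith
            rw [hκ]
            have h2 : 0 ≤ ((1 - t) * K / 2 * lam - (lam + n)) * (r - r₀) :=
              mul_nonneg (by linarith) (by linarith)
            linarith
    have hinner : ENNReal.ofReal (E / (8 * lam * G * 2 ^ n) * 2) ≤
        ∫⁻ r in Set.Ioo (r₀ / 2) r₀, ENNReal.ofReal
          ((1 - Real.exp (-(t * ℓ r))) * Real.exp (-φ r) * r ^ n) := by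
      have hl1 : lam⁻¹ ≤ 1 := inv_le_one_of_one_le₀ hlam1
      have hl0 : 0 < lam⁻¹ := inv_pos.2 hlam0
      -- The strip at distance between `lam⁻¹ / 2` and `lam⁻¹` below `r₀` is far enough for `t * ℓ ≥
      -- 1` and close enough for the weight to stay comparable with its value at `r₀`.
      have hsub : Set.Ioo (r₀ - lam⁻¹) (r₀ - lam⁻¹ / 2) ⊆ Set.Ioo (r₀ / 2) r₀ := fun r hr =>
        ⟨by have := hr.1; linarith, by have := hr.2; linarith⟩
      refine le_trans ?_ (lintegral_mono_set hsub)
      calc ENNReal.ofReal (E / (8 * lam * G * 2 ^ n) * 2)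
          = ∫⁻ r in Set.Ioo (r₀ - lam⁻¹) (r₀ - lam⁻¹ / 2),
              ENNReal.ofReal (E / (2 * G * 2 ^ n)) := by
            rw [setLIntegral_const, Real.volume_Ioo, ← ENNReal.ofReal_mul (by positivity)]
            congr 1
            field_simp
            ring
        _ ≤ _ := by
            refine setLIntegral_mono' measurableSet_Ioo fun r hr => ENNReal.ofReal_le_ofReal ?_
            have hτ1 : r₀ - r ≤ lam⁻¹ := by have := hr.1; linarith
            have hτ2 : lam⁻¹ / 2 ≤ r₀ - r := by have := hr.2; linarith
            have hτ0 : 0 < r₀ - r := by linarith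
            have hrr : r₀ / 2 ≤ r := by linarith
            have h1 : 1 ≤ t * ℓ r := by
              have h2 := hin r hrr (by linarith)
              have h3 : (r₀ / 2) ^ (ρ - 1) = lam * γ := by
                rw [div_eq_mul_inv, Real.mul_rpow hr0.le (by norm_num)]
              rw [h3] at h2
              have h4 : K * (lam * γ) * (lam⁻¹ / 2) ≤ K * (lam * γ) * (r₀ - r) := by gcongr
              have h5 : K * (lam * γ) * (lam⁻¹ / 2) = K * γ / 2 := by field_simp
              have h6 := mul_le_mul_of_nonneg_left ((h5 ▸ h4).trans h2) ht0.le
              linarith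
            have h2 : (1 : ℝ) / 2 ≤ 1 - Real.exp (-(t * ℓ r)) := by
              have h3 : Real.exp (-(t * ℓ r)) ≤ Real.exp (-1) := Real.exp_le_exp.2 (by linarith)
              have h4 : Real.exp (-1) ≤ 1 / 2 := by
                rw [Real.exp_neg]
                have := Real.add_one_le_exp 1
                rw [one_div]
                apply inv_anti₀ (by norm_num) (by linarith)
              linarith
            have h3 : Real.exp (-φ r₀) * G⁻¹ ≤ Real.exp (-φ r) := by
              rw [hG, ← Real.exp_neg, ← Real.exp_add]
              apply Real.exp_le_exp.2
              have h4 := hexp (r - r₀)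
              rw [add_sub_cancel] at h4
              have h5 : a * (r - r₀) ^ 2 ≤ β / 2 := by
                have h6 : (r - r₀) ^ 2 ≤ 1 :=
                  (sq_le_one_iff_abs_le_one _).2 (abs_le.2 ⟨by linarith, by linarith⟩)
                have h7 := mul_le_mul_of_nonneg_left h6 ha
                linarith
              have h6 : g * (r - r₀) ≤ 1 := by
                have h7 : lam * (r₀ - r) ≤ 1 := by
                  calc lam * (r₀ - r) ≤ lam * lam⁻¹ := by gcongr
                    _ = 1 := mul_inv_cancel₀ hlam0.ne'
                have h8 := mul_le_mul_of_nonneg_right hgl hτ0.le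
                linarith
              linarith
            calc E / (2 * G * 2 ^ n) = 1 / 2 * (Real.exp (-φ r₀) * G⁻¹) * (r₀ / 2) ^ n := by
                  rw [hE, div_pow]; field_simp
              _ ≤ _ := by gcongr
    refine (houter.trans ?_).trans (add_le_add (mul_le_mul_right hinner 2⁻¹) zero_le)
    rw [add_zero, show (2⁻¹ : ℝ≥0∞) = ENNReal.ofReal 2⁻¹ by
      rw [ENNReal.ofReal_inv_of_pos (by norm_num)]; simp, ← ENNReal.ofReal_mul (by norm_num)]
    apply ENNReal.ofReal_le_ofReal
    have : E / κ ≤ E / (8 * lam * G * 2 ^ n) := by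
      gcongr
      rw [hκ]
      have := mul_le_mul_of_nonneg_right hK2 hlam0.le
      linarith
    linarith
  · refine le_trans ?_ le_add_self
    have hE0 : (0 : ℝ) ≤ 2 * r₀ ^ n * Real.exp (-lam) := by positivity
    have h0 := lintegral_exp_shift (r₀ := r₀) hE0 one_pos
    rw [div_one] at h0
    refine le_trans ?_ (h0.le.trans (ENNReal.ofReal_le_ofReal hR1))
    refine setLIntegral_mono' measurableSet_Ioi fun r hr => ENNReal.ofReal_le_ofReal ?_
    have hr : r₀ < r := hr
    have hτ : 0 < r - r₀ := by linarith
    have hn0 : (0 : ℝ) ≤ n := Nat.cast_nonneg n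
    have h2 : Real.exp (-((1 - t) * K * lam * (r - r₀))) * Real.exp (-φ r) ≤
        Real.exp (-lam - (n + 1) * (r - r₀)) := by
      rw [← Real.exp_add]
      apply Real.exp_le_exp.2
      have h3 : (2 * (n + 4)) * (lam * (r - r₀)) ≤ (1 - t) * K * (lam * (r - r₀)) := by gcongr
      have h6 : r - r₀ ≤ lam * (r - r₀) := le_mul_of_one_le_left hτ.le hlam1
      have h7 : (n : ℝ) * (r - r₀) ≤ n * (lam * (r - r₀)) := by gcongr
      have h8 : 0 ≤ (n : ℝ) * (lam * (r - r₀)) := by positivity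
      have h9 := hφ r
      rcases le_total (r - r₀) 1 with h4 | h4
      -- The slope `s` of `φ` at `r` is at most `-(3/4) * lam`. Nonnegativity of `φ` at `r + lam /
      -- (2β)` and `2a ≤ β` give `φ r ≥ lam ^ 2 / (4β) ≥ lam`.
      · have hφr : lam ≤ φ r := by
          set s := g + 2 * a * (r - r₀) with hs
          have h10 : s ≤ -(lam - β) := by
            have h11 := mul_le_mul haβ h4 hτ.le hβ.le
            linarith
          have h11 : ∀ σ, 0 ≤ φ r + s * σ + a * σ ^ 2 := fun σ => by
            have h12 := hφ (r + σ)
            have : φ r + s * σ + a * σ ^ 2 = a * (r + σ) ^ 2 - b * (r + σ) + c := by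
              simp only [φ, hs, hg]; ring
            rw [this]; exact h12
          have h13 := h11 2
          have h14 := h11 (lam / β / 2)
          have h15 : s ≤ -(3 / 4) * lam := by linarith
          have h16 : a * (lam / β / 2) ^ 2 ≤ lam ^ 2 / β / 8 := by
            calc a * (lam / β / 2) ^ 2 ≤ β / 2 * (lam / β / 2) ^ 2 := by gcongr; linarith
              _ = lam ^ 2 / β / 8 := by field_simp; ring
          have h17 : s * (lam / β / 2) ≤ -(3 / 4) * lam * (lam / β / 2) := by gcongr
          have h18 : -(3 / 4) * lam * (lam / β / 2) = - (3 / 8) * (lam ^ 2 / β) := by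
            field_simp; ring
          have h19 : 4 * lam ≤ lam ^ 2 / β := by
            rw [le_div_iff₀ hβ]
            have := mul_le_mul_of_nonneg_left hR2 hlam0.le
            linarith
          linarith
        linarith
      · have : lam ≤ lam * (r - r₀) := le_mul_of_one_le_right hlam0.le h4
        change 0 ≤ φ r at h9
        linarith
    calc Real.exp ((1 - t) * ℓ r) * Real.exp (-φ r) * r ^ n
        ≤ (Real.exp (-((1 - t) * K * lam * (r - r₀))) * Real.exp (-φ r)) *
            (r₀ ^ n * Real.exp (n * (r - r₀))) := by
          gcongr
          · have : 0 < r := by linarith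
            positivity
          · exact Real.exp_le_exp.1 (hu r hr)
          · exact hpow r hr
      _ ≤ Real.exp (-lam - (n + 1) * (r - r₀)) * (r₀ ^ n * Real.exp (n * (r - r₀))) := by gcongr
      _ = r₀ ^ n * Real.exp (-lam) * Real.exp (-1 * (r - r₀)) := by
          have : Real.exp (-lam - (n + 1) * (r - r₀)) * (r₀ ^ n * Real.exp (n * (r - r₀))) =
            r₀ ^ n * (Real.exp (-lam - (n + 1) * (r - r₀)) * Real.exp (n * (r - r₀))) := by ring
          rw [this, mul_assoc, ← Real.exp_add, ← Real.exp_add]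
          congr 2; ring
      _ ≤ 2 * r₀ ^ n * Real.exp (-lam) * Real.exp (-1 * (r - r₀)) := by
          gcongr
          have : 0 ≤ r₀ ^ n := by positivity
          linarith

/-! ### Gains exceed losses far from the origin -/

variable {d : ℕ} {p : State d → ℝ}

lemma lintegral_polar (hd : 0 < d) {F : State d → ℝ≥0∞} (hF : Measurable F) :
    ∫⁻ y, F y = ∫⁻ θ : Metric.sphere (0 : State d) 1,
      (∫⁻ r in Set.Ioi (0 : ℝ), F (r • θ.1) * ENNReal.ofReal (r ^ (d - 1)))
        ∂(volume : Measure (State d)).toSphere := by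
  have : Nonempty (Fin d) := ⟨⟨0, hd⟩⟩
  have hmp := (volume : Measure (State d)).measurePreserving_homeomorphUnitSphereProd
  rw [finrank_euclideanSpace_fin] at hmp
  have hcont : Continuous fun z : Metric.sphere (0 : State d) 1 × Set.Ioi (0 : ℝ) =>
      z.2.1 • z.1.1 := by fun_prop
  have hFm : Measurable fun z : Metric.sphere (0 : State d) 1 × Set.Ioi (0 : ℝ) =>
      F (z.2.1 • z.1.1) := hF.comp hcont.measurable
  have h1 : ∫⁻ y, F y = ∫⁻ z : ({0}ᶜ : Set (State d)), F z.1 ∂(volume.comap Subtype.val) := by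
    rw [lintegral_subtype_comap (measurableSet_singleton _).compl F,
      restrict_compl_singleton]
  have h2 : ∫⁻ z : ({0}ᶜ : Set (State d)), F z.1 ∂(volume.comap Subtype.val) =
      ∫⁻ z, F (z.2.1 • z.1.1)
        ∂((volume : Measure (State d)).toSphere.prod (Measure.volumeIoiPow (d - 1))) := by
    rw [← hmp.lintegral_comp hFm]
    refine lintegral_congr fun z => ?_
    have hz : ‖z.1‖ ≠ 0 := norm_ne_zero_iff.2 z.2
    simp [homeomorphUnitSphereProd, smul_smul, hz]
  rw [h1, h2, lintegral_prod _ hFm.aemeasurable]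
  refine lintegral_congr fun θ => ?_
  have hm : Measurable fun r : Set.Ioi (0 : ℝ) => F (r.1 • θ.1) :=
    hF.comp (hcont.comp (Continuous.prodMk continuous_const continuous_id)).measurable
  rw [Measure.volumeIoiPow, lintegral_withDensity_eq_lintegral_mul _ (by fun_prop) hm]
  rw [← lintegral_subtype_comap measurableSet_Ioi]
  refine lintegral_congr fun r => ?_
  simp [mul_comm]

lemma norm_normalize_sub_normalize_le {x z : State d} (hx : x ≠ 0) (hz : z ≠ 0) :
    ‖‖x‖⁻¹ • x - ‖z‖⁻¹ • z‖ ≤ 2 * ‖x - z‖ / ‖x‖ := by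
  have hx' : 0 < ‖x‖ := norm_pos_iff.2 hx
  have hz' : 0 < ‖z‖ := norm_pos_iff.2 hz
  have h1 : ‖x‖⁻¹ • x - ‖z‖⁻¹ • z = ‖x‖⁻¹ • (x - z) + (‖x‖⁻¹ - ‖z‖⁻¹) • z := by
    rw [smul_sub, sub_smul]; abel
  have h2 : ‖(‖x‖⁻¹ - ‖z‖⁻¹) • z‖ ≤ ‖x - z‖ / ‖x‖ := by
    have : ‖x‖⁻¹ - ‖z‖⁻¹ = (‖z‖ - ‖x‖) / (‖x‖ * ‖z‖) := by field_simp
    rw [norm_smul, this, norm_div, Real.norm_of_nonneg (by positivity : 0 ≤ ‖x‖ * ‖z‖)]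
    have h3 := abs_norm_sub_norm_le x z
    rw [abs_sub_comm] at h3
    rw [Real.norm_eq_abs]
    calc |‖z‖ - ‖x‖| / (‖x‖ * ‖z‖) * ‖z‖ = |‖z‖ - ‖x‖| / ‖x‖ := by field_simp
      _ ≤ _ := by gcongr
  have h4 : ‖‖x‖⁻¹ • (x - z)‖ = ‖x - z‖ / ‖x‖ := by
    rw [norm_smul, norm_inv, norm_norm, inv_mul_eq_div]
  rw [h1]
  calc _ ≤ _ := norm_add_le _ _
    _ ≤ ‖x - z‖ / ‖x‖ + ‖x - z‖ / ‖x‖ := add_le_add h4.le h2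
    _ = _ := by ring

namespace SuperExpRegularContours

/-- Far out, `log p` increases by at least `K` on a ball of fixed radius next to `x`. -/
lemma exists_ball_log_ge (hM : SuperExpRegularContours p) :
    ∃ η : ℝ, 0 < η ∧ η ≤ 1 ∧ ∀ K : ℝ, 0 < K → ∃ R : ℝ, 1 ≤ R ∧ ∀ x e : State d, R ≤ ‖x‖ →
      ‖e‖ ≤ η → K ≤ Real.log (p (x + (e - ‖x‖⁻¹ • x))) - Real.log (p x) := by
  obtain ⟨η, R₁, hη, hR₁, h1⟩ := hM.exists_regular
  obtain ⟨ρ, hρ, h2⟩ := hM.exists_inner_gradient_log_le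
  set m := min η 1 with hm
  have hm0 : 0 < m := lt_min hη one_pos
  have hm1 : m ≤ 1 := min_le_right _ _
  have hmη : m ≤ η := min_le_left _ _
  refine ⟨m / 3, by positivity, by linarith, fun K hK => ?_⟩
  obtain ⟨R₂, h2⟩ := h2 (3 * K / m)
  -- The `3` keeps the segment, of length at most `4/3`, in the region where both tail bounds hold.
  -- The bound `8 / m` keeps the radial direction within `m / 3` of its value at `x`.
  refine ⟨max (max R₁ R₂ + 3) (8 / m) , ?_, fun x e hx he => ?_⟩
  · have := le_max_left (max R₁ R₂ + 3) (8 / m)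
    have := le_max_left R₁ R₂
    linarith
  have hx1 : max R₁ R₂ + 3 ≤ ‖x‖ := (le_max_left _ _).trans hx
  have hx2 : 8 / m ≤ ‖x‖ := (le_max_right _ _).trans hx
  have hR1 := le_max_left R₁ R₂
  have hR2 := le_max_right R₁ R₂
  have hx0 : 0 < ‖x‖ := by linarith
  have hxne : x ≠ 0 := norm_pos_iff.1 hx0
  set ξ := e - ‖x‖⁻¹ • x with hξ
  have hξn : ‖ξ‖ ≤ 4 / 3 := by
    have h3 : ‖‖x‖⁻¹ • x‖ = 1 := by simp [norm_smul, hx0.ne']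
    have := norm_sub_le e (‖x‖⁻¹ • x)
    linarith
  have hder := fun τ => hM.hasDerivAt_log_ray x ξ τ
  have hmono := Convex.mul_sub_le_image_sub_of_le_deriv (convex_Icc (0 : ℝ) 1)
    (f := fun τ : ℝ => Real.log (p (x + τ • ξ)))
    (fun r _ => (hder r).continuousAt.continuousWithinAt)
    (fun r _ => (hder r).differentiableAt.differentiableWithinAt) (C := K) ?_ 0 (by simp) 1 (by simp)
    zero_le_one
  · simpa using hmono
  intro τ hτ
  rw [interior_Icc] at hτ
  rw [(hder τ).deriv]
  set z := x + τ • ξ with hz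
  set g := gradient (fun y => Real.log (p y)) z with hg
  have hxz : ‖x - z‖ ≤ 4 / 3 := by
    rw [hz]
    simp only [sub_add_cancel_left, norm_neg, norm_smul, Real.norm_of_nonneg hτ.1.le]
    have := hτ.2; have := hτ.1; have := norm_nonneg ξ
    nlinarith
  have hzn : max R₁ R₂ + 1 ≤ ‖z‖ := by
    have := norm_sub_norm_le x z
    linarith
  have hz0 : 0 < ‖z‖ := by linarith
  have hzne : z ≠ 0 := norm_pos_iff.1 hz0
  have h3 := h1 z (by linarith)
  have h4 := h2 z (by linarith) hzne
  rw [← hg] at h3 h4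
  have h5 : 3 * K / m ≤ ‖g‖ := by
    have h6 := neg_le_of_abs_le (abs_real_inner_le_norm z g)
    have h7 : ‖z‖ ≤ ‖z‖ ^ ρ := Real.self_le_rpow_of_one_le (by linarith) hρ.le
    have h8 : 3 * K / m * ‖z‖ ≤ 3 * K / m * ‖z‖ ^ ρ := by gcongr
    have h9 : 3 * K / m * ‖z‖ ≤ ‖g‖ * ‖z‖ := by linarith
    exact le_of_mul_le_mul_right h9 hz0
  -- Moving inward from `z` gains at least `m ‖g‖`. The perturbation `e` and the rotation of the
  -- radial direction each cost at most `m ‖g‖ / 3`, and the remaining third is at least `K`.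
  have h6 : inner ℝ g ξ = inner ℝ g e - inner ℝ g (‖x‖⁻¹ • x - ‖z‖⁻¹ • z) -
      inner ℝ (‖z‖⁻¹ • z) g := by
    rw [real_inner_comm g, hξ, inner_sub_right, inner_sub_right]
    rw [real_inner_comm (‖z‖⁻¹ • z) g]
    ring
  have h7 : ‖‖x‖⁻¹ • x - ‖z‖⁻¹ • z‖ ≤ m / 3 := by
    refine (norm_normalize_sub_normalize_le hxne hzne).trans ?_
    rw [div_le_iff₀ hx0]
    rw [div_le_iff₀ hm0] at hx2
    linarith
  have h8 := neg_le_of_abs_le (abs_real_inner_le_norm g e)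
  have h9 := le_of_abs_le (abs_real_inner_le_norm g (‖x‖⁻¹ • x - ‖z‖⁻¹ • z))
  have h10 : ‖g‖ * ‖e‖ ≤ ‖g‖ * (m / 3) := by gcongr
  have h11 : ‖g‖ * ‖‖x‖⁻¹ • x - ‖z‖⁻¹ • z‖ ≤ ‖g‖ * (m / 3) := by gcongr
  have h12 : m * ‖g‖ ≤ η * ‖g‖ := by gcongr
  rw [div_le_iff₀ hm0] at h5
  rw [h6]
  linarith

end SuperExpRegularContours

/-- The Gaussian weight `exp (-z S⁻¹ z / 2)`. -/
noncomputable def gaussWeight (S : Matrix (Fin d) (Fin d) ℝ) (z : State d) : ℝ :=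
  Real.exp (-quadForm S⁻¹ z / 2)

lemma continuous_gaussWeight (S : Matrix (Fin d) (Fin d) ℝ) : Continuous (gaussWeight S) := by
  unfold gaussWeight
  simp only [quadForm_eq_inner]
  fun_prop

/-- The mass gained by moving into the region of higher density. -/
noncomputable def gainDens (p : State d → ℝ) (t : ℝ) (S : Matrix (Fin d) (Fin d) ℝ)
    (x y : State d) : ℝ :=
  (1 - Real.exp (-(t * (Real.log (p y) - Real.log (p x))))) * gaussWeight S (y - x)

/-- The mass lost by moving into the region of lower density. -/
noncomputable def lossDens (p : State d → ℝ) (t : ℝ) (S : Matrix (Fin d) (Fin d) ℝ)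
    (x y : State d) : ℝ :=
  Real.exp ((1 - t) * (Real.log (p y) - Real.log (p x))) * gaussWeight S (y - x)

/-- On a ball of fixed radius around `x - x / ‖x‖`, `log p` exceeds its value at `x` by `1 / t`, so
the gain factor is at least `1 - e⁻¹ ≥ 1/2`. Points there are within distance `2` of `x`, and for `S
≥ k` the unnormalized Gaussian weight is bounded below no matter how large `S` is. -/
lemma SuperExpRegularContours.exists_gain_ge (hM : SuperExpRegularContours p)
    {t k : ℝ} (ht : 0 < t) (hk : 0 < k) :
    ∃ c R : ℝ, 0 < c ∧ ∀ S : Matrix (Fin d) (Fin d) ℝ, UniformlyElliptic k S → ∀ x : State d,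
      R ≤ ‖x‖ → ENNReal.ofReal c ≤ ∫⁻ y, ENNReal.ofReal (gainDens p t S x y) := by
  obtain ⟨η, hη0, hη1, h⟩ := hM.exists_ball_log_ge
  obtain ⟨R, hR1, hR⟩ := h (1 / t) (by positivity)
  set v : ℝ := (volume (Metric.ball (0 : State d) η)).toReal with hv
  have hv0 : 0 < v := ENNReal.toReal_pos (Metric.measure_ball_pos _ _ hη0).ne'
    measure_ball_lt_top.ne
  set c₀ : ℝ := 1 / 2 * Real.exp (-((2 ^ 2 / k) / 2)) with hc₀
  have hc0 : 0 < c₀ := by positivity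
  refine ⟨c₀ * v, R, by positivity, fun S hS x hx => ?_⟩
  have hx0 : 0 < ‖x‖ := by linarith
  calc ENNReal.ofReal (c₀ * v)
      = ∫⁻ y in Metric.ball (x - ‖x‖⁻¹ • x) η, ENNReal.ofReal c₀ := by
        rw [setLIntegral_const, ENNReal.ofReal_mul hc0.le, hv,
          ENNReal.ofReal_toReal measure_ball_lt_top.ne,
          Measure.addHaar_ball_center _ (x - ‖x‖⁻¹ • x)]
    _ ≤ ∫⁻ y in Metric.ball (x - ‖x‖⁻¹ • x) η, ENNReal.ofReal (gainDens p t S x y) := by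
        refine setLIntegral_mono' measurableSet_ball fun y hy => ENNReal.ofReal_le_ofReal ?_
        set e := y - (x - ‖x‖⁻¹ • x) with he
        have hen : ‖e‖ ≤ η := by
          rw [Metric.mem_ball, dist_eq_norm] at hy; exact hy.le
        have hye : y = x + (e - ‖x‖⁻¹ • x) := by rw [he]; abel
        have h1 := hR x e hx hen
        rw [← hye] at h1
        have h2 : 1 ≤ t * (Real.log (p y) - Real.log (p x)) := by
          rw [div_le_iff₀ ht] at h1; linarith
        have h3 : (1 : ℝ) / 2 ≤ 1 - Real.exp (-(t * (Real.log (p y) - Real.log (p x)))) := by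
          have h3 : Real.exp (-(t * (Real.log (p y) - Real.log (p x)))) ≤ Real.exp (-1) :=
            Real.exp_le_exp.2 (by linarith)
          have h4 : Real.exp (-1) ≤ 1 / 2 := by
            rw [Real.exp_neg]
            have := Real.add_one_le_exp 1
            rw [one_div]
            apply inv_anti₀ (by norm_num) (by linarith)
          linarith
        have h4 : ‖y - x‖ ≤ 2 := by
          have h5 : y - x = e - ‖x‖⁻¹ • x := by rw [he]; abel
          have h3 : ‖‖x‖⁻¹ • x‖ = 1 := by simp [norm_smul, hx0.ne']
          have := norm_sub_le e (‖x‖⁻¹ • x)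
          rw [h5]; linarith
        have h5 : Real.exp (-((2 ^ 2 / k) / 2)) ≤ gaussWeight S (y - x) := by
          unfold gaussWeight
          apply Real.exp_le_exp.2
          have h6 := hS.quadForm_inv_le hk (y - x)
          have h7 : ‖y - x‖ ^ 2 / k ≤ 2 ^ 2 / k := by gcongr
          linarith
        unfold gainDens
        rw [hc₀]
        gcongr
    _ ≤ _ := setLIntegral_le_lintegral _ _

/-- For `x` far out, `p x` lies below the minimum of `p` on the ball of radius `R`, because `p`
tends to `0`. Beyond `R` the logarithm decreases along each ray with slope at most `-K`, so it
reaches the level `log (p x)`. -/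
lemma SuperExpRegularContours.exists_contour (hM : SuperExpRegularContours p)
    {K R : ℝ} (hK : 0 < K)
    (hR1 : 1 ≤ R) {ρ : ℝ} (hρ : 1 < ρ)
    (hR : ∀ θ : State d, ‖θ‖ = 1 → ∀ r₁ r₂ : ℝ, R ≤ r₁ → r₁ ≤ r₂ →
        Real.log (p (r₂ • θ)) - Real.log (p (r₁ • θ)) ≤ -(K * r₁ ^ (ρ - 1)) * (r₂ - r₁)) :
    ∃ R₁ : ℝ, ∀ x : State d, R₁ ≤ ‖x‖ → ∀ θ : State d, ‖θ‖ = 1 → ∃ r₀, R ≤ r₀ ∧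
      Real.log (p (r₀ • θ)) = Real.log (p x) ∧
      ∀ r, 0 ≤ r → r ≤ r₀ → p x ≤ p (r • θ) := by
  obtain ⟨z, hz, hzmin⟩ := (isCompact_closedBall (0 : State d) R).exists_isMinOn
    ⟨0, by simp; linarith⟩ hM.continuous.continuousOn
  obtain ⟨C, hC0, hC⟩ := hM.exists_le_exp_neg 1 zero_le_one
  have hlim : Tendsto (fun r : ℝ => C * Real.exp (-1 * r)) atTop (𝓝 0) := by
    have := (Real.tendsto_exp_neg_atTop_nhds_zero).const_mul C
    simpa using this
  obtain ⟨R₁, hR₁⟩ := eventually_atTop.1 (hlim.eventually (gt_mem_nhds (hM.pos z)))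
  refine ⟨R₁, fun x hx θ hθ => ?_⟩
  have hxz : p x < p z := (hC x).trans_lt (hR₁ _ hx)
  have hball : ∀ r, 0 ≤ r → r ≤ R → p x < p (r • θ) := fun r h0 h1 =>
    hxz.trans_le (hzmin (by simp [norm_smul, hθ, abs_of_nonneg h0, h1]))
  set f : ℝ → ℝ := fun r => Real.log (p (r • θ)) with hf
  have hfc : Continuous f := by
    have h1 : Continuous fun y => Real.log (p y) := hM.differentiable_log.continuous
    exact h1.comp (by fun_prop)
  have hfR : Real.log (p x) < f R :=
    Real.log_lt_log (hM.pos x) (hball R (by linarith) le_rfl)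
  -- By this radius a slope of `-K` has brought `f` below the level of `x`, which gives the second
  -- endpoint for the intermediate value theorem.
  set r' := R + (f R - Real.log (p x)) / K with hr'
  have hRr' : R ≤ r' := by
    have : 0 ≤ (f R - Real.log (p x)) / K := div_nonneg (by linarith) hK.le
    linarith
  have hfr' : f r' ≤ Real.log (p x) := by
    have h1 := hR θ hθ R r' le_rfl hRr'
    have h3 : (1 : ℝ) ≤ R ^ (ρ - 1) := Real.one_le_rpow hR1 (by linarith)
    have h4 : K * (r' - R) = f R - Real.log (p x) := by rw [hr']; field_simp; ring
    have h5 : K * (r' - R) ≤ K * R ^ (ρ - 1) * (r' - R) := by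
      have h6 : 0 ≤ r' - R := by linarith
      have h7 : K ≤ K * R ^ (ρ - 1) := le_mul_of_one_le_right hK.le h3
      gcongr
    change f r' - f R ≤ _ at h1
    linarith
  obtain ⟨r₀, hr₀, hfr₀⟩ := intermediate_value_Icc' hRr' hfc.continuousOn ⟨hfr', hfR.le⟩
  refine ⟨r₀, hr₀.1, hfr₀, fun r h0 h1 => ?_⟩
  rcases le_total r R with h2 | h2
  · exact (hball r h0 h2).le
  · have h3 := hR θ hθ r r₀ h2 h1
    have h4 : 0 ≤ K * r ^ (ρ - 1) * (r₀ - r) :=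
      mul_nonneg (mul_nonneg hK.le (Real.rpow_nonneg (by linarith) _)) (by linarith)
    change f r₀ - f r ≤ _ at h3
    have h5 : Real.log (p x) ≤ Real.log (p (r • θ)) := by
      change _ ≤ f r
      linarith
    exact (Real.log_le_log_iff (hM.pos _) (hM.pos _)).1 h5

lemma SuperExpRegularContours.measurable_log (hM : SuperExpRegularContours p) :
    Measurable fun y => Real.log (p y) := hM.differentiable_log.continuous.measurable

lemma measurable_gaussWeight (S : Matrix (Fin d) (Fin d) ℝ) : Measurable (gaussWeight S) :=
  (continuous_gaussWeight S).measurable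

lemma SuperExpRegularContours.measurable_gainDens (hM : SuperExpRegularContours p) (t : ℝ)
    (S : Matrix (Fin d) (Fin d) ℝ) (x : State d) : Measurable (gainDens p t S x) := by
  have h1 := hM.measurable_log
  have h2 : Measurable fun y => gaussWeight S (y - x) :=
    (measurable_gaussWeight S).comp (measurable_id.sub_const x)
  unfold gainDens
  fun_prop

lemma SuperExpRegularContours.measurable_lossDens (hM : SuperExpRegularContours p) (t : ℝ)
    (S : Matrix (Fin d) (Fin d) ℝ) (x : State d) : Measurable (lossDens p t S x) := by
  have h1 := hM.measurable_log
  have h2 : Measurable fun y => gaussWeight S (y - x) :=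
    (measurable_gaussWeight S).comp (measurable_id.sub_const x)
  unfold lossDens
  fun_prop

/-- Integrates the ray comparison over the sphere. On each ray the points with `p y < p x` lie
beyond the contour radius, and the shell between half that radius and the radius itself consists of
gains. -/
lemma SuperExpRegularContours.exists_loss_le (hM : SuperExpRegularContours p) (hd : 0 < d)
    {t k ε : ℝ} (ht : t ∈ Set.Ioo (0 : ℝ) 1) (hk : 0 < k) (hε : 0 < ε) :
    ∃ R : ℝ, ∀ S : Matrix (Fin d) (Fin d) ℝ, UniformlyElliptic k S → ∀ x : State d,
      R ≤ ‖x‖ →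
      ∫⁻ y, Set.indicator {y | p y < p x} (fun y => ENNReal.ofReal (lossDens p t S x y)) y ≤
        2⁻¹ * (∫⁻ y, ENNReal.ofReal (gainDens p t S x y)) + ENNReal.ofReal ε := by
  set σ : ℝ := (volume : Measure (State d)).toSphere.real Set.univ with hσ
  have hσ0 : 0 ≤ σ := measureReal_nonneg
  obtain ⟨ρ, hρ, hrad⟩ := hM.exists_radial_decay
  -- `1 / k` bounds the form of `S⁻¹` on unit vectors, `σ` is the mass of the sphere, and the
  -- exponent `d - 1` is the polar Jacobian.
  obtain ⟨K, R₀, hK, hR₀, hray⟩ := exists_ray_comparison (β := 1 / k) (ε := ε / (σ + 1)) ht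
    (by positivity) hρ (by positivity) (d - 1)
  obtain ⟨R₂, hR₂1, hR₂⟩ := hrad K hK.le
  -- Requiring contour radii of at least `2 * R₂` makes the radial decay available already from half
  -- the contour radius.
  obtain ⟨R₁, hR₁⟩ := hM.exists_contour (R := max (2 * R₂) R₀) hK
    (by have := le_max_right (2 * R₂) R₀; linarith) hρ
    (fun θ hθ r₁ r₂ h1 h2 => hR₂ θ hθ r₁ r₂ (by have := le_max_left (2 * R₂) R₀; linarith) h2)
  refine ⟨R₁, fun S hS x hx => ?_⟩
  have hlm := hM.measurable_lossDens t S x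
  have hgm := hM.measurable_gainDens t S x
  have hset : MeasurableSet {y | p y < p x} :=
    measurableSet_lt hM.continuous.measurable measurable_const
  have hgm' : Measurable fun y => ENNReal.ofReal (gainDens p t S x y) := hgm.ennreal_ofReal
  have hlm' : Measurable (Set.indicator {y | p y < p x}
    (fun y => ENNReal.ofReal (lossDens p t S x y))) := hlm.ennreal_ofReal.indicator hset
  rw [lintegral_polar hd hlm', lintegral_polar hd hgm']
  have hε' : ENNReal.ofReal (ε / (σ + 1)) * (volume : Measure (State d)).toSphere Set.univ ≤
      ENNReal.ofReal ε := by
    rw [← ENNReal.ofReal_toReal (measure_ne_top (volume : Measure (State d)).toSphere Set.univ),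
      ← ENNReal.ofReal_mul (by positivity)]
    apply ENNReal.ofReal_le_ofReal
    change ε / (σ + 1) * σ ≤ ε
    rw [div_mul_eq_mul_div, div_le_iff₀ (by positivity)]
    nlinarith
  refine le_trans ?_ (add_le_add_right hε' _)
  rw [← lintegral_const, ← lintegral_const_mul' _ _ (by simp), ← lintegral_add_right _ (by fun_prop)]
  refine lintegral_mono fun θ => ?_
  have hθ : ‖θ.1‖ = 1 := by simp
  obtain ⟨r₀, hr₀, hr₀x, hin⟩ := hR₁ x hx θ.1 hθ
  have hr₀1 : 2 * R₂ ≤ r₀ := (le_max_left _ _).trans hr₀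
  have hr₀2 : R₀ ≤ r₀ := (le_max_right _ _).trans hr₀
  obtain ⟨b, hb⟩ := quadForm_smul_sub S⁻¹ θ.1 x
  set a := quadForm S⁻¹ θ.1 / 2 with ha
  set c := quadForm S⁻¹ x / 2 with hc
  have hq : ∀ r : ℝ, quadForm S⁻¹ (r • θ.1 - x) / 2 = a * r ^ 2 - b * r + c := fun r => by
    rw [hb, ha, hc]; ring
  have hw : ∀ r : ℝ, gaussWeight S (r • θ.1 - x) = Real.exp (-(a * r ^ 2 - b * r + c)) := fun r => by
    rw [gaussWeight, neg_div, hq]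
  have hmain := hray r₀ hr₀2 (fun r => Real.log (p (r • θ.1)) - Real.log (p x)) a b c
    (by have := hS.quadForm_inv_nonneg hk θ.1; positivity)
    (by have := hS.quadForm_inv_le hk θ.1; rw [hθ, one_pow] at this; linarith)
    (fun r => by rw [← hq]; have := hS.quadForm_inv_nonneg hk (r • θ.1 - x); positivity)
    (fun r hr => by
      rw [← hr₀x]
      exact hR₂ θ.1 hθ r₀ r (by linarith) hr.le)
    (fun r h1 h2 => by
      have h3 := hR₂ θ.1 hθ r r₀ (by linarith) h2
      rw [hr₀x] at h3
      have h4 : (r₀ / 2) ^ (ρ - 1) ≤ r ^ (ρ - 1) :=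
        Real.rpow_le_rpow (by linarith) h1 (by linarith)
      have h5 : K * (r₀ / 2) ^ (ρ - 1) * (r₀ - r) ≤ K * r ^ (ρ - 1) * (r₀ - r) := by
        have : 0 ≤ r₀ - r := by linarith
        gcongr
      linarith)
  calc ∫⁻ r in Set.Ioi (0 : ℝ), Set.indicator {y | p y < p x}
        (fun y => ENNReal.ofReal (lossDens p t S x y)) (r • θ.1) * ENNReal.ofReal (r ^ (d - 1))
      ≤ ∫⁻ r in Set.Ioi (0 : ℝ), Set.indicator (Set.Ioi r₀) (fun r => ENNReal.ofReal
          (Real.exp ((1 - t) * (Real.log (p (r • θ.1)) - Real.log (p x))) *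
            Real.exp (-(a * r ^ 2 - b * r + c)) * r ^ (d - 1))) r := by
        refine setLIntegral_mono' measurableSet_Ioi fun r hr => ?_
        have hr : 0 < r := hr
        by_cases h1 : r₀ < r
        · rw [Set.indicator_of_mem (s := Set.Ioi r₀) h1]
          refine (mul_le_mul_left (Set.indicator_le_self _ _ _) _).trans ?_
          rw [← ENNReal.ofReal_mul (by unfold lossDens gaussWeight; positivity), lossDens, hw]
        · rw [Set.indicator_of_notMem, zero_mul]
          · exact zero_le
          · exact fun h2 => absurd (hin r hr.le (not_lt.1 h1)) (not_le.2 h2)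
    _ ≤ ∫⁻ r in Set.Ioi r₀, ENNReal.ofReal
          (Real.exp ((1 - t) * (Real.log (p (r • θ.1)) - Real.log (p x))) *
            Real.exp (-(a * r ^ 2 - b * r + c)) * r ^ (d - 1)) := by
        exact (setLIntegral_le_lintegral _ _).trans (lintegral_indicator measurableSet_Ioi _).le
    _ ≤ _ := hmain
    _ ≤ _ := by
        refine add_le_add (mul_le_mul_right ((lintegral_mono_set (t := Set.Ioi 0)
          fun r hr => ?_).trans (setLIntegral_mono' measurableSet_Ioi fun r hr => ?_)) _) le_rfl
        · have := hr.1; change 0 < r; linarith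
        · have hr : 0 < r := hr
          rw [← ENNReal.ofReal_mul' (by positivity), gainDens, hw]

/-- Uniformly over the covariance matrices bounded below by `k`, gains exceed losses far out. -/
lemma SuperExpRegularContours.exists_loss_add_le_gain (hM : SuperExpRegularContours p) (hd : 0 < d)
    {t k : ℝ} (ht : t ∈ Set.Ioo (0 : ℝ) 1) (hk : 0 < k) :
    ∃ c R : ℝ, 0 < c ∧ ∀ S : Matrix (Fin d) (Fin d) ℝ, UniformlyElliptic k S → ∀ x : State d,
      R ≤ ‖x‖ →
      (∫⁻ y, Set.indicator {y | p y < p x} (fun y => ENNReal.ofReal (lossDens p t S x y)) y) +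
        ENNReal.ofReal c ≤ ∫⁻ y, ENNReal.ofReal (gainDens p t S x y) := by
  obtain ⟨c, R₁, hc, h1⟩ := hM.exists_gain_ge ht.1 hk
  -- With gain at least `c` and loss at most half the gain plus `c / 4`, the surplus is at least `c
  -- / 4`.
  obtain ⟨R₂, h2⟩ := hM.exists_loss_le hd ht hk (ε := c / 4) (by positivity)
  refine ⟨c / 4, max R₁ R₂, by positivity, fun S hS x hx => ?_⟩
  have h3 := h1 S hS x ((le_max_left _ _).trans hx)
  have h4 := h2 S hS x ((le_max_right _ _).trans hx)
  calc _ ≤ _ := add_le_add_left h4 _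
    _ = 2⁻¹ * (∫⁻ y, ENNReal.ofReal (gainDens p t S x y)) + 2⁻¹ * ENNReal.ofReal c := by
        rw [add_assoc, ← ENNReal.ofReal_add (by positivity) (by positivity),
          show (2⁻¹ : ℝ≥0∞) = ENNReal.ofReal 2⁻¹ by
            rw [ENNReal.ofReal_inv_of_pos (by norm_num)]; simp,
          ← ENNReal.ofReal_mul (by norm_num)]
        congr 2; ring
    _ ≤ 2⁻¹ * (∫⁻ y, ENNReal.ofReal (gainDens p t S x y)) +
        2⁻¹ * (∫⁻ y, ENNReal.ofReal (gainDens p t S x y)) := by gcongr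
    _ = _ := by rw [← add_mul, ENNReal.inv_two_add_inv_two, one_mul]

/-! ### The Metropolis kernel and its drift -/

variable {d : ℕ} {p : State d → ℝ}

/-- The random-walk Metropolis kernel whose Gaussian increments have covariance matrix `S`. -/
noncomputable def metro (p : State d → ℝ) (S : Matrix (Fin d) (Fin d) ℝ) (x : State d) :
    Measure (State d) :=
  (multivariateGaussian x S).withDensity (fun y => ENNReal.ofReal (accept p x y))
    + ENNReal.ofReal (1 - ∫ y, accept p x y ∂(multivariateGaussian x S)) • Measure.dirac x

/-- The Lyapunov function `p ^ (-t)`. -/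
noncomputable def lyap (p : State d → ℝ) (t : ℝ) (x : State d) : ℝ := p x ^ (-t)

lemma accept_le_one (x y : State d) : accept p x y ≤ 1 := min_le_left _ _

section Positive

variable (hp : ∀ x, 0 < p x) (hc : Continuous p)
include hp

lemma accept_pos (x y : State d) : 0 < accept p x y :=
  lt_min one_pos (div_pos (hp y) (hp x))

lemma abs_accept_le_one (x y : State d) : |accept p x y| ≤ 1 := by
  rw [abs_of_pos (accept_pos hp x y)]; exact accept_le_one x y

lemma lyap_pos (t : ℝ) (x : State d) : 0 < lyap p t x := Real.rpow_pos_of_pos (hp x) _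

lemma lyap_eq_exp (t : ℝ) (x : State d) : lyap p t x = Real.exp (-(t * Real.log (p x))) := by
  rw [lyap, Real.rpow_def_of_pos (hp x)]; congr 1; ring

/-- Uphill the Lyapunov function does not increase. Downhill the left side is `p y ^ (1 - t) / p x`,
and `t < 1` lets `p x` replace `p y`. This makes the Lyapunov function integrable under every
Metropolis kernel, singular proposals included. -/
lemma accept_mul_lyap_le {t : ℝ} (ht : t ∈ Set.Ioo (0 : ℝ) 1) (x y : State d) :
    accept p x y * lyap p t y ≤ lyap p t x := by
  have h0 := lyap_pos hp t y
  rw [lyap_eq_exp hp, lyap_eq_exp hp]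
  rcases le_total (p x) (p y) with h | h
  · have h1 : Real.log (p x) ≤ Real.log (p y) := Real.log_le_log (hp x) h
    calc accept p x y * Real.exp (-(t * Real.log (p y)))
        ≤ 1 * Real.exp (-(t * Real.log (p x))) := by
          have := accept_le_one (p := p) x y
          have h2 := mul_le_mul_of_nonneg_left h1 ht.1.le
          gcongr
      _ = _ := one_mul _
  · have h1 : Real.log (p y) ≤ Real.log (p x) := Real.log_le_log (hp y) h
    have h2 : p y / p x = Real.exp (Real.log (p y) - Real.log (p x)) := by
      rw [Real.exp_sub, Real.exp_log (hp x), Real.exp_log (hp y)]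
    calc accept p x y * Real.exp (-(t * Real.log (p y)))
        ≤ p y / p x * Real.exp (-(t * Real.log (p y))) := by
          gcongr; exact min_le_right _ _
      _ = Real.exp (Real.log (p y) - Real.log (p x) + -(t * Real.log (p y))) := by
          rw [h2, ← Real.exp_add]
      _ ≤ _ := Real.exp_le_exp.2 (by
          have := mul_le_mul_of_nonneg_left h1 (sub_nonneg.2 ht.2.le)
          linarith)

include hc

lemma continuous_accept : Continuous fun z : State d × State d => accept p z.1 z.2 := by
  unfold accept
  have : ∀ z : State d × State d, p z.1 ≠ 0 := fun z => (hp _).ne'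
  fun_prop (disch := assumption)

lemma measurable_accept (x : State d) : Measurable (accept p x) :=
  ((continuous_accept hp hc).comp (Continuous.prodMk continuous_const continuous_id)).measurable

lemma continuous_lyap (t : ℝ) : Continuous (lyap p t) :=
  hc.rpow_const fun x => Or.inl (hp x).ne'

variable (S : Matrix (Fin d) (Fin d) ℝ)

lemma integrable_accept (x : State d) : Integrable (accept p x) (multivariateGaussian x S) :=
  Integrable.of_bound (measurable_accept hp hc x).aestronglyMeasurable 1
    (ae_of_all _ fun y => abs_accept_le_one hp x y)

lemma integral_accept_le_one (x : State d) :
    ∫ y, accept p x y ∂(multivariateGaussian x S) ≤ 1 := by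
  calc ∫ y, accept p x y ∂(multivariateGaussian x S)
      ≤ ∫ y, 1 ∂(multivariateGaussian x S) :=
        integral_mono (integrable_accept hp hc S x) (integrable_const _) fun y => accept_le_one x y
    _ = 1 := by simp

lemma lintegral_metro (x : State d) {f : State d → ℝ≥0∞} (hf : Measurable f) :
    ∫⁻ y, f y ∂(metro p S x) =
      ∫⁻ y, ENNReal.ofReal (accept p x y) * f y ∂(multivariateGaussian x S) +
        ENNReal.ofReal (1 - ∫ y, accept p x y ∂(multivariateGaussian x S)) * f x := by
  rw [metro, lintegral_add_measure, lintegral_smul_measure, lintegral_dirac' _ hf,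
    lintegral_withDensity_eq_lintegral_mul _ (measurable_accept hp hc x).ennreal_ofReal hf]
  rfl

lemma isProbabilityMeasure_metro (x : State d) : IsProbabilityMeasure (metro p S x) := by
  constructor
  rw [← lintegral_one, lintegral_metro hp hc S x measurable_const]
  simp only [mul_one]
  rw [← ofReal_integral_eq_lintegral_ofReal (integrable_accept hp hc S x)
    (ae_of_all _ fun y => (accept_pos hp x y).le),
    ← ENNReal.ofReal_add (integral_nonneg fun y => (accept_pos hp x y).le)
      (sub_nonneg.2 (integral_accept_le_one hp hc S x))]
  simp

lemma integrable_metro (x : State d) {f : State d → ℝ}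
    (hint : Integrable (fun y => accept p x y * f y) (multivariateGaussian x S)) :
    Integrable f (metro p S x) := by
  rw [metro]
  refine Integrable.add_measure ?_ ((integrable_dirac (by simp)).smul_measure (by simp))
  rw [integrable_withDensity_iff_integrable_smul₀' (by
    exact (measurable_accept hp hc x).ennreal_ofReal.aemeasurable) (by simp)]
  refine hint.congr (ae_of_all _ fun y => ?_)
  simp [ENNReal.toReal_ofReal (accept_pos hp x y).le]

lemma integral_metro (x : State d) {f : State d → ℝ}
    (hint : Integrable (fun y => accept p x y * f y) (multivariateGaussian x S)) :
    ∫ y, f y ∂(metro p S x) =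
      f x + ∫ y, accept p x y * (f y - f x) ∂(multivariateGaussian x S) := by
  have h1 : Integrable f ((multivariateGaussian x S).withDensity
      (fun y => ENNReal.ofReal (accept p x y))) := by
    rw [integrable_withDensity_iff_integrable_smul₀' (by
      exact (measurable_accept hp hc x).ennreal_ofReal.aemeasurable) (by simp)]
    refine hint.congr (ae_of_all _ fun y => ?_)
    simp [ENNReal.toReal_ofReal (accept_pos hp x y).le]
  rw [metro, integral_add_measure h1 ((integrable_dirac (by simp)).smul_measure (by simp)),
    integral_withDensity_eq_integral_toReal_smul (measurable_accept hp hc x).ennreal_ofReal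
      (by simp), integral_smul_measure, integral_dirac,
    ENNReal.toReal_ofReal (sub_nonneg.2 (integral_accept_le_one hp hc S x))]
  have h2 : ∀ y, (ENNReal.ofReal (accept p x y)).toReal • f y = accept p x y * f y := fun y => by
    rw [ENNReal.toReal_ofReal (accept_pos hp x y).le, smul_eq_mul]
  simp only [h2, mul_sub]
  rw [integral_sub hint ((integrable_accept hp hc S x).mul_const _), integral_mul_const]
  simp only [smul_eq_mul]
  ring

lemma integrable_accept_mul_lyap {t : ℝ} (ht : t ∈ Set.Ioo (0 : ℝ) 1) (x : State d) :
    Integrable (fun y => accept p x y * lyap p t y) (multivariateGaussian x S) :=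
  Integrable.of_bound ((measurable_accept hp hc x).mul
    (continuous_lyap hp hc t).measurable).aestronglyMeasurable (lyap p t x)
    (ae_of_all _ fun y => by
      rw [Real.norm_of_nonneg (mul_nonneg (accept_pos hp x y).le (lyap_pos hp t y).le)]
      exact accept_mul_lyap_le hp ht x y)

lemma integrable_accept_mul_sub (x : State d) {f : State d → ℝ}
    (hint : Integrable (fun y => accept p x y * f y) (multivariateGaussian x S)) :
    Integrable (fun y => accept p x y * (f y - f x)) (multivariateGaussian x S) := by
  simp only [mul_sub]
  exact hint.sub ((integrable_accept hp hc S x).mul_const _)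

lemma integrable_lyap_metro {t : ℝ} (ht : t ∈ Set.Ioo (0 : ℝ) 1) (x : State d) :
    Integrable (lyap p t) (metro p S x) :=
  integrable_metro hp hc S x
    (integrable_accept_mul_lyap hp hc S ht x)

lemma integral_lyap_metro_le {t : ℝ} (ht : t ∈ Set.Ioo (0 : ℝ) 1) (x : State d) :
    ∫ y, lyap p t y ∂(metro p S x) ≤ 2 * lyap p t x := by
  rw [integral_metro hp hc S x
    (integrable_accept_mul_lyap hp hc S ht x)]
  have h0 := lyap_pos hp t x
  have : ∫ y, accept p x y * (lyap p t y - lyap p t x) ∂(multivariateGaussian x S) ≤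
      ∫ _, lyap p t x ∂(multivariateGaussian x S) := by
    refine integral_mono (integrable_accept_mul_sub hp hc S x
      (integrable_accept_mul_lyap hp hc S ht x)) (integrable_const _) fun y => ?_
    have h1 := accept_mul_lyap_le hp ht x y
    have h2 := mul_pos (accept_pos hp x y) h0
    rw [mul_sub]
    linarith
  simp at this
  linarith

end Positive

lemma measurable_gaussDens_sub (S : Matrix (Fin d) (Fin d) ℝ) (x : State d) :
    Measurable fun y => gaussDens S (y - x) :=
  ((continuous_gaussDens S).comp (continuous_sub_right x)).measurable

lemma integrable_gaussDens {S : Matrix (Fin d) (Fin d) ℝ} (hS : S.PosDef) (x : State d) :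
    Integrable fun y => gaussDens S (y - x) := by
  refine ⟨(measurable_gaussDens_sub S x).aestronglyMeasurable, ?_⟩
  rw [hasFiniteIntegral_iff_ofReal (ae_of_all _ fun y => gaussDens_nonneg _ _)]
  have h1 := measure_univ (μ := multivariateGaussian x S)
  rw [multivariateGaussian_eq_withDensity hS x, withDensity_apply _ MeasurableSet.univ,
    Measure.restrict_univ] at h1
  rw [h1]; simp

lemma integral_gaussDens {S : Matrix (Fin d) (Fin d) ℝ} (hS : S.PosDef) (x : State d) :
    ∫ y, gaussDens S (y - x) = 1 := by
  have h1 := measure_univ (μ := multivariateGaussian x S)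
  rw [multivariateGaussian_eq_withDensity hS x, withDensity_apply _ MeasurableSet.univ,
    Measure.restrict_univ, ← ofReal_integral_eq_lintegral_ofReal (integrable_gaussDens hS x)
    (ae_of_all _ fun y => gaussDens_nonneg _ _), ENNReal.ofReal_eq_one] at h1
  exact h1

lemma integral_multivariateGaussian_eq {S : Matrix (Fin d) (Fin d) ℝ} (hS : S.PosDef)
    (x : State d) (f : State d → ℝ) :
    ∫ y, f y ∂(multivariateGaussian x S) = ∫ y, gaussDens S (y - x) * f y := by
  rw [multivariateGaussian_eq_withDensity hS x, integral_withDensity_eq_integral_toReal_smul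
    (measurable_gaussDens_sub S x).ennreal_ofReal (by simp)]
  refine integral_congr_ae (ae_of_all _ fun y => ?_)
  simp [ENNReal.toReal_ofReal (gaussDens_nonneg _ _)]

lemma integrable_multivariateGaussian_iff {S : Matrix (Fin d) (Fin d) ℝ} (hS : S.PosDef)
    (x : State d) (f : State d → ℝ) :
    Integrable f (multivariateGaussian x S) ↔ Integrable fun y => gaussDens S (y - x) * f y := by
  rw [multivariateGaussian_eq_withDensity hS x, integrable_withDensity_iff_integrable_smul₀'
    (measurable_gaussDens_sub S x).ennreal_ofReal.aemeasurable
    (by simp)]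
  refine integrable_congr (ae_of_all _ fun y => ?_)
  simp [ENNReal.toReal_ofReal (gaussDens_nonneg _ _)]

/-- The maximum of the Gaussian density. -/
noncomputable def gaussPeak (S : Matrix (Fin d) (Fin d) ℝ) : ℝ :=
  (√((2 * Real.pi) ^ d * S.det))⁻¹

lemma gaussDens_eq_peak_mul (S : Matrix (Fin d) (Fin d) ℝ) (z : State d) :
    gaussDens S z = gaussPeak S * gaussWeight S z := rfl

lemma gaussPeak_pos {S : Matrix (Fin d) (Fin d) ℝ} (hS : 0 < S.det) : 0 < gaussPeak S := by
  unfold gaussPeak; positivity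

namespace SuperExpRegularContours

/-- The relative increment of the Lyapunov function is bounded pointwise by loss minus gain.
Multiplying the surplus of the gain by the Gaussian normalization gives the rate `c * gaussPeak S`.
-/
lemma integral_lyap_le_far (hM : SuperExpRegularContours p) (hd : 0 < d)
    {t k : ℝ} (ht : t ∈ Set.Ioo (0 : ℝ) 1) (hk : 0 < k) :
    ∃ c R : ℝ, 0 < c ∧ ∀ S : Matrix (Fin d) (Fin d) ℝ, UniformlyElliptic k S → ∀ x : State d,
      R ≤ ‖x‖ →
      ∫ y, lyap p t y ∂(metro p S x) + c * gaussPeak S * lyap p t x ≤ lyap p t x := by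
  obtain ⟨c, R, hc, h⟩ := hM.exists_loss_add_le_gain hd ht hk
  refine ⟨c, R, hc, fun S hS x hx => ?_⟩
  have hpd := hS.posDef hk
  have hpos := hM.pos
  have hcont := hM.continuous
  have hN := gaussPeak_pos (hS.det_pos hk)
  have hset : MeasurableSet {y | p y < p x} :=
    measurableSet_lt hM.continuous.measurable measurable_const
  have hV := lyap_pos hpos t x
  have hwint : Integrable fun y => gaussWeight S (y - x) := by
    have h1 := (integrable_gaussDens hpd x).const_mul (gaussPeak S)⁻¹
    refine h1.congr (ae_of_all _ fun y => ?_)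
    simp only [gaussDens_eq_peak_mul]
    field_simp
  have hw0 : ∀ y, 0 ≤ gaussWeight S (y - x) := fun y => (Real.exp_pos _).le
  set lossI : State d → ℝ := Set.indicator {y | p y < p x} (lossDens p t S x) with hlossI
  set gainP : State d → ℝ := fun y => max (gainDens p t S x y) 0 with hgainP
  have hloss0 : ∀ y, 0 ≤ lossI y := fun y =>
    Set.indicator_nonneg (fun y _ => by unfold lossDens gaussWeight; positivity) _
  have hgain0 : ∀ y, 0 ≤ gainP y := fun y => le_max_right _ _
  have hlossint : Integrable lossI := by
    refine hwint.mono' ((hM.measurable_lossDens t S x).indicator hset).aestronglyMeasurable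
      (ae_of_all _ fun y => ?_)
    rw [Real.norm_of_nonneg (hloss0 y), hlossI, Set.indicator_apply]
    split_ifs with hy
    · have h1 : Real.log (p y) ≤ Real.log (p x) := Real.log_le_log (hpos y) (le_of_lt hy)
      have h2 : Real.exp ((1 - t) * (Real.log (p y) - Real.log (p x))) ≤ 1 :=
        Real.exp_le_one_iff.2 (mul_nonpos_of_nonneg_of_nonpos (by linarith [ht.2]) (by linarith))
      exact mul_le_of_le_one_left (hw0 y) h2
    · exact hw0 y
  have hgainint : Integrable gainP := by
    refine hwint.mono' ((hM.measurable_gainDens t S x).max measurable_const).aestronglyMeasurable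
      (ae_of_all _ fun y => ?_)
    rw [Real.norm_of_nonneg (hgain0 y)]
    refine max_le (mul_le_of_le_one_left (hw0 y) ?_) (hw0 y)
    have := Real.exp_pos (-(t * (Real.log (p y) - Real.log (p x))))
    linarith
  have hkey : (∫ y, lossI y) + c ≤ ∫ y, gainP y := by
    have h1 := h S hS x hx
    have h2 : ∫⁻ y, ENNReal.ofReal (gainDens p t S x y) = ENNReal.ofReal (∫ y, gainP y) := by
      rw [ofReal_integral_eq_lintegral_ofReal hgainint (ae_of_all _ hgain0)]
      refine lintegral_congr fun y => ?_
      simp only [hgainP]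
      rcases le_total (gainDens p t S x y) 0 with h3 | h3
      · rw [max_eq_right h3, ENNReal.ofReal_of_nonpos h3, ENNReal.ofReal_zero]
      · rw [max_eq_left h3]
    have h3 : ∫⁻ y, Set.indicator {y | p y < p x}
        (fun y => ENNReal.ofReal (lossDens p t S x y)) y = ENNReal.ofReal (∫ y, lossI y) := by
      rw [ofReal_integral_eq_lintegral_ofReal hlossint (ae_of_all _ hloss0)]
      refine lintegral_congr fun y => ?_
      simp only [hlossI, Set.indicator_apply]
      split_ifs <;> simp
    rw [h2, h3, ← ENNReal.ofReal_add (integral_nonneg hloss0) hc.le] at h1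
    exact (ENNReal.ofReal_le_ofReal_iff (integral_nonneg hgain0)).1 h1
  -- With `D = log (p y / p x)`, a downhill move contributes `exp ((1 - t) * D) - exp D`, of which
  -- only the first term is kept. An uphill move is always accepted and contributes exactly minus
  -- the gain.
  have hpt : ∀ y, gaussDens S (y - x) * (accept p x y * (lyap p t y - lyap p t x)) ≤
      gaussPeak S * lyap p t x * (lossI y - gainP y) := by
    intro y
    have hratio : p y / p x = Real.exp (Real.log (p y) - Real.log (p x)) := by
      rw [Real.exp_sub, Real.exp_log (hpos x), Real.exp_log (hpos y)]
    have hlyap : lyap p t y = lyap p t x * Real.exp (-(t * (Real.log (p y) - Real.log (p x)))) := by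
      rw [lyap_eq_exp hpos, lyap_eq_exp hpos, ← Real.exp_add]; congr 1; ring
    have hmain : accept p x y * (Real.exp (-(t * (Real.log (p y) - Real.log (p x)))) - 1) *
        gaussWeight S (y - x) ≤ lossI y - gainP y := by
      set D := Real.log (p y) - Real.log (p x) with hD
      by_cases hy : p y < p x
      · have hD0 : D < 0 := by
          have := Real.log_lt_log (hpos y) hy; linarith
        have hacc : accept p x y = Real.exp D := by
          rw [accept, hratio]; exact min_eq_right (Real.exp_le_one_iff.2 hD0.le)
        have hg : gainP y = 0 := by
          apply max_eq_right
          apply mul_nonpos_of_nonpos_of_nonneg _ (hw0 y)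
          have : 1 ≤ Real.exp (-(t * D)) := Real.one_le_exp (by nlinarith [ht.1])
          linarith
        have hl : lossI y = Real.exp ((1 - t) * D) * gaussWeight S (y - x) :=
          Set.indicator_of_mem (s := {y | p y < p x}) hy _
        rw [hg, hl, hacc, sub_zero]
        apply mul_le_mul_of_nonneg_right _ (hw0 y)
        rw [mul_sub, ← Real.exp_add, mul_one]
        have : D + -(t * D) = (1 - t) * D := by ring
        rw [this]
        linarith [Real.exp_pos D]
      · have hD0 : 0 ≤ D := by
          have := Real.log_le_log (hpos x) (not_lt.1 hy); linarith
        have hacc : accept p x y = 1 := by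
          rw [accept, hratio]; exact min_eq_left (Real.one_le_exp hD0)
        have hl : lossI y = 0 := Set.indicator_of_notMem (s := {y | p y < p x}) hy _
        have hg : gainP y = (1 - Real.exp (-(t * D))) * gaussWeight S (y - x) := by
          apply max_eq_left
          apply mul_nonneg _ (hw0 y)
          have : Real.exp (-(t * D)) ≤ 1 := Real.exp_le_one_iff.2 (by nlinarith [ht.1])
          linarith
        rw [hg, hl, hacc]
        linarith
    calc gaussDens S (y - x) * (accept p x y * (lyap p t y - lyap p t x))
        = gaussPeak S * lyap p t x *
          (accept p x y * (Real.exp (-(t * (Real.log (p y) - Real.log (p x)))) - 1) *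
            gaussWeight S (y - x)) := by
          rw [gaussDens_eq_peak_mul, hlyap]; ring
      _ ≤ _ := by gcongr
  have hint0 := integrable_accept_mul_sub hpos hcont S x
    (integrable_accept_mul_lyap hpos hcont S ht x)
  rw [integral_metro hpos hcont S x
    (integrable_accept_mul_lyap hpos hcont S ht x), integral_multivariateGaussian_eq hpd]
  have h5 : ∫ y, gaussDens S (y - x) * (accept p x y * (lyap p t y - lyap p t x)) ≤
      ∫ y, gaussPeak S * lyap p t x * (lossI y - gainP y) :=
    integral_mono ((integrable_multivariateGaussian_iff hpd x _).1 hint0)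
      ((hlossint.sub hgainint).const_mul _) hpt
  rw [integral_const_mul, integral_sub hlossint hgainint] at h5
  have h6 : gaussPeak S * lyap p t x * ((∫ y, lossI y) - ∫ y, gainP y) ≤
      gaussPeak S * lyap p t x * (-c) := by
    gcongr; linarith
  linarith

/-- The drift inequality, uniformly over the covariance matrices bounded below by `k`. -/
lemma exists_drift (hM : SuperExpRegularContours p) (hd : 0 < d)
    {t k : ℝ} (ht : t ∈ Set.Ioo (0 : ℝ) 1) (hk : 0 < k) :
    ∃ c b : ℝ, 0 < c ∧ 0 ≤ b ∧ ∀ S : Matrix (Fin d) (Fin d) ℝ, UniformlyElliptic k S →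
      c * gaussPeak S ≤ 1 ∧ ∀ x : State d,
      ∫ y, lyap p t y ∂(metro p S x) + c * gaussPeak S * lyap p t x ≤ lyap p t x + b := by
  obtain ⟨c, R, hc, h⟩ := hM.integral_lyap_le_far hd ht hk
  have hpos := hM.pos
  have hcont := hM.continuous
  obtain ⟨B, hB⟩ := (isCompact_closedBall (0 : State d) R).bddAbove_image
    (continuous_lyap hpos hcont t).continuousOn
  refine ⟨c, 2 * max B 0, hc, by positivity, fun S hS => ?_⟩
  -- The far inequality at a single point already forces this, since the integral on its left is
  -- nonnegative.
  have h1 : c * gaussPeak S ≤ 1 := by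
    have h2 := h S hS (EuclideanSpace.single ⟨0, hd⟩ R) (by simpa using le_abs_self R)
    set x : State d := EuclideanSpace.single ⟨0, hd⟩ R
    have h3 := lyap_pos hpos t x
    have h4 : 0 ≤ ∫ y, lyap p t y ∂(metro p S x) := integral_nonneg fun y => (lyap_pos hpos t y).le
    have h5 : c * gaussPeak S * lyap p t x ≤ 1 * lyap p t x := by linarith
    exact le_of_mul_le_mul_right h5 h3
  refine ⟨h1, fun x => ?_⟩
  rcases le_total R ‖x‖ with hx | hx
  · have := h S hS x hx
    have : 0 ≤ max B 0 := le_max_right _ _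
    linarith
  · have h2 := integral_lyap_metro_le hpos hcont S ht x
    have h3 : lyap p t x ≤ B := hB ⟨x, by simpa using hx, rfl⟩
    have h4 := le_max_left B 0
    have h5 := lyap_pos hpos t x
    have h6 : c * gaussPeak S * lyap p t x ≤ 1 * lyap p t x := by gcongr
    linarith

/-- The Lyapunov function grows faster than any power of the norm. -/
lemma exists_pow_norm_le_lyap (hM : SuperExpRegularContours p) {t : ℝ} (ht : 0 < t) (m : ℕ) :
    ∃ C : ℝ, 0 < C ∧ ∀ x, ‖x‖ ^ m ≤ C * lyap p t x := by
  -- The rate `1 / t` turns into `exp ‖x‖` after raising to the power `-t`.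
  obtain ⟨C, hC0, hC⟩ := hM.exists_le_exp_neg (1 / t) (by positivity)
  refine ⟨m.factorial * C ^ t, by positivity, fun x => ?_⟩
  have h1 : (C * Real.exp (-(1 / t) * ‖x‖)) ^ (-t) ≤ lyap p t x :=
    Real.rpow_le_rpow_of_nonpos (hM.pos x) (hC x) (by linarith)
  rw [Real.mul_rpow hC0.le (Real.exp_pos _).le, ← Real.exp_mul] at h1
  have h2 : -(1 / t) * ‖x‖ * -t = ‖x‖ := by field_simp
  rw [h2, Real.rpow_neg hC0.le, inv_mul_le_iff₀ (by positivity)] at h1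
  have h3 := Real.pow_div_factorial_le_exp ‖x‖ (norm_nonneg x) m
  rw [div_le_iff₀ (by positivity)] at h3
  calc ‖x‖ ^ m ≤ Real.exp ‖x‖ * m.factorial := h3
    _ ≤ (C ^ t * lyap p t x) * m.factorial := by gcongr
    _ = _ := by ring

end SuperExpRegularContours

/-! ### The transition operator: dependence on the covariance and invariance -/

variable {d : ℕ} {p : State d → ℝ}

/-- The Metropolis transition operator, written with the Gaussian density. -/
noncomputable def metroOp (p : State d → ℝ) (S : Matrix (Fin d) (Fin d) ℝ) (f : State d → ℝ)
    (x : State d) : ℝ :=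
  f x + ∫ y, gaussDens S (y - x) * (accept p x y * (f y - f x))

section

variable (hp : ∀ x, 0 < p x) (hc : Continuous p) {S : Matrix (Fin d) (Fin d) ℝ} (hS : S.PosDef)
include hp hc

lemma integrable_accept_mul (S : Matrix (Fin d) (Fin d) ℝ) (x : State d) {f : State d → ℝ}
    (hf : Measurable f) {B : ℝ} (hB : ∀ x, |f x| ≤ B) :
    Integrable (fun y => accept p x y * f y) (multivariateGaussian x S) :=
  Integrable.of_bound ((measurable_accept hp hc x).mul hf).aestronglyMeasurable B
    (ae_of_all _ fun y => by
      rw [norm_mul, Real.norm_eq_abs, Real.norm_eq_abs]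
      calc _ ≤ 1 * B := mul_le_mul (abs_accept_le_one hp x y) (hB y) (abs_nonneg _) zero_le_one
        _ = B := one_mul B)

include hS

lemma metroOp_eq_integral {f : State d → ℝ} {x : State d}
    (hint : Integrable (fun y => accept p x y * f y) (multivariateGaussian x S)) :
    metroOp p S f x = ∫ y, f y ∂(metro p S x) := by
  rw [integral_metro hp hc S x hint, integral_multivariateGaussian_eq hS, metroOp]

lemma abs_metroOp_le {f : State d → ℝ} (hf : Measurable f) {B : ℝ} (hB : ∀ x, |f x| ≤ B)
    (x : State d) : |metroOp p S f x| ≤ B := by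
  have := isProbabilityMeasure_metro hp hc S x
  rw [metroOp_eq_integral hp hc hS (integrable_accept_mul hp hc S x hf hB)]
  have := norm_integral_le_of_norm_le_const (μ := metro p S x) (f := f) (C := B)
    (ae_of_all _ fun y => hB y)
  simpa using this

lemma integrable_metroOp_integrand {f : State d → ℝ} (hf : Measurable f) {B : ℝ}
    (hB : ∀ x, |f x| ≤ B) (x : State d) :
    Integrable fun y => gaussDens S (y - x) * (accept p x y * (f y - f x)) :=
  (integrable_multivariateGaussian_iff hS x _).1
    (integrable_accept_mul_sub hp hc S x (integrable_accept_mul hp hc S x hf hB))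

lemma metroOp_sub {f g : State d → ℝ} (hf : Measurable f) (hg : Measurable g) {B C : ℝ}
    (hB : ∀ x, |f x| ≤ B) (hC : ∀ x, |g x| ≤ C) (x : State d) :
    metroOp p S (fun y => f y - g y) x = metroOp p S f x - metroOp p S g x := by
  unfold metroOp
  have h1 : (fun y => gaussDens S (y - x) * (accept p x y * ((f y - g y) - (f x - g x)))) =
      fun y => gaussDens S (y - x) * (accept p x y * (f y - f x)) -
        gaussDens S (y - x) * (accept p x y * (g y - g x)) := by
    funext y; ring
  rw [h1, integral_sub (integrable_metroOp_integrand hp hc hS hf hB x)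
    (integrable_metroOp_integrand hp hc hS hg hC x)]
  ring

lemma abs_metroOp_sub_le {S' : Matrix (Fin d) (Fin d) ℝ} (hS' : S'.PosDef) {f : State d → ℝ}
    (hf : Measurable f) {B : ℝ} (hB : ∀ x, |f x| ≤ B) (x : State d) :
    |metroOp p S f x - metroOp p S' f x| ≤
      2 * B * ∫ z, |gaussDens S z - gaussDens S' z| := by
  have hi : Integrable fun y => |gaussDens S (y - x) - gaussDens S' (y - x)| :=
    ((integrable_gaussDens hS x).sub (integrable_gaussDens hS' x)).abs
  unfold metroOp
  rw [add_sub_add_left_eq_sub, ← integral_sub (integrable_metroOp_integrand hp hc hS hf hB x)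
    (integrable_metroOp_integrand hp hc hS' hf hB x)]
  rw [← integral_sub_right_eq_self (fun z => |gaussDens S z - gaussDens S' z|) x,
    ← integral_const_mul, ← Real.norm_eq_abs]
  refine norm_integral_le_of_norm_le (hi.const_mul _) (ae_of_all _ fun y => ?_)
  rw [← sub_mul, norm_mul, norm_mul, Real.norm_eq_abs, Real.norm_eq_abs, Real.norm_eq_abs]
  have h1 : |f y - f x| ≤ 2 * B := by
    have := abs_sub (f y) (f x); have := hB y; have := hB x; linarith
  calc |gaussDens S (y - x) - gaussDens S' (y - x)| * (|accept p x y| * |f y - f x|)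
      ≤ |gaussDens S (y - x) - gaussDens S' (y - x)| * (1 * (2 * B)) := by
        gcongr
        exact abs_accept_le_one hp x y
    _ = _ := by ring

omit hS in
lemma measurable_metroOp_uncurry {F : (Fin d → Fin d → ℝ) × State d → ℝ} (hF : Measurable F) :
    Measurable fun q : (Fin d → Fin d → ℝ) × State d =>
      metroOp p (Matrix.of q.1) (fun y => F (q.1, y)) q.2 := by
  unfold metroOp
  refine Measurable.add (by exact hF) ?_
  have h1 : Measurable fun w : ((Fin d → Fin d → ℝ) × State d) × State d =>
      gaussDens (Matrix.of w.1.1) (w.2 - w.1.2) *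
        (accept p w.1.2 w.2 * (F (w.1.1, w.2) - F (w.1.1, w.1.2))) := by
    have h2 : Measurable fun w : ((Fin d → Fin d → ℝ) × State d) × State d =>
        gaussDens (Matrix.of w.1.1) (w.2 - w.1.2) :=
      measurable_gaussDens.comp (f := fun w : ((Fin d → Fin d → ℝ) × State d) × State d =>
        (w.1.1, w.2 - w.1.2)) (by fun_prop)
    have h3 : Measurable fun w : ((Fin d → Fin d → ℝ) × State d) × State d =>
        accept p w.1.2 w.2 :=
      (continuous_accept hp hc).measurable.comp (measurable_fst.snd.prodMk measurable_snd)
    fun_prop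
  exact (h1.stronglyMeasurable.integral_prod_right).measurable

omit hS in
lemma measurable_metroOp (S : Matrix (Fin d) (Fin d) ℝ) {f : State d → ℝ} (hf : Measurable f) :
    Measurable (metroOp p S f) := by
  have := measurable_metroOp_uncurry hp hc (F := fun q => f q.2) (by fun_prop)
  exact this.comp (g := fun q : (Fin d → Fin d → ℝ) × State d =>
      metroOp p (Matrix.of q.1) (fun y => f y) q.2) (f := fun x => (fun i j => S i j, x))
      (by fun_prop)

/-- Invariance of the target follows from detailed balance: `p x * accept p x y = min (p x) (p y)`
and the Gaussian density is even, so the increment integrand `H` is antisymmetric and its double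
integral vanishes by Fubini. -/
lemma integral_metroOp_target (hpd : IsProbDensity p) {f : State d → ℝ} (hf : Measurable f)
    {B : ℝ} (hB : ∀ x, |f x| ≤ B) :
    ∫ x, metroOp p S f x ∂(target p) = ∫ x, f x ∂(target p) := by
  have hpi : Integrable p := by
    refine ⟨hpd.measurable.aestronglyMeasurable, ?_⟩
    rw [hasFiniteIntegral_iff_ofReal (ae_of_all _ hpd.nonneg), hpd.lintegral_eq_one]
    simp
  have htar : ∀ g : State d → ℝ, ∫ x, g x ∂(target p) = ∫ x, p x * g x := fun g => by
    rw [target, integral_withDensity_eq_integral_toReal_smul hpd.measurable.ennreal_ofReal (by simp)]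
    refine integral_congr_ae (ae_of_all _ fun y => ?_)
    simp [ENNReal.toReal_ofReal (hpd.nonneg y)]
  have hbd : ∀ g : State d → ℝ, Measurable g → (∀ x, |g x| ≤ B) → Integrable fun x => p x * g x :=
    fun g hg hgB => hpi.mul_bdd hg.aestronglyMeasurable (ae_of_all _ hgB)
  set H : State d → State d → ℝ := fun x y =>
    p x * (gaussDens S (y - x) * (accept p x y * (f y - f x))) with hH
  have hanti : ∀ x y, H y x = -H x y := fun x y => by
    have h1 : ∀ u v, p u * accept p u v = min (p u) (p v) := fun u v => by
      rw [accept, mul_min_of_nonneg _ _ (hp u).le, mul_one, mul_div_cancel₀ _ (hp u).ne']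
    have h2 : gaussDens S (x - y) = gaussDens S (y - x) := by rw [← gaussDens_neg, neg_sub]
    calc H y x = (p y * accept p y x) * gaussDens S (x - y) * (f x - f y) := by
          simp only [hH]; ring
      _ = -((p x * accept p x y) * gaussDens S (y - x) * (f y - f x)) := by
          rw [h1, h1, h2, min_comm]; ring
      _ = -H x y := by simp only [hH]; ring
  have hHm : Measurable fun w : State d × State d => H w.1 w.2 := by
    have h2 : Measurable fun w : State d × State d => gaussDens S (w.2 - w.1) :=
      ((continuous_gaussDens S).comp (continuous_snd.sub continuous_fst)).measurable
    have h3 := (continuous_accept hp hc).measurable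
    have h4 := hc.measurable
    simp only [hH]
    fun_prop
  have hHb : ∀ x y, ‖H x y‖ ≤ 2 * B * (p x * gaussDens S (y - x)) := fun x y => by
    have h1 : |f y - f x| ≤ 2 * B := by
      have := abs_sub (f y) (f x); have := hB y; have := hB x; linarith
    simp only [hH, norm_mul, Real.norm_eq_abs, abs_of_pos (hp x), abs_of_nonneg (gaussDens_nonneg S _)]
    calc p x * (gaussDens S (y - x) * (|accept p x y| * |f y - f x|))
        ≤ p x * (gaussDens S (y - x) * (1 * (2 * B))) := by
          have := (hp x).le
          have := gaussDens_nonneg S (y - x)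
          gcongr
          exact abs_accept_le_one hp x y
      _ = _ := by ring
  have hprod : Integrable (fun w : State d × State d => H w.1 w.2) (volume.prod volume) := by
    rw [integrable_prod_iff hHm.aestronglyMeasurable]
    refine ⟨ae_of_all _ fun x => (integrable_metroOp_integrand hp hc hS hf hB x).const_mul (p x), ?_⟩
    refine Integrable.mono' (hpi.const_mul (2 * B))
      (hHm.norm.stronglyMeasurable.integral_prod_right).aestronglyMeasurable (ae_of_all _ fun x => ?_)
    rw [Real.norm_of_nonneg (integral_nonneg fun y => norm_nonneg _)]
    calc ∫ y, ‖H x y‖ ≤ ∫ y, 2 * B * (p x * gaussDens S (y - x)) :=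
          integral_mono ((integrable_metroOp_integrand hp hc hS hf hB x).const_mul (p x)).norm
            (((integrable_gaussDens hS x).const_mul _).const_mul _) (hHb x)
      _ = _ := by rw [integral_const_mul, integral_const_mul, integral_gaussDens hS, mul_one]
  have hzero : ∫ x, ∫ y, H x y = 0 := by
    have h1 : ∫ x, ∫ y, H x y = ∫ y, ∫ x, H x y := integral_integral_swap hprod
    have h2 : ∫ y, ∫ x, H x y = -∫ y, ∫ x, H y x := by
      rw [← integral_neg]
      refine integral_congr_ae (ae_of_all _ fun y => ?_)
      simp only
      rw [← integral_neg]
      refine integral_congr_ae (ae_of_all _ fun x => ?_)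
      simp only
      rw [hanti y x]
    linarith
  have hsplit : ∀ x, p x * metroOp p S f x = p x * f x + ∫ y, H x y := fun x => by
    rw [metroOp, mul_add, ← integral_const_mul]
  rw [htar, htar]
  simp only [hsplit]
  rw [integral_add (hbd f hf hB) hprod.integral_prod_left, hzero, add_zero]

end

/-! ### Compact sets of covariance matrices -/

/-- Covariance matrices bounded below by `k` and with entries bounded by `M`. -/
def covSet (d : ℕ) (k M : ℝ) : Set (Fin d → Fin d → ℝ) :=
  {a | UniformlyElliptic k (Matrix.of a) ∧ ∀ i j, |a i j| ≤ M}

lemma isCompact_covSet (k M : ℝ) : IsCompact (covSet d k M) := by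
  have h1 : IsCompact (Set.pi Set.univ fun _ : Fin d => Set.pi Set.univ fun _ : Fin d =>
      Set.Icc (-M) M) := isCompact_univ_pi fun _ => isCompact_univ_pi fun _ => isCompact_Icc
  refine h1.of_isClosed_subset ?_ fun a ha => ?_
  · have h2 : covSet d k M = (⋂ i, ⋂ j, {a : Fin d → Fin d → ℝ | a j i = a i j}) ∩
        (⋂ z : State d, {a | k * ‖z‖ ^ 2 ≤ quadForm (Matrix.of a) z}) ∩
        ⋂ i, ⋂ j, {a | |a i j| ≤ M} := by
      ext a
      simp only [covSet, Set.mem_ofPred_eq, Set.mem_inter_iff, Set.mem_iInter]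
      constructor
      · rintro ⟨⟨h3, h4⟩, h5⟩
        exact ⟨⟨fun i j => congrFun (congrFun h3 i) j, h4⟩, h5⟩
      · rintro ⟨⟨h3, h4⟩, h5⟩
        exact ⟨⟨by ext i j; exact h3 i j, h4⟩, h5⟩
    rw [h2]
    refine ((isClosed_iInter fun i => isClosed_iInter fun j => isClosed_eq (by fun_prop)
      (by fun_prop)).inter (isClosed_iInter fun z => ?_)).inter
      (isClosed_iInter fun i => isClosed_iInter fun j => isClosed_le (by fun_prop) (by fun_prop))
    refine isClosed_le continuous_const ?_
    simp only [quadForm, dotProduct, Matrix.mulVec, Matrix.of_apply]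
    fun_prop
  · simp only [Set.mem_pi, Set.mem_univ, true_implies]
    exact fun i j => abs_le.1 (ha.2 i j)

/-- Entries bounded by `M` give `S ≤ Λ I` with `Λ = d ^ 2 * M`, hence `S⁻¹ ≥ Λ⁻¹ I`. A multiple of
the isotropic Gaussian of variance `Λ` therefore dominates; the multiple comes from the maximum of
the peak over the compact set. -/
lemma exists_gaussDens_le (hd : 0 < d) {k M : ℝ} (hk : 0 < k) (hM : 0 < M) :
    ∃ g : State d → ℝ, Integrable g ∧ ∀ a ∈ covSet d k M, ∀ z, gaussDens (Matrix.of a) z ≤ g z := by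
  set Λ : ℝ := d ^ 2 * M with hΛ
  have hΛ0 : 0 < Λ := by positivity
  have hsc : UniformlyElliptic Λ (Λ • (1 : Matrix (Fin d) (Fin d) ℝ)) := by
    refine ⟨by simp, fun z => ?_⟩
    rw [quadForm, Matrix.smul_mulVec, Matrix.one_mulVec, dotProduct_smul, norm_sq_eq_dotProduct,
      smul_eq_mul]
  have hpk : ContinuousOn (fun a : Fin d → Fin d → ℝ => gaussPeak (Matrix.of a)) (covSet d k M) := by
    have h1 : ∀ a : Fin d → Fin d → ℝ, gaussPeak (Matrix.of a) = gaussDens (Matrix.of a) 0 :=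
      fun a => by simp [gaussDens, gaussPeak, quadForm]
    simp only [h1]
    exact (continuousOn_gaussDens 0).mono fun a ha => ha.1.det_pos hk
  obtain ⟨C, hC⟩ := (isCompact_covSet k M).bddAbove_image hpk
  have hpd := hsc.posDef hΛ0
  have hpeak := gaussPeak_pos (hsc.det_pos hΛ0)
  refine ⟨fun z => max C 0 * (gaussPeak (Λ • (1 : Matrix (Fin d) (Fin d) ℝ)))⁻¹ *
    gaussDens (Λ • (1 : Matrix (Fin d) (Fin d) ℝ)) z, ?_, fun a ha z => ?_⟩
  · have := integrable_gaussDens hpd 0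
    simp only [sub_zero] at this
    exact this.const_mul _
  · have h1 := hsc.quadForm_inv_le hΛ0 z
    have h2 := ha.1.le_quadForm_inv hk hΛ0 (fun z => quadForm_le_of_entry_le hM.le ha.2 z) z
    have h3 : gaussPeak (Matrix.of a) ≤ max C 0 := (hC ⟨a, ha, rfl⟩).trans (le_max_left _ _)
    simp only [gaussDens_eq_peak_mul]
    have h4 : gaussWeight (Matrix.of a) z ≤ gaussWeight (Λ • (1 : Matrix (Fin d) (Fin d) ℝ)) z :=
      Real.exp_le_exp.2 (by linarith)
    calc gaussPeak (Matrix.of a) * gaussWeight (Matrix.of a) z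
        ≤ max C 0 * gaussWeight (Λ • (1 : Matrix (Fin d) (Fin d) ℝ)) z := by
          have : 0 ≤ gaussWeight (Matrix.of a) z := (Real.exp_pos _).le
          gcongr
      _ = _ := by field_simp

/-- On compact sets of covariance matrices, the Gaussian densities are uniformly continuous in
`L¹`. -/
lemma exists_integral_abs_sub_lt (hd : 0 < d) {k M ε : ℝ} (hk : 0 < k) (hM : 0 < M)
    (hε : 0 < ε) :
    ∃ δ > 0, ∀ a ∈ covSet d k M, ∀ b ∈ covSet d k M, dist a b < δ →
      ∫ z, |gaussDens (Matrix.of a) z - gaussDens (Matrix.of b) z| < ε := by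
  obtain ⟨g, hg, hgle⟩ := exists_gaussDens_le (d := d) hd hk hM
  set G : (Fin d → Fin d → ℝ) × (Fin d → Fin d → ℝ) → ℝ := fun w =>
    ∫ z, |gaussDens (Matrix.of w.1) z - gaussDens (Matrix.of w.2) z| with hG
  have hcont : ContinuousOn G (covSet d k M ×ˢ covSet d k M) := by
    refine continuousOn_of_dominated (bound := fun z => 2 * g z)
      (fun w _ => ((continuous_gaussDens _).sub (continuous_gaussDens _)).abs.aestronglyMeasurable)
      (fun w hw => ae_of_all _ fun z => ?_) (hg.const_mul 2) (ae_of_all _ fun z => ?_)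
    · rw [norm_abs_eq_norm, Real.norm_eq_abs]
      have h1 := hgle _ hw.1 z
      have h2 := hgle _ hw.2 z
      have h3 := gaussDens_nonneg (Matrix.of w.1) z
      have h4 := gaussDens_nonneg (Matrix.of w.2) z
      rw [abs_le]; constructor <;> linarith
    · have h1 := (continuousOn_gaussDens z).mono (fun a (ha : a ∈ covSet d k M) => ha.1.det_pos hk)
      exact ((h1.comp continuousOn_fst fun w hw => hw.1).sub
        (h1.comp continuousOn_snd fun w hw => hw.2)).abs
  have hcpt := (isCompact_covSet (d := d) k M).prod (isCompact_covSet (d := d) k M)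
  have huc := hcpt.uniformContinuousOn_of_continuous hcont
  obtain ⟨δ, hδ, h⟩ := Metric.uniformContinuousOn_iff.1 huc ε hε
  refine ⟨δ, hδ, fun a ha b hb hab => ?_⟩
  -- The `L¹` distance is uniformly continuous as a function of the pair and vanishes on the
  -- diagonal.
  have h1 := h (a, b) ⟨ha, hb⟩ (a, a) ⟨ha, ha⟩ (by
    rw [Prod.dist_eq, dist_self, dist_comm b a]; exact max_lt hδ hab)
  have h2 : G (a, a) = 0 := by simp [hG]
  rw [h2, dist_zero_right] at h1
  exact (le_abs_self _).trans_lt h1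

/-! ### Harris' theorem for weighted oscillations -/

section Harris

variable {E : Type*} [MeasurableSpace E]

lemma integrable_affine {ν : Measure E} [IsFiniteMeasure ν] (c s β w : ℝ) {V : E → ℝ}
    (hV : Integrable V ν) : Integrable (fun v => c * (s + β * (w + V v))) ν := by
  have h1 : Integrable (fun v => w + V v) ν := (integrable_const w).add hV
  exact ((integrable_const s).add (h1.const_mul β)).const_mul c

lemma integral_affine {ν : Measure E} [IsFiniteMeasure ν] (c s β w : ℝ) {V : E → ℝ}
    (hV : Integrable V ν) :
    ∫ v, c * (s + β * (w + V v)) ∂ν =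
      c * (s * ν.real Set.univ + β * (w * ν.real Set.univ + ∫ v, V v ∂ν)) := by
  have h1 : Integrable (fun v => w + V v) ν := (integrable_const w).add hV
  rw [integral_const_mul, integral_add (integrable_const _) (h1.const_mul β), integral_const_mul,
    integral_add (integrable_const _) hV]
  simp only [integral_const, smul_eq_mul]
  ring

/-- Independent coupling: integrate the oscillation bound in both variables and divide by the common
mass `m`. For `m = 0` both measures vanish. -/
lemma integral_sub_integral_le_of_osc {μ ν : Measure E} [IsFiniteMeasure μ] [IsFiniteMeasure ν]
    {m c β : ℝ} (hμ : μ.real Set.univ = m) (hν : ν.real Set.univ = m) {φ V : E → ℝ}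
    (hφμ : Integrable φ μ) (hφν : Integrable φ ν) (hVμ : Integrable V μ) (hVν : Integrable V ν)
    (hosc : ∀ u v, φ u - φ v ≤ c * (2 + β * (V u + V v))) :
    ∫ x, φ x ∂μ - ∫ x, φ x ∂ν ≤ c * (2 * m + β * (∫ x, V x ∂μ + ∫ x, V x ∂ν)) := by
  have hm0 : 0 ≤ m := hμ ▸ measureReal_nonneg
  rcases hm0.eq_or_lt with hm | hm
  · have h1 : μ = 0 := by
      rw [← Measure.measure_univ_eq_zero, ← measureReal_eq_zero_iff, hμ, hm]
    have h2 : ν = 0 := by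
      rw [← Measure.measure_univ_eq_zero, ← measureReal_eq_zero_iff, hν, hm]
    simp [h1, h2, ← hm]
  have h1 : ∀ u, m * φ u - ∫ v, φ v ∂ν ≤ c * (2 * m + β * (m * V u + ∫ v, V v ∂ν)) := fun u => by
    calc m * φ u - ∫ v, φ v ∂ν = ∫ v, (φ u - φ v) ∂ν := by
          rw [integral_sub (integrable_const _) hφν]; simp [hν]
      _ ≤ ∫ v, c * (2 + β * (V u + V v)) ∂ν :=
          integral_mono ((integrable_const _).sub hφν) (integrable_affine c 2 β (V u) hVν)
            fun v => hosc u v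
      _ = _ := by rw [integral_affine c 2 β (V u) hVν, hν]; ring
  have h2 : m * (∫ x, φ x ∂μ - ∫ x, φ x ∂ν) ≤
      m * (c * (2 * m + β * (∫ x, V x ∂μ + ∫ x, V x ∂ν))) := by
    calc m * (∫ x, φ x ∂μ - ∫ x, φ x ∂ν) = ∫ u, (m * φ u - ∫ v, φ v ∂ν) ∂μ := by
          rw [integral_sub (hφμ.const_mul m) (integrable_const _), integral_const_mul]
          simp [hμ]; ring
      _ ≤ ∫ u, c * (2 * m + β * (m * V u + ∫ v, V v ∂ν)) ∂μ :=
          integral_mono ((hφμ.const_mul m).sub (integrable_const _)) (by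
            simp only [add_comm (m * _)]
            exact integrable_affine c (2 * m) β _ (hVμ.const_mul m)) h1
      _ = _ := by
          simp only [add_comm (m * _)]
          rw [integral_affine c (2 * m) β _ (hVμ.const_mul m), hμ, integral_const_mul]
          ring
  exact le_of_mul_le_mul_left h2 hm

/-- The common part `θ` cancels in the difference, so only the residual measures of mass `1 - α`
need to be coupled. -/
lemma integral_sub_integral_le_of_common {μ ν θ : Measure E} [IsProbabilityMeasure μ]
    [IsProbabilityMeasure ν] {α c β : ℝ} (hα : θ.real Set.univ = α) (hθμ : θ ≤ μ) (hθν : θ ≤ ν)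
    {φ V : E → ℝ} (hc : 0 ≤ c) (hβ : 0 ≤ β) (hV0 : ∀ x, 0 ≤ V x)
    (hφμ : Integrable φ μ) (hφν : Integrable φ ν) (hVμ : Integrable V μ) (hVν : Integrable V ν)
    (hosc : ∀ u v, φ u - φ v ≤ c * (2 + β * (V u + V v))) :
    ∫ x, φ x ∂μ - ∫ x, φ x ∂ν ≤ c * (2 * (1 - α) + β * (∫ x, V x ∂μ + ∫ x, V x ∂ν)) := by
  have : IsFiniteMeasure θ := isFiniteMeasure_of_le μ hθμ
  have hμ' : μ - θ + θ = μ := Measure.sub_add_cancel_of_le hθμ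
  have hν' : ν - θ + θ = ν := Measure.sub_add_cancel_of_le hθν
  have hle1 : μ - θ ≤ μ := Measure.sub_le
  have hle2 : ν - θ ≤ ν := Measure.sub_le
  have : IsFiniteMeasure (μ - θ) := isFiniteMeasure_of_le μ hle1
  have : IsFiniteMeasure (ν - θ) := isFiniteMeasure_of_le ν hle2
  have hm1 : (μ - θ).real Set.univ = 1 - α := by
    have : (μ - θ + θ).real Set.univ = 1 := by rw [hμ']; simp
    rw [measureReal_add_apply, hα] at this
    linarith
  have hm2 : (ν - θ).real Set.univ = 1 - α := by
    have : (ν - θ + θ).real Set.univ = 1 := by rw [hν']; simp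
    rw [measureReal_add_apply, hα] at this
    linarith
  have h1 := integral_sub_integral_le_of_osc hm1 hm2 (hφμ.mono_measure hle1)
    (hφν.mono_measure hle2) (hVμ.mono_measure hle1) (hVν.mono_measure hle2) hosc
  have h2 : ∫ x, φ x ∂μ = ∫ x, φ x ∂(μ - θ) + ∫ x, φ x ∂θ := by
    rw [← integral_add_measure (hφμ.mono_measure hle1) (hφμ.mono_measure hθμ), hμ']
  have h3 : ∫ x, φ x ∂ν = ∫ x, φ x ∂(ν - θ) + ∫ x, φ x ∂θ := by
    rw [← integral_add_measure (hφν.mono_measure hle2) (hφν.mono_measure hθν), hν']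
  have h4 : ∫ x, V x ∂(μ - θ) ≤ ∫ x, V x ∂μ :=
    integral_mono_measure hle1 (ae_of_all _ hV0) hVμ
  have h5 : ∫ x, V x ∂(ν - θ) ≤ ∫ x, V x ∂ν :=
    integral_mono_measure hle2 (ae_of_all _ hV0) hVν
  rw [h2, h3]
  calc _ = ∫ x, φ x ∂(μ - θ) - ∫ x, φ x ∂(ν - θ) := by ring
    _ ≤ _ := h1
    _ ≤ _ := by gcongr

/-- **Harris' theorem** (one-step contraction of weighted oscillations), with a contraction factor
depending only on the drift and minorization constants. -/
lemma exists_osc_contraction {γ b α : ℝ} (hγ0 : 0 ≤ γ) (hγ1 : γ < 1) (hb : 0 ≤ b) (hα0 : 0 < α) :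
    ∃ β q : ℝ, 0 < β ∧ 0 ≤ q ∧ q < 1 ∧ ∀ (K : E → Measure E) (V : E → ℝ),
      (∀ x, IsProbabilityMeasure (K x)) → (∀ x, 0 ≤ V x) → (∀ x, Integrable V (K x)) →
      (∀ x, ∫ y, V y ∂(K x) ≤ γ * V x + b) →
      (∀ x y, V x + V y ≤ 4 * b / (1 - γ) + 1 →
        ∃ θ : Measure E, θ.real Set.univ = α ∧ θ ≤ K x ∧ θ ≤ K y) →
      ∀ (φ : E → ℝ) (c : ℝ), 0 ≤ c → (∀ x, Integrable φ (K x)) →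
        (∀ u v, φ u - φ v ≤ c * (2 + β * (V u + V v))) →
        ∀ u v, ∫ y, φ y ∂(K u) - ∫ y, φ y ∂(K v) ≤ (c * q) * (2 + β * (V u + V v)) := by
  have h1γ : 0 < 1 - γ := by linarith
  set R : ℝ := 4 * b / (1 - γ) + 1 with hR
  have hR1 : 1 ≤ R := by
    have : 0 ≤ 4 * b / (1 - γ) := by positivity
    linarith
  -- Small enough that the drift constant costs at most `2 * β * b ≤ α`, half of the `2 * α` saved
  -- by the minorization.
  set β : ℝ := α / (2 * (b + 1)) with hβ
  have hβ0 : 0 < β := by positivity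
  set e : ℝ := min (min (α / 2) ((1 - γ) / 4)) (β * (1 - γ) * R / 8) with he
  have he0 : 0 < e := by
    refine lt_min (lt_min (by positivity) (by positivity)) (by positivity)
  have he1 : e ≤ α / 2 := (min_le_left _ _).trans (min_le_left _ _)
  have he2 : e ≤ (1 - γ) / 4 := (min_le_left _ _).trans (min_le_right _ _)
  have he3 : e ≤ β * (1 - γ) * R / 8 := min_le_right _ _
  have hβb : β * b ≤ α / 2 := by
    rw [hβ, div_mul_eq_mul_div, div_le_div_iff₀ (by positivity) (by positivity)]
    nlinarith
  refine ⟨β, 1 - e, hβ0, by linarith, by linarith, fun K V hK hV0 hVK hdrift hminor φ c hc hφ hosc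
    u v => ?_⟩
  have := hK u
  have := hK v
  have hs0 : 0 ≤ V u + V v := add_nonneg (hV0 u) (hV0 v)
  have hd : ∫ y, V y ∂(K u) + ∫ y, V y ∂(K v) ≤ γ * (V u + V v) + 2 * b := by
    have := hdrift u; have := hdrift v; linarith
  rw [mul_assoc]
  -- For small `V u + V v` the minorization gives the contraction. For large values the drift does:
  -- `R` is chosen so that `4 * b ≤ (1 - γ) * (V u + V v)`.
  rcases le_total (V u + V v) R with h | h
  · obtain ⟨θ, hθα, h1, h2⟩ := hminor u v h
    refine (integral_sub_integral_le_of_common hθα h1 h2 hc hβ0.le hV0 (hφ u) (hφ v) (hVK u) (hVK v)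
      hosc).trans (mul_le_mul_of_nonneg_left ?_ hc)
    have h3 := mul_le_mul_of_nonneg_left hd hβ0.le
    have h4 : e * (β * (V u + V v)) ≤ (1 - γ) / 4 * (β * (V u + V v)) := by gcongr
    have h5 : 0 ≤ (1 - γ) * (β * (V u + V v)) := by positivity
    linarith
  · refine (integral_sub_integral_le_of_osc (m := 1) (by simp) (by simp) (hφ u) (hφ v) (hVK u)
      (hVK v) hosc).trans (mul_le_mul_of_nonneg_left ?_ hc)
    have h3 := mul_le_mul_of_nonneg_left hd hβ0.le
    have h4 : e * (β * (V u + V v)) ≤ (1 - γ) / 4 * (β * (V u + V v)) := by gcongr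
    have h5 : 4 * b ≤ (1 - γ) * (V u + V v) := by
      have : 4 * b / (1 - γ) ≤ V u + V v := by linarith
      rw [div_le_iff₀ h1γ] at this
      linarith
    have h6 := mul_le_mul_of_nonneg_left h5 hβ0.le
    have h7 : β * (1 - γ) * R ≤ β * (1 - γ) * (V u + V v) := by gcongr
    linarith

end Harris

/-! ### Uniform ergodicity over compact sets of covariances -/

variable {d : ℕ} {p : State d → ℝ}

lemma isProbabilityMeasure_target {d : ℕ} {p : State d → ℝ} (hp : IsProbDensity p) :
    IsProbabilityMeasure (target p) :=
  ⟨by rw [target, withDensity_apply _ MeasurableSet.univ, Measure.restrict_univ,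
    hp.lintegral_eq_one]⟩

namespace SuperExpRegularContours

/-- The integrand is `p ^ (1 - t)`, which still decays exponentially because `t < 1`. -/
lemma integrable_lyap_target (hM : SuperExpRegularContours p) {t : ℝ} (ht : t ∈ Set.Ioo (0 : ℝ) 1) :
    Integrable (lyap p t) (target p) := by
  have h1t : 0 < 1 - t := by linarith [ht.2]
  obtain ⟨C, hC0, hC⟩ := hM.exists_le_exp_neg (1 / (1 - t)) (by positivity)
  have hm := hM.continuous.measurable
  rw [target, integrable_withDensity_iff_integrable_smul₀' hm.ennreal_ofReal.aemeasurable (by simp)]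
  have h0 := (integrable_one_add_norm (E := State d) (μ := volume) (r := (d : ℝ) + 1) (by simp)).const_mul
    (C ^ (1 - t) * Real.exp 1 * (d + 1).factorial)
  refine h0.mono' (hm.ennreal_ofReal.ennreal_toReal.smul
    (continuous_lyap hM.pos hM.continuous t).measurable).aestronglyMeasurable
    (ae_of_all _ fun x => ?_)
  have hx := hM.pos x
  have h1 : p x * lyap p t x = p x ^ (1 - t) := by
    rw [lyap, sub_eq_add_neg, Real.rpow_add hx, Real.rpow_one]
  rw [ENNReal.toReal_ofReal hx.le, smul_eq_mul, h1, Real.norm_of_nonneg (by positivity)]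
  have h2 : p x ^ (1 - t) ≤ C ^ (1 - t) * Real.exp (-‖x‖) := by
    calc p x ^ (1 - t) ≤ (C * Real.exp (-(1 / (1 - t)) * ‖x‖)) ^ (1 - t) :=
          Real.rpow_le_rpow hx.le (hC x) h1t.le
      _ = C ^ (1 - t) * Real.exp (-‖x‖) := by
          rw [Real.mul_rpow hC0.le (Real.exp_pos _).le, ← Real.exp_mul]
          congr 2; field_simp
  have h3 := Real.pow_div_factorial_le_exp (1 + ‖x‖) (by positivity) (d + 1)
  rw [div_le_iff₀ (by positivity), Real.exp_add] at h3
  have h4 : (1 + ‖x‖) ^ (-((d : ℝ) + 1)) = ((1 + ‖x‖) ^ (d + 1))⁻¹ := by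
    rw [Real.rpow_neg (by positivity)]; norm_cast
  have h5 : Real.exp (-‖x‖) ≤ Real.exp 1 * (d + 1).factorial * ((1 + ‖x‖) ^ (d + 1))⁻¹ := by
    rw [← div_eq_mul_inv, le_div_iff₀ (by positivity), Real.exp_neg,
      inv_mul_le_iff₀ (Real.exp_pos _)]
    linarith
  rw [h4]
  calc _ ≤ _ := h2
    _ ≤ C ^ (1 - t) * (Real.exp 1 * (d + 1).factorial * ((1 + ‖x‖) ^ (d + 1))⁻¹) := by gcongr
    _ = _ := by ring

/-- Sublevel sets of the Lyapunov function lie in a ball, where the Gaussian densities of the family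
and the acceptance probabilities are uniformly bounded below. The minorizing measure is a multiple
of Lebesgue measure on that ball, the same for all covariances in the set. -/
lemma exists_minorization (hM : SuperExpRegularContours p) {k M t R : ℝ} (hk : 0 < k)
    (ht : 0 < t) :
    ∃ α : ℝ, 0 < α ∧ ∃ θ : Measure (State d), θ.real Set.univ = α ∧ ∀ a ∈ covSet d k M,
      ∀ x, lyap p t x ≤ R → θ ≤ metro p (Matrix.of a) x := by
  have hpos := hM.pos
  obtain ⟨C, hC0, hC⟩ := hM.exists_pow_norm_le_lyap ht 1
  obtain ⟨B, hB⟩ := hM.bounded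
  have hB0 : 0 < B := (hM.pos 0).trans_le (hB 0)
  set r : ℝ := max (C * R) 1 with hr
  have hr0 : 0 < r := lt_of_lt_of_le one_pos (le_max_right _ _)
  obtain ⟨z, -, hz⟩ := (isCompact_closedBall (0 : State d) r).exists_isMinOn
    ⟨0, by simp [hr0.le]⟩ hM.continuous.continuousOn
  set M' : ℝ := max M 1 with hM'
  have hM'0 : 0 < M' := lt_of_lt_of_le one_pos (le_max_right _ _)
  set c : ℝ := (√((2 * Real.pi) ^ d * (d.factorial * M' ^ d)))⁻¹ *
    Real.exp (-((2 * r) ^ 2 / k) / 2) * min 1 (p z / B) with hc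
  have hc0 : 0 < c := by
    have : 0 < min 1 (p z / B) := lt_min one_pos (div_pos (hpos z) hB0)
    have : 0 < (2 * Real.pi) ^ d := by positivity
    positivity
  have hv0 : 0 < volume.real (Metric.closedBall (0 : State d) r) :=
    ENNReal.toReal_pos (Metric.measure_closedBall_pos _ _ hr0).ne' measure_closedBall_lt_top.ne
  refine ⟨c * volume.real (Metric.closedBall (0 : State d) r), by positivity,
    ENNReal.ofReal c • volume.restrict (Metric.closedBall 0 r), ?_, fun a ha x hx => ?_⟩
  · simp [measureReal_def, ENNReal.toReal_ofReal hc0.le]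
  have hxr : ‖x‖ ≤ r := by
    have h1 := hC x
    rw [pow_one] at h1
    exact h1.trans ((mul_le_mul_of_nonneg_left hx hC0.le).trans (le_max_left _ _))
  have hpd := ha.1.posDef hk
  have hgm := (measurable_gaussDens_sub (Matrix.of a) x).ennreal_ofReal
  have ham := (measurable_accept hpos hM.continuous x).ennreal_ofReal
  refine Measure.le_iff.2 fun s hs => ?_
  have hrhs : ∫⁻ y in s, ENNReal.ofReal (gaussDens (Matrix.of a) (y - x)) *
      ENNReal.ofReal (accept p x y) ≤ metro p (Matrix.of a) x s := by
    rw [metro, Measure.add_apply, multivariateGaussian_eq_withDensity hpd,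
      ← withDensity_mul _ hgm ham, withDensity_apply _ hs]
    exact le_self_add
  refine le_trans ?_ hrhs
  rw [Measure.smul_apply, Measure.restrict_apply hs, smul_eq_mul, ← setLIntegral_const]
  refine le_trans (setLIntegral_mono' (hs.inter measurableSet_closedBall) fun y hy => ?_)
    (lintegral_mono_set Set.inter_subset_left)
  have hyr : ‖y‖ ≤ r := by simpa using hy.2
  rw [← ENNReal.ofReal_mul (gaussDens_nonneg _ _)]
  apply ENNReal.ofReal_le_ofReal
  have h1 : min 1 (p z / B) ≤ accept p x y := by
    apply min_le_min le_rfl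
    have := hpos x
    gcongr
    · exact (hpos y).le
    · exact hz (by simpa using hyr)
    · exact hB x
  have h2 : (√((2 * Real.pi) ^ d * (d.factorial * M' ^ d)))⁻¹ ≤ gaussPeak (Matrix.of a) := by
    unfold gaussPeak
    have h3 := det_le_of_entry_le (S := Matrix.of a) (M := M')
      fun i j => (ha.2 i j).trans (le_max_left _ _)
    have h4 := ha.1.det_pos hk
    gcongr
  have h5 : Real.exp (-((2 * r) ^ 2 / k) / 2) ≤ gaussWeight (Matrix.of a) (y - x) := by
    apply Real.exp_le_exp.2
    have h6 := ha.1.quadForm_inv_le hk (y - x)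
    have h7 : ‖y - x‖ ≤ 2 * r := (norm_sub_le _ _).trans (by linarith)
    have h8 : ‖y - x‖ ^ 2 / k ≤ (2 * r) ^ 2 / k := by gcongr
    linarith
  rw [gaussDens_eq_peak_mul]
  have h9 : 0 ≤ gaussPeak (Matrix.of a) := (gaussPeak_pos (ha.1.det_pos hk)).le
  have h10 : 0 ≤ min 1 (p z / B) := le_min zero_le_one (div_pos (hpos z) hB0).le
  exact mul_le_mul (mul_le_mul h2 h5 (Real.exp_pos _).le h9) h1 h10
    (mul_nonneg h9 (Real.exp_pos _).le)

lemma exists_gaussPeak_ge {k M : ℝ} (hk : 0 < k) (hM : 0 < M) :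
    ∃ c : ℝ, 0 < c ∧ ∀ a ∈ covSet d k M, c ≤ gaussPeak (Matrix.of a) := by
  have : 0 < (2 * Real.pi) ^ d := by positivity
  refine ⟨(√((2 * Real.pi) ^ d * (d.factorial * M ^ d)))⁻¹, by positivity, fun a ha => ?_⟩
  unfold gaussPeak
  have h3 := det_le_of_entry_le (S := Matrix.of a) ha.2
  have h4 := ha.1.det_pos hk
  gcongr

/-- Uniform geometric ergodicity over compact sets of covariance matrices. -/
lemma exists_uniform_ergodicity (hM : SuperExpRegularContours p) (hp : IsProbDensity p) (hd : 0 < d)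
    {k M t : ℝ} (hk : 0 < k) (hM0 : 0 < M) (ht : t ∈ Set.Ioo (0 : ℝ) 1) :
    ∃ C q : ℝ, 0 ≤ C ∧ 0 ≤ q ∧ q < 1 ∧ ∀ a ∈ covSet d k M, ∀ (f : State d → ℝ) (B : ℝ),
      Measurable f → (∀ x, |f x| ≤ B) → ∀ (n : ℕ) (x : State d),
        |(metroOp p (Matrix.of a))^[n] f x - ∫ y, f y ∂(target p)| ≤
          B * C * q ^ n * (1 + lyap p t x) := by
  have hpos := hM.pos
  have hcont := hM.continuous
  obtain ⟨c, b, hc, hb, hdrift⟩ := hM.exists_drift hd ht hk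
  obtain ⟨c', hc', hpeak⟩ := exists_gaussPeak_ge (d := d) hk hM0
  -- On the compact set the peak is at least `c'`, so the drift becomes geometric.
  set γ : ℝ := max (1 - c * c') 0 with hγ
  have hγ0 : 0 ≤ γ := le_max_right _ _
  have hγ1 : γ < 1 := max_lt (by have := mul_pos hc hc'; linarith) one_pos
  obtain ⟨α, hα, θ, hθα, hθ⟩ := hM.exists_minorization (k := k) (M := M)
    (R := 4 * b / (1 - γ) + 1) hk ht.1
  obtain ⟨β, q, hβ, hq0, hq1, hcontr⟩ := exists_osc_contraction (E := State d) hγ0 hγ1 hb hα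
  have hV := hM.integrable_lyap_target ht
  have hprob := isProbabilityMeasure_target hp
  set v : ℝ := ∫ y, lyap p t y ∂(target p) with hv
  have hv0 : 0 ≤ v := integral_nonneg fun y => (lyap_pos hpos t y).le
  refine ⟨2 + β + β * v, q, by positivity, hq0, hq1, fun a ha f B hf hB n x => ?_⟩
  have hB0 : 0 ≤ B := (abs_nonneg _).trans (hB x)
  have hpd := ha.1.posDef hk
  let T := metroOp p (Matrix.of a)
  have hmeas : ∀ n, Measurable (T^[n] f) ∧ ∀ x, |T^[n] f x| ≤ B := fun n => by
    induction n with
    | zero => exact ⟨hf, hB⟩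
    | succ n ih =>
      rw [Function.iterate_succ']
      exact ⟨measurable_metroOp hpos hcont _ ih.1, abs_metroOp_le hpos hcont hpd ih.1 ih.2⟩
  have hosc : ∀ n u v, T^[n] f u - T^[n] f v ≤
      (B * q ^ n) * (2 + β * (lyap p t u + lyap p t v)) := fun n => by
    induction n with
    | zero =>
      intro u v
      have h1 := abs_le.1 (hB u)
      have h2 := abs_le.1 (hB v)
      have h3 : 0 ≤ B * (β * (lyap p t u + lyap p t v)) := by
        have := lyap_pos hpos t u; have := lyap_pos hpos t v
        positivity
      simp only [Function.iterate_zero, id, pow_zero, mul_one]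
      linarith
    | succ n ih =>
      intro u v
      have hint := fun x => integrable_accept_mul hpos hcont (Matrix.of a) x (hmeas n).1 (hmeas n).2
      have hTu : ∀ w, T^[n + 1] f w = ∫ y, T^[n] f y ∂(metro p (Matrix.of a) w) := fun w => by
        rw [Function.iterate_succ']
        exact metroOp_eq_integral hpos hcont hpd (hint w)
      rw [hTu, hTu, pow_succ, ← mul_assoc]
      refine hcontr (metro p (Matrix.of a)) (lyap p t)
        (isProbabilityMeasure_metro hpos hcont _) (fun x => (lyap_pos hpos t x).le)
        (integrable_lyap_metro hpos hcont _ ht) (fun x => ?_) (fun x y hxy => ?_) (T^[n] f)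
        (B * q ^ n) (by positivity)
        (fun x => integrable_metro hpos hcont _ x (hint x)) ih u v
      · have h1 := (hdrift _ ha.1).2 x
        have h2 : c * c' * lyap p t x ≤ c * gaussPeak (Matrix.of a) * lyap p t x := by
          have := lyap_pos hpos t x
          have := hpeak a ha
          gcongr
        have h3 : (1 - c * c') * lyap p t x ≤ γ * lyap p t x := by
          have := lyap_pos hpos t x
          gcongr
          exact le_max_left _ _
        linarith
      · have := lyap_pos hpos t x; have := lyap_pos hpos t y
        exact ⟨θ, hθα, hθ a ha x (by linarith), hθ a ha y (by linarith)⟩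
  have hinv : ∀ n, ∫ y, T^[n] f y ∂(target p) = ∫ y, f y ∂(target p) := fun n => by
    induction n with
    | zero => rfl
    | succ n ih =>
      rw [Function.iterate_succ', ← ih]
      exact integral_metroOp_target hpos hcont hpd hp (hmeas n).1 (hmeas n).2
  have hTint : Integrable (T^[n] f) (target p) :=
    Integrable.of_bound (hmeas n).1.aestronglyMeasurable B (ae_of_all _ (hmeas n).2)
  have hVx := lyap_pos hpos t x
  have hqn : 0 ≤ B * q ^ n := by positivity
  have hfin : B * q ^ n * (2 + β * (lyap p t x + v)) ≤
      B * (2 + β + β * v) * q ^ n * (1 + lyap p t x) := by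
    have h1 : 2 + β * (lyap p t x + v) ≤ (2 + β + β * v) * (1 + lyap p t x) := by
      have : 0 ≤ β * v * lyap p t x := by positivity
      nlinarith
    have := mul_le_mul_of_nonneg_left h1 hqn
    linarith
  have hbound : ∀ y, |T^[n] f x - T^[n] f y| ≤
      (B * q ^ n) * (2 + β * (lyap p t x + lyap p t y)) := fun y => by
    have h1 := hosc n x y
    have h2 := hosc n y x
    rw [add_comm (lyap p t y)] at h2
    rw [abs_le]; constructor <;> linarith
  -- Invariance turns the oscillation bound into convergence to the mean.
  have h1 : T^[n] f x - ∫ y, f y ∂(target p) = ∫ y, (T^[n] f x - T^[n] f y) ∂(target p) := by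
    rw [integral_sub (integrable_const _) hTint, hinv]; simp
  rw [h1]
  refine le_trans ?_ hfin
  rw [← Real.norm_eq_abs]
  refine (norm_integral_le_of_norm_le (integrable_affine (B * q ^ n) 2 β (lyap p t x) hV)
    (ae_of_all _ hbound)).trans (le_of_eq ?_)
  rw [integral_affine _ _ _ _ hV]
  simp [hv]

end SuperExpRegularContours

/-! ### Martingale laws of large numbers and averages under a drift -/

/-- A form of Kronecker's lemma: if `∑ d k / (k + 1)` converges, the averages of `d` tend to `0`. -/
theorem tendsto_average_of_tendsto_sum_div {d : ℕ → ℝ} {l : ℝ}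
    (h : Tendsto (fun n => ∑ k ∈ Finset.range n, d k / ((k : ℝ) + 1)) atTop (𝓝 l)) :
    Tendsto (fun n : ℕ => (n : ℝ)⁻¹ * ∑ k ∈ Finset.range n, d k) atTop (𝓝 0) := by
  set S : ℕ → ℝ := fun n => ∑ k ∈ Finset.range n, d k / ((k : ℝ) + 1) with hS
  -- Summation by parts: the average of `d` is `S n` minus the Cesàro mean of `S`.
  have key : ∀ n : ℕ, ∑ k ∈ Finset.range n, d k = n * S n - ∑ k ∈ Finset.range n, S k := by
    intro n
    induction n with
    | zero => simp
    | succ n ih =>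
      have h1 : S (n + 1) = S n + d n / ((n : ℝ) + 1) := by
        simp only [hS, Finset.sum_range_succ]
      rw [Finset.sum_range_succ, Finset.sum_range_succ, ih, h1]
      have : (n : ℝ) + 1 ≠ 0 := by positivity
      push_cast
      field_simp
      ring
  have h2 := h.sub h.cesaro
  rw [sub_self] at h2
  refine h2.congr' ?_
  filter_upwards [eventually_gt_atTop 0] with n hn
  have : (n : ℝ) ≠ 0 := by positivity
  rw [key]
  field_simp

section Probability

variable {Ω : Type*} {m mΩ : MeasurableSpace Ω} {P : Measure Ω} [IsProbabilityMeasure P]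

/-- A martingale difference is orthogonal to the past. -/
theorem integral_mul_eq_zero_of_condExp_eq_zero (hm : m ≤ mΩ)
    {f g : Ω → ℝ} (hf : StronglyMeasurable[m] f) (hf2 : MemLp f 2 P) (hg2 : MemLp g 2 P)
    (hg : P[g | m] =ᵐ[P] 0) : ∫ ω, f ω * g ω ∂P = 0 := by
  have hint : Integrable (f * g) P := hf2.integrable_mul hg2
  have h := condExp_mul_of_stronglyMeasurable_left hf hint (hg2.integrable one_le_two)
  have h2 := integral_condExp hm (μ := P) (f := f * g)
  have h3 : P[f * g | m] =ᵐ[P] 0 := by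
    filter_upwards [h, hg] with ω h1 h2
    rw [h1, Pi.mul_apply, h2]
    simp
  rw [integral_congr_ae h3] at h2
  simpa using h2.symm

/-- Strong law of large numbers for square-integrable martingale differences. -/
theorem ae_tendsto_average_of_martingale_diff {ℱ : Filtration ℕ mΩ} {D : ℕ → Ω → ℝ}
    (hD : ∀ n, StronglyMeasurable[ℱ (n + 1)] (D n)) (hD2 : ∀ n, MemLp (D n) 2 P)
    (hD0 : ∀ n, P[D n | ℱ n] =ᵐ[P] 0)
    (hsum : Summable fun n : ℕ => (∫ ω, D n ω ^ 2 ∂P) / ((n : ℝ) + 1) ^ 2) :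
    ∀ᵐ ω ∂P, Tendsto (fun n : ℕ => (n : ℝ)⁻¹ * ∑ k ∈ Finset.range n, D k ω) atTop (𝓝 0) := by
  set M : ℕ → Ω → ℝ := fun n => ∑ k ∈ Finset.range n, ((k : ℝ) + 1)⁻¹ • D k with hM
  have hsucc : ∀ n, M (n + 1) = M n + ((n : ℝ) + 1)⁻¹ • D n := fun n => by
    simp only [hM, Finset.sum_range_succ]
  have hadp : ∀ n, StronglyMeasurable[ℱ n] (M n) := by
    intro n
    simp only [hM]
    refine Finset.stronglyMeasurable_sum _ fun k hk => ?_
    exact ((hD k).mono (ℱ.mono (Finset.mem_range.1 hk))).const_smul _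
  have hM2 : ∀ n, MemLp (M n) 2 P := fun n =>
    memLp_finsetSum' _ fun k _ => (hD2 k).const_smul _
  have hint : ∀ n, Integrable (M n) P := fun n => (hM2 n).integrable one_le_two
  have hmart : Martingale M ℱ P := by
    refine martingale_of_condExp_sub_eq_zero_nat hadp hint fun n => ?_
    have : M (n + 1) - M n = ((n : ℝ) + 1)⁻¹ • D n := by rw [hsucc]; simp
    rw [this]
    filter_upwards [condExp_smul (μ := P) ((n : ℝ) + 1)⁻¹ (D n) (ℱ n), hD0 n] with ω h1 h2
    rw [h1, Pi.smul_apply, h2]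
    simp
  -- Orthogonality of the increments makes the weighted sum bounded in `L²`, hence almost surely
  -- convergent.
  have hsq : ∀ n, ∫ ω, M n ω ^ 2 ∂P
      = ∑ k ∈ Finset.range n, (∫ ω, D k ω ^ 2 ∂P) / ((k : ℝ) + 1) ^ 2 := by
    intro n
    induction n with
    | zero => simp [hM]
    | succ n ih =>
      rw [Finset.sum_range_succ, ← ih]
      have h0 := integral_mul_eq_zero_of_condExp_eq_zero (ℱ.le n) (hadp n) (hM2 n) (hD2 n) (hD0 n)
      have e : ∀ ω, M (n + 1) ω ^ 2 = (M n ω ^ 2 + 2 * ((n : ℝ) + 1)⁻¹ * (M n ω * D n ω))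
          + (((n : ℝ) + 1) ^ 2)⁻¹ * D n ω ^ 2 := by
        intro ω
        rw [hsucc, Pi.add_apply, Pi.smul_apply, smul_eq_mul, ← inv_pow]
        ring
      have i1 := (hM2 n).integrable_sq
      have i2 : Integrable (fun ω => M n ω * D n ω) P := (hM2 n).integrable_mul (hD2 n)
      have i3 := (hD2 n).integrable_sq
      have i12 : Integrable (fun ω => M n ω ^ 2 + 2 * ((n : ℝ) + 1)⁻¹ * (M n ω * D n ω)) P :=
        i1.add (i2.const_mul _)
      simp_rw [e]
      rw [integral_add i12 (i3.const_mul _),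
        integral_add i1 (i2.const_mul _), integral_const_mul, integral_const_mul, h0]
      ring
  set R : ℝ := 1 + ∑' n : ℕ, (∫ ω, D n ω ^ 2 ∂P) / ((n : ℝ) + 1) ^ 2 with hR
  have hbdd : ∀ n, eLpNorm (M n) 1 P ≤ (R.toNNReal : ℝ≥0∞) := by
    intro n
    rw [eLpNorm_one_eq_lintegral_enorm, ← ofReal_integral_norm_eq_lintegral_enorm (hint n)]
    refine ENNReal.ofReal_le_ofReal ?_
    calc ∫ ω, ‖M n ω‖ ∂P ≤ ∫ ω, (1 + M n ω ^ 2) ∂P := by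
          refine integral_mono (hint n).norm ((integrable_const _).add (hM2 n).integrable_sq) ?_
          intro ω
          simp only [Real.norm_eq_abs]
          nlinarith [sq_nonneg (|M n ω| - 1), sq_abs (M n ω), abs_nonneg (M n ω)]
      _ = 1 + ∫ ω, M n ω ^ 2 ∂P := by
          rw [integral_add (integrable_const _) (hM2 n).integrable_sq]; simp
      _ ≤ R := by
          rw [hsq, hR]
          gcongr
          exact hsum.sum_le_tsum _ fun k _ => by positivity
  filter_upwards [hmart.submartingale.exists_ae_tendsto_of_bdd hbdd] with ω ⟨l, hl⟩
  refine tendsto_average_of_tendsto_sum_div (l := l) (hl.congr fun n => ?_)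
  simp only [hM, Finset.sum_apply, Pi.smul_apply, smul_eq_mul]
  exact Finset.sum_congr rfl fun k _ => by rw [div_eq_inv_mul]

variable {E : Type*} [MeasurableSpace E]

/-- Integrating a one-step bound of a transition kernel over an event of the past. -/
theorem setLIntegral_comp_le_of_integral_le (hm : m ≤ mΩ)
    {Y : Ω → E} (hY : Measurable Y) {K : Ω → Measure E}
    (hK : ∀ f : E → ℝ, Measurable f → (∃ C : ℝ, ∀ x, |f x| ≤ C) →
      P[fun ω => f (Y ω) | m] =ᵐ[P] fun ω => ∫ y, f y ∂(K ω))
    {A : Set Ω} (hA : MeasurableSet[m] A) {V : E → ℝ} (hV : Measurable V) (hV0 : ∀ x, 0 ≤ V x)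
    {g : Ω → ℝ} (hg : ∀ ω ∈ A, Integrable V (K ω) ∧ ∫ y, V y ∂(K ω) ≤ g ω) :
    ∫⁻ ω in A, ENNReal.ofReal (V (Y ω)) ∂P ≤ ∫⁻ ω in A, ENNReal.ofReal (g ω) ∂P := by
  -- The transition law is only known on bounded functions, so `V` is truncated at `L` and monotone
  -- convergence removes the truncation.
  have hstep : ∀ L : ℕ, ∫⁻ ω in A, ENNReal.ofReal (min (V (Y ω)) L) ∂P
      ≤ ∫⁻ ω in A, ENNReal.ofReal (g ω) ∂P := by
    intro L
    have hb : ∀ x, |min (V x) (L : ℝ)| ≤ L := fun x => by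
      rw [abs_of_nonneg (le_min (hV0 x) (Nat.cast_nonneg L))]; exact min_le_right _ _
    have hmeas : Measurable fun x => min (V x) (L : ℝ) := hV.min measurable_const
    have hc := hK _ hmeas ⟨L, hb⟩
    have hint : Integrable (fun ω => min (V (Y ω)) (L : ℝ)) P :=
      Integrable.of_bound (hmeas.comp hY).aestronglyMeasurable (L : ℝ)
        (ae_of_all _ fun ω => hb (Y ω))
    have hint2 : Integrable (fun ω => ∫ y, min (V y) (L : ℝ) ∂(K ω)) P :=
      integrable_condExp.congr hc
    have hpos : ∀ ω, 0 ≤ ∫ y, min (V y) (L : ℝ) ∂(K ω) := fun ω =>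
      integral_nonneg fun y => le_min (hV0 y) (Nat.cast_nonneg L)
    rw [← ofReal_integral_eq_lintegral_ofReal hint.integrableOn
      (ae_of_all _ fun ω => le_min (hV0 _) (Nat.cast_nonneg L)),
      ← setIntegral_condExp hm hint hA, setIntegral_congr_ae (hm _ hA)
        (hc.mono fun ω h _ => h),
      ofReal_integral_eq_lintegral_ofReal hint2.integrableOn (ae_of_all _ hpos)]
    refine setLIntegral_mono' (hm _ hA) fun ω hω => ENNReal.ofReal_le_ofReal ?_
    refine le_trans (integral_mono_of_nonneg (ae_of_all _ fun y =>
      le_min (hV0 y) (Nat.cast_nonneg L)) (hg ω hω).1 (ae_of_all _ fun y => min_le_left _ _))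
      (hg ω hω).2
  have hlim : Tendsto (fun L : ℕ => ∫⁻ ω in A, ENNReal.ofReal (min (V (Y ω)) L) ∂P) atTop
      (𝓝 (∫⁻ ω in A, ENNReal.ofReal (V (Y ω)) ∂P)) := by
    refine lintegral_tendsto_of_tendsto_of_monotone ?_ ?_ ?_
    · exact fun L => (((hV.comp hY).min measurable_const).ennreal_ofReal).aemeasurable
    · refine ae_of_all _ fun ω L L' hL => ENNReal.ofReal_le_ofReal ?_
      exact min_le_min le_rfl (by exact_mod_cast hL)
    · refine ae_of_all _ fun ω => ?_
      refine tendsto_const_nhds.congr' ?_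
      obtain ⟨N, hN⟩ := exists_nat_ge (V (Y ω))
      filter_upwards [eventually_ge_atTop N] with L hL
      rw [min_eq_left (hN.trans (by exact_mod_cast hL))]
  exact le_of_tendsto' hlim hstep

/-- Conditional expectation of a function of the past and of the next state. -/
theorem condExp_prodMk_ae_eq (hm : m ≤ mΩ)
    {β : Type*} [MeasurableSpace β] {T : Ω → β} (hT : Measurable[m] T)
    {Y : Ω → E} (hY : Measurable Y) {k : Kernel β E} [IsMarkovKernel k]
    (hk : ∀ f : E → ℝ, Measurable f → (∃ C : ℝ, ∀ x, |f x| ≤ C) →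
      P[fun ω => f (Y ω) | m] =ᵐ[P] fun ω => ∫ y, f y ∂(k (T ω)))
    {F : β × E → ℝ} (hF : Measurable F) {B : ℝ} (hB : ∀ q, |F q| ≤ B) :
    P[fun ω => F (T ω, Y ω) | m] =ᵐ[P] fun ω => ∫ y, F (T ω, y) ∂(k (T ω)) := by
  have hT' : Measurable T := hT.mono hm le_rfl
  have hTY : Measurable fun ω => (T ω, Y ω) := hT'.prodMk hY
  have hmeas : StronglyMeasurable fun b => ∫ y, F (b, y) ∂(k b) :=
    StronglyMeasurable.integral_kernel_prod_right (f := fun b y => F (b, y)) hF.stronglyMeasurable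
  have hmeasT : StronglyMeasurable[m] fun ω => ∫ y, F (T ω, y) ∂(k (T ω)) :=
    hmeas.comp_measurable hT
  have hbd : ∀ b, ‖∫ y, F (b, y) ∂(k b)‖ ≤ B := fun b => by
    refine (norm_integral_le_of_norm_le_const (ae_of_all _ fun y => hB (b, y))).trans ?_
    simp
  have hi : Integrable (fun ω => F (T ω, Y ω)) P :=
    Integrable.of_bound (hF.comp hTY).aestronglyMeasurable B (ae_of_all _ fun ω => hB _)
  have hi2 : Integrable (fun ω => ∫ y, F (T ω, y) ∂(k (T ω))) P :=
    Integrable.of_bound (hmeasT.mono hm).aestronglyMeasurable B (ae_of_all _ fun ω => hbd _)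
  refine (ae_eq_condExp_of_forall_setIntegral_eq hm hi (fun A _ _ => hi2.integrableOn) ?_
    hmeasT.aestronglyMeasurable).symm
  intro A hA _
  -- The joint law on an event of the past is identified on rectangles, where the hypothesis on the
  -- transition of indicators applies.
  have key : (P.restrict A).map (fun ω => (T ω, Y ω)) = ((P.restrict A).map T) ⊗ₘ k := by
    refine Measure.ext_prod (fun {C} {D} hC hD => ?_)
    have hS : MeasurableSet[m] (T ⁻¹' C ∩ A) := (hT hC).inter hA
    have hc := hk (D.indicator fun _ => 1) (measurable_const.indicator hD)
      ⟨1, fun x => by by_cases h : x ∈ D <;> simp [h]⟩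
    have hint : Integrable (fun ω => D.indicator (fun _ => (1 : ℝ)) (Y ω)) P :=
      Integrable.of_bound ((measurable_const.indicator hD).comp hY).aestronglyMeasurable 1
        (ae_of_all _ fun ω => by by_cases h : Y ω ∈ D <;> simp [h])
    have hint2 := (integrable_condExp (μ := P) (m := m)).congr hc
    rw [Measure.map_apply hTY (hC.prod hD), Measure.compProd_apply_prod hC hD,
      setLIntegral_map hC (k.measurable_coe hD) hT',
      Measure.restrict_restrict (hT' hC)]
    have e1 : (fun ω => (T ω, Y ω)) ⁻¹' C ×ˢ D = Y ⁻¹' D ∩ (T ⁻¹' C) := by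
      ext ω; simp [and_comm]
    rw [e1, Measure.restrict_apply ((hY hD).inter (hT' hC)), Set.inter_assoc,
      ← Measure.restrict_apply (hY hD), ← lintegral_indicator_one (hY hD)]
    have e2 : ∀ ω, (Y ⁻¹' D).indicator (1 : Ω → ℝ≥0∞) ω
        = ENNReal.ofReal (D.indicator (fun _ => (1 : ℝ)) (Y ω)) := fun ω => by
      by_cases h : Y ω ∈ D <;> simp [h]
    simp_rw [e2]
    rw [← ofReal_integral_eq_lintegral_ofReal hint.integrableOn
      (ae_of_all _ fun ω => Set.indicator_nonneg (fun _ _ => zero_le_one) _),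
      ← setIntegral_condExp hm hint hS, setIntegral_congr_ae (hm _ hS) (hc.mono fun ω h _ => h),
      ofReal_integral_eq_lintegral_ofReal hint2.integrableOn (ae_of_all _ fun ω =>
        integral_nonneg fun y => Set.indicator_nonneg (fun _ _ => zero_le_one) _)]
    refine lintegral_congr fun ω => ?_
    rw [integral_indicator_const _ hD]
    simp
  have hi3 : Integrable F (((P.restrict A).map T) ⊗ₘ k) := by
    have : IsProbabilityMeasure P := inferInstance
    exact Integrable.of_bound hF.aestronglyMeasurable B (ae_of_all _ fun q => hB q)
  calc ∫ ω in A, ∫ y, F (T ω, y) ∂(k (T ω)) ∂P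
      = ∫ b, ∫ y, F (b, y) ∂(k b) ∂((P.restrict A).map T) :=
        (integral_map hT'.aemeasurable hmeas.aestronglyMeasurable).symm
    _ = ∫ q, F q ∂(((P.restrict A).map T) ⊗ₘ k) := (Measure.integral_compProd hi3).symm
    _ = ∫ ω in A, F (T ω, Y ω) ∂P := by
        rw [← key, integral_map hTY.aemeasurable hF.aestronglyMeasurable]

end Probability

section Probability

variable {Ω : Type*} {mΩ : MeasurableSpace Ω} {P : Measure Ω} [IsProbabilityMeasure P]

/-- Strong law of large numbers for `Z n - 𝔼[Z n | ℱ n]`. -/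
theorem ae_tendsto_average_sub_condExp {ℱ : Filtration ℕ mΩ} {Z : ℕ → Ω → ℝ}
    (hZ : ∀ n, StronglyMeasurable[ℱ (n + 1)] (Z n)) (hZ2 : ∀ n, MemLp (Z n) 2 P)
    (hsum : Summable fun n : ℕ => (∫ ω, Z n ω ^ 2 ∂P) / ((n : ℝ) + 1) ^ 2) :
    ∀ᵐ ω ∂P, Tendsto (fun n : ℕ => (n : ℝ)⁻¹ *
      ∑ k ∈ Finset.range n, (Z k ω - (P[Z k | ℱ k]) ω)) atTop (𝓝 0) := by
  have hc2 : ∀ n, MemLp (P[Z n | ℱ n]) 2 P := fun n => (hZ2 n).condExp one_le_two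
  have hZ1 : ∀ n, Integrable (Z n) P := fun n => (hZ2 n).integrable one_le_two
  have hD2 : ∀ n, MemLp (Z n - P[Z n | ℱ n]) 2 P := fun n => (hZ2 n).sub (hc2 n)
  have hD0 : ∀ n, P[Z n - P[Z n | ℱ n] | ℱ n] =ᵐ[P] 0 := fun n => by
    filter_upwards [condExp_sub (hZ1 n) integrable_condExp (ℱ n)] with ω h
    rw [h, Pi.sub_apply, condExp_of_stronglyMeasurable (ℱ.le n) stronglyMeasurable_condExp
      integrable_condExp]
    simp
  refine ae_tendsto_average_of_martingale_diff (ℱ := ℱ) (D := fun n => Z n - P[Z n | ℱ n])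
    (fun n => (hZ n).sub (stronglyMeasurable_condExp.mono (ℱ.mono n.le_succ))) hD2 hD0 ?_
  refine Summable.of_nonneg_of_le (fun n => by positivity) (fun n => ?_) hsum
  gcongr ?_ / _
  have h0 := integral_mul_eq_zero_of_condExp_eq_zero (ℱ.le n)
    (stronglyMeasurable_condExp (m := ℱ n) (μ := P) (f := Z n)) (hc2 n) (hD2 n) (hD0 n)
  have i1 := (hD2 n).integrable_sq
  have i2 : Integrable (fun ω => (P[Z n | ℱ n]) ω * (Z n - P[Z n | ℱ n]) ω) P :=
    (hc2 n).integrable_mul (hD2 n)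
  have e : ∫ ω, ((Z n - P[Z n | ℱ n]) ω ^ 2
      + 2 * ((P[Z n | ℱ n]) ω * (Z n - P[Z n | ℱ n]) ω)) ∂P
      = ∫ ω, (Z n - P[Z n | ℱ n]) ω ^ 2 ∂P := by
    rw [integral_add i1 (i2.const_mul _), integral_const_mul, h0]
    simp
  rw [← e]
  refine integral_mono (i1.add (i2.const_mul _)) (hZ2 n).integrable_sq fun ω => ?_
  simp only [Pi.sub_apply]
  nlinarith [sq_nonneg ((P[Z n | ℱ n]) ω)]

variable {E : Type*} [MeasurableSpace E]

/-- A drift inequality of an adaptive chain controls the time averages of the drift function. -/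
theorem ae_sum_le_mul_of_drift {ℱ : Filtration ℕ mΩ} {X : ℕ → Ω → E}
    (hX : ∀ n, Measurable[ℱ n] (X n)) {K : ℕ → Ω → Measure E}
    [∀ n ω, IsProbabilityMeasure (K n ω)]
    (hK : ∀ n, ∀ f : E → ℝ, Measurable f → (∃ C : ℝ, ∀ x, |f x| ≤ C) →
      P[fun ω => f (X (n + 1) ω) | ℱ n] =ᵐ[P] fun ω => ∫ y, f y ∂(K n ω))
    {A : ℕ → Set Ω} (hA : ∀ n, MeasurableSet[ℱ n] (A n))
    {U : E → ℝ} (hU : Measurable U) (hU0 : ∀ x, 0 ≤ U x) {δ : ℕ → Ω → ℝ} {b : ℝ}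
    (hb : 0 ≤ b)
    (hdrift : ∀ n, 1 ≤ n → ∀ ω ∈ A n, Integrable U (K n ω) ∧
      (∫ y, U y ∂(K n ω)) + δ n ω * U (X n ω) ≤ U (X n ω) + b)
    (hsum : ∑' n : ℕ, ∫⁻ ω in A n,
      ENNReal.ofReal ((min (U (X (n + 1) ω)) ((n : ℝ) + 1) / ((n : ℝ) + 1)) ^ 2) ∂P ≠ ∞) :
    ∀ᵐ ω ∂P, (∀ n, 1 ≤ n → ω ∈ A n) →
      ∃ C : ℝ, ∀ N : ℕ, 1 ≤ N → ∑ k ∈ Finset.Ico 1 N, δ k ω * U (X k ω) ≤ C * N := by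
  have hXm : ∀ n, Measurable (X n) := fun n => (hX n).mono (ℱ.le n) le_rfl
  have hAm : ∀ n, MeasurableSet (A n) := fun n => ℱ.le n _ (hA n)
  set u : ℕ → E → ℝ := fun n x => min (U x) ((n : ℝ) + 1) with hu
  have hum : ∀ n, Measurable (u n) := fun n => hU.min measurable_const
  have hu0 : ∀ n x, 0 ≤ u n x := fun n x => le_min (hU0 x) (by positivity)
  have hub : ∀ n x, |u n x| ≤ (n : ℝ) + 1 := fun n x => by
    rw [abs_of_nonneg (hu0 n x)]; exact min_le_right _ _
  -- Truncation at level `n + 1` and restriction to the past event `A n` give square-integrable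
  -- variables to which the martingale law applies.
  set Z : ℕ → Ω → ℝ := fun n => (A n).indicator fun ω => u n (X (n + 1) ω) with hZdef
  have hZm : ∀ n, StronglyMeasurable[ℱ (n + 1)] (Z n) := fun n =>
    (((hum n).comp (hX (n + 1))).indicator (ℱ.mono n.le_succ _ (hA n))).stronglyMeasurable
  have hZb : ∀ n ω, ‖Z n ω‖ ≤ (n : ℝ) + 1 := fun n ω => by
    simp only [hZdef]
    exact (norm_indicator_le_norm_self _ _).trans (hub n _)
  have hZ2 : ∀ n, MemLp (Z n) 2 P := fun n =>
    MemLp.of_bound ((hZm n).mono (ℱ.le _)).aestronglyMeasurable ((n : ℝ) + 1)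
      (ae_of_all _ (hZb n))
  have hsq : ∀ n : ℕ, (∫ ω, Z n ω ^ 2 ∂P) / ((n : ℝ) + 1) ^ 2 = (∫⁻ ω in A n,
      ENNReal.ofReal ((min (U (X (n + 1) ω)) ((n : ℝ) + 1) / ((n : ℝ) + 1)) ^ 2) ∂P).toReal := by
    intro n
    rw [← integral_toReal (by
        exact ((((hum n).comp (hXm (n + 1))).div_const _).pow_const 2).ennreal_ofReal.aemeasurable)
      (ae_of_all _ fun ω => ENNReal.ofReal_lt_top), ← integral_indicator (hAm n),
      ← integral_div]
    refine integral_congr_ae (ae_of_all _ fun ω => ?_)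
    by_cases h : ω ∈ A n
    · simp only [hZdef, hu, Set.indicator_of_mem h]
      rw [ENNReal.toReal_ofReal (by positivity), div_pow]
    · simp [hZdef, Set.indicator_of_notMem h]
  have hs : Summable fun n : ℕ => (∫ ω, Z n ω ^ 2 ∂P) / ((n : ℝ) + 1) ^ 2 := by
    simp_rw [hsq]
    exact ENNReal.summable_toReal hsum
  -- Where `U` exceeds `n + 1` the truncated ratio equals `1`, so the summability assumed for the
  -- variances also gives Borel–Cantelli.
  have hBC : ∀ᵐ ω ∂P, ∀ᶠ n : ℕ in atTop,
      ω ∉ {ω | (n : ℝ) + 1 < U (X (n + 1) ω)} ∩ A n := by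
    refine ae_eventually_notMem (ne_top_of_le_ne_top hsum (ENNReal.tsum_le_tsum fun n => ?_))
    have hm : MeasurableSet {ω | (n : ℝ) + 1 < U (X (n + 1) ω)} :=
      measurableSet_lt measurable_const (hU.comp (hXm (n + 1)))
    rw [← Measure.restrict_apply hm, ← lintegral_indicator_one hm]
    refine lintegral_mono fun ω => ?_
    by_cases h : ω ∈ {ω | (n : ℝ) + 1 < U (X (n + 1) ω)}
    · have h' : (n : ℝ) + 1 < U (X (n + 1) ω) := h
      have hn : (n : ℝ) + 1 ≠ 0 := by positivity
      rw [Set.indicator_of_mem h, min_eq_right h'.le, div_self hn]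
      simp
    · simp [Set.indicator_of_notMem h]
  have hcond : ∀ᵐ ω ∂P, ∀ n, (P[Z n | ℱ n]) ω
      = (A n).indicator (fun ω => ∫ y, u n y ∂(K n ω)) ω := by
    refine ae_all_iff.2 fun n => ?_
    have hi : Integrable (fun ω => u n (X (n + 1) ω)) P :=
      Integrable.of_bound ((hum n).comp (hXm (n + 1))).aestronglyMeasurable ((n : ℝ) + 1)
        (ae_of_all _ fun ω => hub n _)
    filter_upwards [condExp_indicator hi (hA n), hK n (u n) (hum n) ⟨_, hub n⟩] with ω h1 h2
    rw [h1]
    by_cases h : ω ∈ A n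
    · rw [Set.indicator_of_mem h, Set.indicator_of_mem h, h2]
    · rw [Set.indicator_of_notMem h, Set.indicator_of_notMem h]
  filter_upwards [ae_tendsto_average_sub_condExp hZm hZ2 hs, hBC, hcond] with ω h1 h2 h3 hω
  set D : ℕ → ℝ := fun n => Z n ω - (P[Z n | ℱ n]) ω with hD
  -- The truncation error, nonzero for only finitely many `n`. Index `0` is excluded since
  -- membership in `A 0` is not assumed.
  set W : ℕ → ℝ := fun n => if 1 ≤ n then U (X (n + 1) ω) - Z n ω else 0 with hW
  have hZn : ∀ n, 1 ≤ n → Z n ω = u n (X (n + 1) ω) := fun n hn => by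
    simp only [hZdef, Set.indicator_of_mem (hω n hn)]
  have hW0 : ∀ n, 0 ≤ W n := fun n => by
    simp only [hW]
    split_ifs with hn
    · rw [hZn n hn]; exact sub_nonneg.2 (min_le_left _ _)
    · exact le_rfl
  obtain ⟨n₀, hn₀⟩ := eventually_atTop.1 h2
  have hWs : Summable W := by
    refine summable_of_ne_finset_zero (s := Finset.range n₀) fun n hn => ?_
    simp only [hW]
    split_ifs with h
    · have h4 := hn₀ n (by simpa using hn)
      have h5 : U (X (n + 1) ω) ≤ (n : ℝ) + 1 := by
        by_contra hcon
        exact h4 ⟨not_le.1 hcon, hω n h⟩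
      rw [hZn n h, hu]
      simp only [min_eq_left h5, sub_self]
    · rfl
  -- The drift with the conditional mean replaced by the next value: a telescoping difference, the
  -- truncation error, the constant `b` and a martingale difference.
  have hstep : ∀ n, 1 ≤ n →
      δ n ω * U (X n ω) ≤ (U (X n ω) - U (X (n + 1) ω)) + W n + b + D n := by
    intro n hn
    obtain ⟨hi, hle⟩ := hdrift n hn ω (hω n hn)
    have h4 : (P[Z n | ℱ n]) ω ≤ ∫ y, U y ∂(K n ω) := by
      rw [h3 n, Set.indicator_of_mem (hω n hn)]
      exact integral_mono_of_nonneg (ae_of_all _ (hu0 n)) hi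
        (ae_of_all _ fun y => min_le_left _ _)
    simp only [hW, hD, if_pos hn]
    linarith
  have hsumle : ∀ N : ℕ, 1 ≤ N → ∑ k ∈ Finset.Ico 1 N, δ k ω * U (X k ω)
      ≤ (U (X 1 ω) - U (X N ω)) + ∑ k ∈ Finset.range N, W k + b * N
        + ∑ k ∈ Finset.range N, D k - D 0 := by
    intro N hN
    induction N, hN using Nat.le_induction with
    | base => simp; linarith [hW0 0]
    | succ n hn ih =>
      rw [Finset.sum_Ico_succ_top hn, Finset.sum_range_succ, Finset.sum_range_succ]
      have := hstep n hn
      push_cast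
      linarith
  obtain ⟨C₀, hC₀⟩ := h1.bddAbove_range
  refine ⟨U (X 1 ω) + (∑' k, W k) + b + |C₀| + |D 0|, fun N hN => (hsumle N hN).trans ?_⟩
  have hN' : (1 : ℝ) ≤ N := by exact_mod_cast hN
  have hC : ∑ k ∈ Finset.range N, D k ≤ |C₀| * N := by
    have h5 : (N : ℝ)⁻¹ * ∑ k ∈ Finset.range N, D k ≤ |C₀| :=
      (hC₀ ⟨N, rfl⟩).trans (le_abs_self _)
    rw [inv_mul_le_iff₀ (by positivity)] at h5
    linarith
  have hWle : ∑ k ∈ Finset.range N, W k ≤ ∑' k, W k := hWs.sum_le_tsum _ fun k _ => hW0 k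
  have hW1 : 0 ≤ ∑' k, W k := tsum_nonneg hW0
  have m1 : U (X 1 ω) * 1 ≤ U (X 1 ω) * N := mul_le_mul_of_nonneg_left hN' (hU0 _)
  have m2 : (∑' k, W k) * 1 ≤ (∑' k, W k) * N := mul_le_mul_of_nonneg_left hN' hW1
  have m3 : |D 0| * 1 ≤ |D 0| * N := mul_le_mul_of_nonneg_left hN' (abs_nonneg _)
  linarith [hU0 (X N ω), neg_abs_le (D 0)]

end Probability

/-! ### Deterministic estimates for the recursion of mean and covariance -/

/-- The covariance matrix of the Gaussian proposal attached to `G`, as a function of the entries. -/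
noncomputable def scaledCov {d : ℕ} (G : Matrix (Fin d) (Fin d) ℝ) : Fin d → Fin d → ℝ :=
  fun i j => ((2.38 : ℝ) ^ 2 * (d : ℝ)⁻¹) * G i j

lemma quadForm_add {d : ℕ} (S S' : Matrix (Fin d) (Fin d) ℝ) (z : State d) :
    quadForm (S + S') z = quadForm S z + quadForm S' z := by
  simp [quadForm, Matrix.add_mulVec]

lemma quadForm_smul {d : ℕ} (c : ℝ) (S : Matrix (Fin d) (Fin d) ℝ) (z : State d) :
    quadForm (c • S) z = c * quadForm S z := by
  simp [quadForm, Matrix.smul_mulVec]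

lemma quadForm_one {d : ℕ} (z : State d) :
    quadForm (1 : Matrix (Fin d) (Fin d) ℝ) z = ‖z‖ ^ 2 := by
  rw [quadForm, Matrix.one_mulVec, norm_sq_eq_dotProduct]

lemma quadForm_vecMulVec_self {d : ℕ} (v z : State d) :
    quadForm (Matrix.vecMulVec v.ofLp v.ofLp) z = (z.ofLp ⬝ᵥ v.ofLp) ^ 2 := by
  rw [quadForm, Matrix.vecMulVec_mulVec, dotProduct_comm v.ofLp]
  simp [sq]

lemma UniformlyElliptic.scaled {d : ℕ} (hd : 0 < d) {k : ℝ} {G : Matrix (Fin d) (Fin d) ℝ}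
    (h : UniformlyElliptic k G) :
    UniformlyElliptic ((2.38 : ℝ) ^ 2 * (d : ℝ)⁻¹ * k) (Matrix.of (scaledCov G)) := by
  have e : Matrix.of (scaledCov G) = ((2.38 : ℝ) ^ 2 * (d : ℝ)⁻¹) • G := by
    ext i j; simp [scaledCov]
  rw [e]
  refine ⟨by rw [Matrix.transpose_smul, h.symm], fun z => ?_⟩
  rw [quadForm_smul, mul_assoc]
  exact mul_le_mul_of_nonneg_left (h.lower z) (by positivity)

/-- The square root in the peak is dropped, which is allowed because the quantity under it is
bounded by a number at least `1`. The resulting power `M ^ d` is still affordable. -/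
lemma le_gaussPeak {d : ℕ} {k M : ℝ} (hk : 0 < k) (hM : 1 ≤ M) {a : Fin d → Fin d → ℝ}
    (ha : a ∈ covSet d k M) :
    ((2 * Real.pi) ^ d * (d.factorial * M ^ d))⁻¹ ≤ gaussPeak (Matrix.of a) := by
  have h1 := det_le_of_entry_le (S := Matrix.of a) ha.2
  have h2 := ha.1.det_pos hk
  have h3 : (1 : ℝ) ≤ (2 * Real.pi) ^ d * (d.factorial * M ^ d) := by
    have h4 : (1 : ℝ) ≤ (2 * Real.pi) ^ d := one_le_pow₀ (by linarith [Real.pi_gt_three])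
    have h5 : (1 : ℝ) ≤ d.factorial := by exact_mod_cast Nat.one_le_iff_ne_zero.2 (d.factorial_ne_zero)
    have h6 : (1 : ℝ) ≤ M ^ d := one_le_pow₀ hM
    exact one_le_mul_of_one_le_of_one_le h4 (one_le_mul_of_one_le_of_one_le h5 h6)
  unfold gaussPeak
  refine inv_anti₀ (by positivity) ?_
  calc √((2 * Real.pi) ^ d * (Matrix.of a).det)
      ≤ √((2 * Real.pi) ^ d * (d.factorial * M ^ d)) := Real.sqrt_le_sqrt (by gcongr)
    _ ≤ (2 * Real.pi) ^ d * (d.factorial * M ^ d) := by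
      rw [Real.sqrt_le_left (by linarith)]
      exact le_self_pow₀ h3 two_ne_zero

/-- A nonnegative sequence that is controlled by its running maximum in a sublinear way is
bounded. -/
lemma exists_bound_of_pow_le {m : ℕ} (hm : 0 < m) {A : ℕ → ℝ} {c₀ C : ℝ} (hc₀ : 0 ≤ c₀)
    (h : ∀ N, ∀ M : ℝ, 1 ≤ M → (∀ j ≤ N, A j ≤ M) → A N ^ (2 * m) ≤ C * (c₀ + 4 * M) ^ m) :
    ∃ B : ℝ, ∀ n, A n ≤ B := by
  set C' : ℝ := max C 1 with hC'
  have hC1 : 1 ≤ C' := le_max_right _ _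
  set B : ℝ := max 1 (C' * (c₀ + 4)) with hB
  refine ⟨B, fun n => ?_⟩
  induction n using Nat.strong_induction_on with
  | _ n ih =>
    by_contra! hcon
    have h1 : 1 < A n := (le_max_left _ _).trans_lt hcon
    have h2 := h n (A n) h1.le fun j hj => by
      rcases hj.lt_or_eq with hj | hj
      · exact (ih j hj).trans hcon.le
      · rw [hj]
    have h0 : 0 ≤ c₀ + 4 * A n := by positivity
    -- At a first violation of the bound, `A n` is its own running maximum. Since `C' ≥ 1`, the
    -- constant can be moved inside the power, leaving a quadratic inequality.
    have h3 : (A n ^ 2) ^ m ≤ (C' * (c₀ + 4 * A n)) ^ m := by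
      rw [← pow_mul, mul_pow]
      refine h2.trans (mul_le_mul_of_nonneg_right ?_ (pow_nonneg h0 _))
      exact (le_max_left _ _).trans (le_self_pow₀ hC1 hm.ne')
    have h4 : A n ^ 2 ≤ C' * (c₀ + 4 * A n) :=
      (pow_le_pow_iff_left₀ (by positivity) (by positivity) hm.ne').1 h3
    have h5 : C' * (c₀ + 4) < A n := (le_max_right _ _).trans_lt hcon
    have h6 : C' * (c₀ + 4) * A n < A n * A n := mul_lt_mul_of_pos_right h5 (by linarith)
    have h7 : C' * c₀ * 1 ≤ C' * c₀ * A n := mul_le_mul_of_nonneg_left h1.le (by positivity)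
    nlinarith

namespace IsAMChain

variable {d : ℕ} {Ω : Type*} {mΩ : MeasurableSpace Ω} {p : State d → ℝ} {κ : ℝ}
  {P : Measure Ω} {ℱ : Filtration ℕ mΩ} {X : ℕ → Ω → State d} {μ : ℕ → Ω → State d}
  {Γ : ℕ → Ω → Matrix (Fin d) (Fin d) ℝ}

/-- The first update gives `Γ 0` the weight `0`, so a degenerate start is forgotten. Later updates
are convex combinations of matrices bounded below by `κ`. -/
lemma uniformlyElliptic_cov (hX : IsAMChain p κ P ℱ X μ Γ) (n : ℕ) (ω : Ω) :
    UniformlyElliptic κ (Γ (n + 1) ω) := by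
  have hinc : ∀ v z : State d, κ * ‖z‖ ^ 2 ≤ quadForm (Matrix.vecMulVec v.ofLp v.ofLp
      + κ • (1 : Matrix (Fin d) (Fin d) ℝ)) z := fun v z => by
    rw [quadForm_add, quadForm_smul, quadForm_one, quadForm_vecMulVec_self]
    linarith [sq_nonneg (z.ofLp ⬝ᵥ v.ofLp)]
  have hsym : ∀ v : State d, (Matrix.vecMulVec v.ofLp v.ofLp
      + κ • (1 : Matrix (Fin d) (Fin d) ℝ)).transpose
      = Matrix.vecMulVec v.ofLp v.ofLp + κ • (1 : Matrix (Fin d) (Fin d) ℝ) := fun v => by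
    rw [Matrix.transpose_add, Matrix.transpose_smul, Matrix.transpose_one,
      Matrix.transpose_vecMulVec]
  induction n with
  | zero =>
    rw [hX.cov_succ]
    simp only [Nat.cast_zero, zero_smul, zero_add, div_one, one_smul]
    exact ⟨hsym _, hinc _⟩
  | succ n ih =>
    rw [hX.cov_succ]
    set r : ℝ := ((n + 1 : ℕ) : ℝ) with hr
    have hr0 : 0 ≤ r := by positivity
    refine ⟨by rw [Matrix.transpose_add, Matrix.transpose_smul, Matrix.transpose_smul, hsym,
      ih.symm], fun z => ?_⟩
    rw [quadForm_add, quadForm_smul, quadForm_smul]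
    have h1 := mul_le_mul_of_nonneg_left (ih.lower z) (show 0 ≤ r / (r + 1) by positivity)
    have h2 := mul_le_mul_of_nonneg_left (hinc (X (n + 1 + 1) ω - μ (n + 1) ω) z)
      (show 0 ≤ 1 / (r + 1) by positivity)
    have h3 : κ * ‖z‖ ^ 2 = r / (r + 1) * (κ * ‖z‖ ^ 2) + 1 / (r + 1) * (κ * ‖z‖ ^ 2) := by
      have : r + 1 ≠ 0 := by positivity
      field_simp
    linarith

lemma uniformlyElliptic_scaledCov (hd : 0 < d) (hX : IsAMChain p κ P ℱ X μ Γ) {n : ℕ}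
    (hn : 1 ≤ n) (ω : Ω) :
    UniformlyElliptic ((2.38 : ℝ) ^ 2 * (d : ℝ)⁻¹ * κ) (Matrix.of (scaledCov (Γ n ω))) := by
  obtain ⟨m, rfl⟩ := Nat.exists_eq_add_of_le' hn
  exact (hX.uniformlyElliptic_cov m ω).scaled hd

lemma smul_mean (hX : IsAMChain p κ P ℱ X μ Γ) (n : ℕ) (ω : Ω) :
    (n : ℝ) • μ n ω = ∑ k ∈ Finset.Icc 1 n, X k ω := by
  induction n with
  | zero => simp
  | succ n ih =>
    rw [Finset.sum_Icc_succ_top (by omega), ← ih, hX.mean_succ, smul_add, smul_smul]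
    have : ((n : ℝ) + 1) ≠ 0 := by positivity
    push_cast
    rw [mul_one_div_cancel this]
    module

lemma norm_sq_mean_le (hX : IsAMChain p κ P ℱ X μ Γ) (n : ℕ) (ω : Ω) :
    ‖μ n ω‖ ^ 2 ≤ (n : ℝ)⁻¹ * ∑ k ∈ Finset.Icc 1 n, ‖X k ω‖ ^ 2 := by
  rcases Nat.eq_zero_or_pos n with rfl | hn
  · simp [hX.mean_zero]
  have hn' : (0 : ℝ) < n := by exact_mod_cast hn
  have h1 : (n : ℝ) * ‖μ n ω‖ ≤ ∑ k ∈ Finset.Icc 1 n, ‖X k ω‖ := by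
    have h := congrArg norm (hX.smul_mean n ω)
    rw [norm_smul, Real.norm_of_nonneg hn'.le] at h
    rw [h]
    exact norm_sum_le _ _
  have h2 := sq_sum_le_card_mul_sum_sq (s := Finset.Icc 1 n) (f := fun k => ‖X k ω‖)
  simp only [Nat.card_Icc, Nat.add_sub_cancel] at h2
  have h3 : ((n : ℝ) * ‖μ n ω‖) ^ 2 ≤ (∑ k ∈ Finset.Icc 1 n, ‖X k ω‖) ^ 2 :=
    pow_le_pow_left₀ (by positivity) h1 2
  rw [← div_eq_inv_mul, le_div_iff₀ hn']
  have h4 : (n : ℝ) * (‖μ n ω‖ ^ 2 * n) ≤ n * ∑ k ∈ Finset.Icc 1 n, ‖X k ω‖ ^ 2 := by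
    calc (n : ℝ) * (‖μ n ω‖ ^ 2 * n) = ((n : ℝ) * ‖μ n ω‖) ^ 2 := by ring
      _ ≤ _ := h3.trans h2
  exact le_of_mul_le_mul_left h4 hn'

lemma abs_vecMulVec_self_le (v : State d) (i j : Fin d) :
    |Matrix.vecMulVec v.ofLp v.ofLp i j| ≤ ‖v‖ ^ 2 := by
  rw [Matrix.vecMulVec_apply, abs_mul, sq]
  have h : ∀ i, |v.ofLp i| ≤ ‖v‖ := fun i => by
    rw [← Real.norm_eq_abs]; exact PiLp.norm_apply_le v i
  exact mul_le_mul (h i) (h j) (abs_nonneg _) (norm_nonneg _)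

/-- Multiplied by `n`, the recursion becomes additive, and each increment is controlled by `‖X - μ‖
^ 2 ≤ 2 ‖X‖ ^ 2 + 2 ‖μ‖ ^ 2`. -/
lemma mul_abs_cov_le (hX : IsAMChain p κ P ℱ X μ Γ) (hκ : 0 < κ) (n : ℕ) (ω : Ω) (i j : Fin d) :
    (n : ℝ) * |Γ n ω i j| ≤ n * κ + 2 * ∑ k ∈ Finset.Icc 1 n, ‖X k ω‖ ^ 2
      + 2 * ∑ k ∈ Finset.range n, ‖μ k ω‖ ^ 2 := by
  induction n with
  | zero => simp
  | succ n ih =>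
    have hn : (n : ℝ) + 1 ≠ 0 := by positivity
    set v : State d := X (n + 1) ω - μ n ω with hv
    have e : ((n : ℝ) + 1) * Γ (n + 1) ω i j = n * Γ n ω i j +
        (Matrix.vecMulVec v.ofLp v.ofLp i j + κ * (1 : Matrix (Fin d) (Fin d) ℝ) i j) := by
      rw [hX.cov_succ]
      simp only [Matrix.add_apply, Matrix.smul_apply, smul_eq_mul]
      field_simp
      rw [hv]
    have h1 : ‖v‖ ^ 2 ≤ 2 * ‖X (n + 1) ω‖ ^ 2 + 2 * ‖μ n ω‖ ^ 2 := by
      have h := pow_le_pow_left₀ (norm_nonneg _) (norm_sub_le (X (n + 1) ω) (μ n ω)) 2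
      rw [hv]
      nlinarith [sq_nonneg (‖X (n + 1) ω‖ - ‖μ n ω‖)]
    have h2 : |κ * (1 : Matrix (Fin d) (Fin d) ℝ) i j| ≤ κ := by
      rw [abs_mul, abs_of_pos hκ]
      refine mul_le_of_le_one_right hκ.le ?_
      rw [Matrix.one_apply]
      split_ifs <;> simp
    have h3 := abs_vecMulVec_self_le v i j
    rw [Finset.sum_Icc_succ_top (by omega), Finset.sum_range_succ]
    push_cast
    calc ((n : ℝ) + 1) * |Γ (n + 1) ω i j| = |((n : ℝ) + 1) * Γ (n + 1) ω i j| := by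
          rw [abs_mul, abs_of_nonneg (show (0 : ℝ) ≤ n + 1 by positivity)]
      _ ≤ |(n : ℝ) * Γ n ω i j| + (‖v‖ ^ 2 + κ) := by
          rw [e]
          refine (abs_add_le _ _).trans ?_
          gcongr
          exact (abs_add_le _ _).trans (add_le_add h3 h2)
      _ ≤ _ := by
          rw [abs_mul, Nat.abs_cast]
          linarith

/-- Entries of the covariance are bounded by the empirical second moments. -/
lemma abs_cov_le (hX : IsAMChain p κ P ℱ X μ Γ) (hκ : 0 < κ) {n : ℕ} (hn : 1 ≤ n) {ω : Ω} {M : ℝ}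
    (hM : ∀ j ≤ n, (j : ℝ)⁻¹ * ∑ k ∈ Finset.Icc 1 j, ‖X k ω‖ ^ 2 ≤ M) (i j : Fin d) :
    |Γ n ω i j| ≤ κ + 4 * M := by
  have hn' : (0 : ℝ) < n := by exact_mod_cast hn
  have h1 := hX.mul_abs_cov_le hκ n ω i j
  have h2 : ∑ k ∈ Finset.range n, ‖μ k ω‖ ^ 2 ≤ n * M := by
    refine (Finset.sum_le_sum (g := fun _ => M) fun k hk => ?_).trans (by simp)
    exact (hX.norm_sq_mean_le k ω).trans (hM k (Finset.mem_range.1 hk).le)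
  have h3 := hM n le_rfl
  rw [inv_mul_le_iff₀ hn'] at h3
  refine le_of_mul_le_mul_left (a := (n : ℝ)) ?_ hn'
  linarith

end IsAMChain

lemma lyap_pow {d : ℕ} {p : State d → ℝ} (hp : ∀ x, 0 < p x) (t : ℝ) (m : ℕ) (x : State d) :
    lyap p t x ^ m = lyap p (t * m) x := by
  rw [lyap, lyap, ← Real.rpow_natCast, ← Real.rpow_mul (hp x).le, neg_mul]

/-- Summability criterion for truncated second moments. -/
theorem tsum_setLIntegral_sq_min_ne_top {Ω E : Type*} {mΩ : MeasurableSpace Ω} {P : Measure Ω}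
    [IsProbabilityMeasure P] {Y : ℕ → Ω → E} {A : ℕ → Set Ω} {U V : E → ℝ} {α β v : ℕ → ℝ}
    (hα : ∀ n, 0 ≤ α n) (hβ : ∀ n, 0 ≤ β n) (hv0 : ∀ n, 0 ≤ v n) (hV0 : ∀ x, 0 ≤ V x)
    (hv : ∀ n, ∫⁻ ω in A n, ENNReal.ofReal (V (Y n ω)) ∂P ≤ ENNReal.ofReal (v n))
    (hUV : ∀ (n : ℕ) x, (min (U x) ((n : ℝ) + 1) / ((n : ℝ) + 1)) ^ 2 ≤ α n + β n * V x)
    (hs : Summable fun n => α n + β n * v n) :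
    ∑' n : ℕ, ∫⁻ ω in A n,
      ENNReal.ofReal ((min (U (Y n ω)) ((n : ℝ) + 1) / ((n : ℝ) + 1)) ^ 2) ∂P ≠ ∞ := by
  refine ne_top_of_le_ne_top hs.tsum_ofReal_ne_top (ENNReal.tsum_le_tsum fun n => ?_)
  calc ∫⁻ ω in A n, ENNReal.ofReal ((min (U (Y n ω)) ((n : ℝ) + 1) / ((n : ℝ) + 1)) ^ 2) ∂P
      ≤ ∫⁻ ω in A n, (ENNReal.ofReal (α n) + ENNReal.ofReal (β n) * ENNReal.ofReal (V (Y n ω))) ∂P := by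
        refine lintegral_mono fun ω => ?_
        rw [← ENNReal.ofReal_mul (hβ n), ← ENNReal.ofReal_add (hα n)
          (mul_nonneg (hβ n) (hV0 _))]
        exact ENNReal.ofReal_le_ofReal (hUV n _)
    _ ≤ ENNReal.ofReal (α n) + ENNReal.ofReal (β n) * ENNReal.ofReal (v n) := by
        rw [lintegral_add_left measurable_const, lintegral_const,
          lintegral_const_mul' _ _ ENNReal.ofReal_ne_top]
        refine add_le_add ?_ (mul_le_mul_right (hv n) _)
        rw [Measure.restrict_apply_univ]
        exact (mul_le_mul_right prob_le_one _).trans (mul_one _).le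
    _ = ENNReal.ofReal (α n + β n * v n) := by
        rw [← ENNReal.ofReal_mul (hβ n), ← ENNReal.ofReal_add (hα n)
          (mul_nonneg (hβ n) (hv0 n))]

lemma weight_eq {d : ℕ} {p : State d → ℝ} (hM : SuperExpRegularContours p) {s : ℝ} (hs : 0 < s) :
    ∃ w : ℝ, 0 < w ∧ ∀ x, weight p s x = w * lyap p s x := by
  refine ⟨⨆ y, |p y ^ s|, ?_, fun x => mul_comm _ _⟩
  obtain ⟨C, hC⟩ := hM.bounded
  have hb : BddAbove (Set.range fun y => |p y ^ s|) := by
    refine ⟨C ^ s, ?_⟩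
    rintro _ ⟨y, rfl⟩
    have := hM.pos y
    simp only
    rw [abs_of_nonneg (by positivity)]
    exact Real.rpow_le_rpow this.le (hC y) hs.le
  have h0 : 0 < |p 0 ^ s| := abs_pos.2 (Real.rpow_pos_of_pos (hM.pos 0) s).ne'
  exact h0.trans_le (le_ciSup hb 0)

lemma measurable_scaledCov_of_entry {d : ℕ} {Ω : Type*} {mΩ : MeasurableSpace Ω}
    {G : Ω → Matrix (Fin d) (Fin d) ℝ} (h : ∀ i j, Measurable fun ω => G ω i j) :
    Measurable fun ω => scaledCov (G ω) :=
  measurable_pi_lambda _ fun i => measurable_pi_lambda _ fun j => (h i j).const_mul _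

/-! ### Almost sure boundedness of the covariance matrices -/

namespace IsAMChain

variable {d : ℕ} {Ω : Type*} {mΩ : MeasurableSpace Ω} {p : State d → ℝ} {κ : ℝ}
  {P : Measure Ω} {ℱ : Filtration ℕ mΩ} {X : ℕ → Ω → State d} {μ : ℕ → Ω → State d}
  {Γ : ℕ → Ω → Matrix (Fin d) (Fin d) ℝ}

lemma measurable_state (hX : IsAMChain p κ P ℱ X μ Γ) (n : ℕ) : Measurable (X n) :=
  (hX.adapted_state n).mono (ℱ.le n) le_rfl

lemma measurable_scaledCov (hX : IsAMChain p κ P ℱ X μ Γ) (n : ℕ) :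
    Measurable[ℱ n] fun ω => scaledCov (Γ n ω) :=
  measurable_scaledCov_of_entry (hX.adapted_cov n)

/-- If the drift function has controlled averages, weighted by the peak of the proposal density,
then the covariance matrices stay in a compact set. -/
lemma exists_forall_mem_covSet (hd : 0 < d) (hκ : 0 < κ) (hX : IsAMChain p κ P ℱ X μ Γ) {ω : Ω}
    {U : State d → ℝ} (hU0 : ∀ x, 0 ≤ U x) {C₁ c C : ℝ} (hC₁ : 0 < C₁)
    (hU : ∀ x, ‖x‖ ^ (4 * d) ≤ C₁ * U x) (hc : 0 < c)
    (h : ∀ N : ℕ, 1 ≤ N → ∑ k ∈ Finset.Ico 1 N,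
      c * gaussPeak (Matrix.of (scaledCov (Γ k ω))) * U (X k ω) ≤ C * N) :
    ∃ M : ℕ, ∀ n, 1 ≤ n →
      scaledCov (Γ n ω) ∈ covSet d ((2.38 : ℝ) ^ 2 * (d : ℝ)⁻¹ * κ) M := by
  have hd' : (0 : ℝ) < d := by exact_mod_cast hd
  set r : ℝ := (2.38 : ℝ) ^ 2 * (d : ℝ)⁻¹ with hr
  have hr0 : 0 < r := by positivity
  have hk : 0 < r * κ := by positivity
  set A : ℕ → ℝ := fun n => (n : ℝ)⁻¹ * ∑ k ∈ Finset.Icc 1 n, ‖X k ω‖ ^ 2 with hA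
  have hentry : ∀ n, 1 ≤ n → ∀ M, (∀ j ≤ n, A j ≤ M) → ∀ i j,
      |scaledCov (Γ n ω) i j| ≤ r * (κ + 4 * M) := fun n hn M hM i j => by
    rw [scaledCov, abs_mul, abs_of_pos hr0]
    exact mul_le_mul_of_nonneg_left (hX.abs_cov_le hκ hn hM i j) hr0.le
  set D : ℝ := (2 * Real.pi) ^ d * (d.factorial * (r + 1) ^ d) with hD
  have hD0 : 0 < D := by positivity
  obtain ⟨B, hB⟩ := exists_bound_of_pow_le (A := A) (c₀ := κ + 1) (C := C₁ * (c⁻¹ * D) * (2 * |C|))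
      hd (by positivity) (by
    intro N M hM1 hM
    have hbase : 0 < κ + 1 + 4 * M := by linarith
    rcases Nat.eq_zero_or_pos N with rfl | hN
    · simp only [hA, Nat.cast_zero, inv_zero, zero_mul]
      rw [zero_pow (by omega)]
      positivity
    have hN' : (0 : ℝ) < N := by exact_mod_cast hN
    set M' : ℝ := (r + 1) * (κ + 1 + 4 * M) with hM'
    have hM'1 : 1 ≤ M' := one_le_mul_of_one_le_of_one_le (by linarith) (by linarith)
    have hMM' : r * (κ + 4 * M) ≤ M' := by
      rw [hM']
      exact mul_le_mul (by linarith) (by linarith) (by linarith) (by linarith)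
    -- If the empirical second moments up to time `N` are at most `M`, the covariance entries are of
    -- order `M` and removing the peak costs a factor of order `M ^ d`.
    have hUk : ∀ k ∈ Finset.Icc 1 N, ‖X k ω‖ ^ (4 * d) ≤ C₁ * (c⁻¹ * D) * (κ + 1 + 4 * M) ^ d *
        (c * gaussPeak (Matrix.of (scaledCov (Γ k ω))) * U (X k ω)) := by
      intro k hk'
      rw [Finset.mem_Icc] at hk'
      have hmem : scaledCov (Γ k ω) ∈ covSet d (r * κ) M' :=
        ⟨hX.uniformlyElliptic_scaledCov hd hk'.1 ω, fun i j =>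
          (hentry k hk'.1 M (fun j hj => hM j (hj.trans hk'.2)) i j).trans hMM'⟩
      have h1 := le_gaussPeak hk hM'1 hmem
      have h2 : (2 * Real.pi) ^ d * (d.factorial * M' ^ d) = D * (κ + 1 + 4 * M) ^ d := by
        rw [hM', mul_pow (r + 1), hD]; ring
      rw [h2] at h1
      have h3 : 1 ≤ D * (κ + 1 + 4 * M) ^ d * gaussPeak (Matrix.of (scaledCov (Γ k ω))) := by
        rwa [inv_le_iff_one_le_mul₀' (by positivity)] at h1
      refine (hU _).trans ?_
      calc C₁ * U (X k ω) = C₁ * U (X k ω) * 1 := (mul_one _).symm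
        _ ≤ C₁ * U (X k ω) *
            (D * (κ + 1 + 4 * M) ^ d * gaussPeak (Matrix.of (scaledCov (Γ k ω)))) :=
          mul_le_mul_of_nonneg_left h3 (mul_nonneg hC₁.le (hU0 _))
        _ = _ := by field_simp
    have hsum := h (N + 1) (by omega)
    have hsum' : ∑ k ∈ Finset.Icc 1 N,
        c * gaussPeak (Matrix.of (scaledCov (Γ k ω))) * U (X k ω) ≤ 2 * |C| * N := by
      have e : Finset.Ico 1 (N + 1) = Finset.Icc 1 N := by ext; simp
      rw [← e]
      refine hsum.trans ?_
      push_cast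
      have h1 : (1 : ℝ) ≤ N := by exact_mod_cast hN
      calc C * ((N : ℝ) + 1) ≤ |C| * (N + 1) := by gcongr; exact le_abs_self C
        _ ≤ |C| * (N + N) := by gcongr
        _ = _ := by ring
    -- Jensen with power `2 * d` raises the second moment to the exponent that beats the cost `M ^
    -- d`.
    have hJ := Real.pow_arith_mean_le_arith_mean_pow (Finset.Icc 1 N) (fun _ => (N : ℝ)⁻¹)
      (fun k => ‖X k ω‖ ^ 2) (fun _ _ => by positivity)
      (by simp [mul_inv_cancel₀ hN'.ne']) (fun _ _ => by positivity) (2 * d)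
    rw [← Finset.mul_sum, ← Finset.mul_sum] at hJ
    calc A N ^ (2 * d) ≤ (N : ℝ)⁻¹ * ∑ k ∈ Finset.Icc 1 N, (‖X k ω‖ ^ 2) ^ (2 * d) := hJ
      _ ≤ (N : ℝ)⁻¹ * ∑ k ∈ Finset.Icc 1 N, C₁ * (c⁻¹ * D) * (κ + 1 + 4 * M) ^ d *
        (c * gaussPeak (Matrix.of (scaledCov (Γ k ω))) * U (X k ω)) := by
          gcongr with k hk'
          rw [← pow_mul, show 2 * (2 * d) = 4 * d by ring]
          exact hUk k hk'
      _ ≤ (N : ℝ)⁻¹ * (C₁ * (c⁻¹ * D) * (κ + 1 + 4 * M) ^ d * (2 * |C| * N)) := by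
          rw [← Finset.mul_sum]
          gcongr
      _ = _ := by field_simp)
  refine ⟨⌈r * (κ + 4 * B)⌉₊, fun n hn => ⟨hX.uniformlyElliptic_scaledCov hd hn ω, fun i j => ?_⟩⟩
  exact (hentry n hn B (fun j _ => hB j) i j).trans (Nat.le_ceil _)

end IsAMChain

namespace IsAMChain

variable {d : ℕ} {Ω : Type*} {mΩ : MeasurableSpace Ω} {p : State d → ℝ} {κ : ℝ}
  {P : Measure Ω} [IsProbabilityMeasure P] {ℱ : Filtration ℕ mΩ} {X : ℕ → Ω → State d}
  {μ : ℕ → Ω → State d} {Γ : ℕ → Ω → Matrix (Fin d) (Fin d) ℝ}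

/-- A one-step bound on the drift function over an event of the past. -/
lemma setLIntegral_lyap_le (hX : IsAMChain p κ P ℱ X μ Γ) (hM : SuperExpRegularContours p) {t : ℝ}
    (ht : t ∈ Set.Ioo (0 : ℝ) 1) (n : ℕ) {A : Set Ω} (hA : MeasurableSet[ℱ n] A) {g : Ω → ℝ}
    (hg : ∀ ω ∈ A, ∫ y, lyap p t y ∂(metro p (Matrix.of (scaledCov (Γ n ω))) (X n ω)) ≤ g ω) :
    ∫⁻ ω in A, ENNReal.ofReal (lyap p t (X (n + 1) ω)) ∂P ≤ ∫⁻ ω in A, ENNReal.ofReal (g ω) ∂P :=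
  setLIntegral_comp_le_of_integral_le (ℱ.le n) (hX.measurable_state (n + 1)) (hX.markov n) hA
    (continuous_lyap hM.pos hM.continuous t).measurable (fun x => (lyap_pos hM.pos t x).le)
    fun ω hω => ⟨integrable_lyap_metro hM.pos hM.continuous _ ht _, hg ω hω⟩

/-- The moments of the drift function grow at most linearly. -/
lemma exists_lintegral_lyap_le (hd : 0 < d) (hκ : 0 < κ) (hX : IsAMChain p κ P ℱ X μ Γ)
    (hM : SuperExpRegularContours p) {t : ℝ} (ht : t ∈ Set.Ioo (0 : ℝ) 1)
    (h0 : ∫⁻ ω, ENNReal.ofReal (lyap p t (X 0 ω)) ∂P < ∞) :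
    ∃ C : ℝ, 0 ≤ C ∧ ∀ n : ℕ, ∫⁻ ω, ENNReal.ofReal (lyap p t (X n ω)) ∂P
      ≤ ENNReal.ofReal (C * ((n : ℝ) + 1)) := by
  have hd' : (0 : ℝ) < d := by exact_mod_cast hd
  have hk : 0 < (2.38 : ℝ) ^ 2 * (d : ℝ)⁻¹ * κ := by positivity
  obtain ⟨c, b, hc, hb, hdrift⟩ := hM.exists_drift hd ht hk
  set c₀ : ℝ := (∫⁻ ω, ENNReal.ofReal (lyap p t (X 0 ω)) ∂P).toReal with hc₀
  have hc₀0 : 0 ≤ c₀ := ENNReal.toReal_nonneg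
  have e0 : ∫⁻ ω, ENNReal.ofReal (lyap p t (X 0 ω)) ∂P = ENNReal.ofReal c₀ :=
    (ENNReal.ofReal_toReal h0.ne).symm
  refine ⟨2 * c₀ + b, by positivity, fun n => ?_⟩
  induction n with
  | zero =>
    rw [e0]
    refine ENNReal.ofReal_le_ofReal ?_
    simp only [Nat.cast_zero, zero_add, mul_one]
    linarith
  | succ n ih =>
    -- The first transition may use a singular `Γ 0`, so it relies on the factor `2` bound valid for
    -- every proposal. Later ones add at most `b`.
    rcases Nat.eq_zero_or_pos n with rfl | hn
    · have h := hX.setLIntegral_lyap_le hM ht 0 (A := Set.univ) MeasurableSet.univ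
        (g := fun ω => 2 * lyap p t (X 0 ω)) fun ω _ =>
          integral_lyap_metro_le hM.pos hM.continuous _ ht _
      simp only [Measure.restrict_univ] at h
      refine h.trans ?_
      have e : ∀ ω, ENNReal.ofReal (2 * lyap p t (X 0 ω))
          = ENNReal.ofReal 2 * ENNReal.ofReal (lyap p t (X 0 ω)) := fun ω =>
        ENNReal.ofReal_mul zero_le_two
      simp_rw [e]
      rw [lintegral_const_mul' _ _ ENNReal.ofReal_ne_top, e0, ← ENNReal.ofReal_mul zero_le_two]
      refine ENNReal.ofReal_le_ofReal ?_
      push_cast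
      linarith
    · have h := hX.setLIntegral_lyap_le hM ht n (A := Set.univ) MeasurableSet.univ
        (g := fun ω => lyap p t (X n ω) + b) fun ω _ => by
          have h1 := (hdrift _ (hX.uniformlyElliptic_scaledCov hd hn ω)).2 (X n ω)
          have h2 := gaussPeak_pos ((hX.uniformlyElliptic_scaledCov hd hn ω).det_pos hk)
          have h3 := lyap_pos hM.pos t (X n ω)
          have h4 : 0 ≤ c * gaussPeak (Matrix.of (scaledCov (Γ n ω))) * lyap p t (X n ω) := by
            positivity
          linarith
      simp only [Measure.restrict_univ] at h
      refine h.trans ?_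
      have e : ∀ ω, ENNReal.ofReal (lyap p t (X n ω) + b)
          = ENNReal.ofReal (lyap p t (X n ω)) + ENNReal.ofReal b := fun ω =>
        ENNReal.ofReal_add (lyap_pos hM.pos t _).le hb
      simp_rw [e]
      rw [lintegral_add_right _ measurable_const, lintegral_const, measure_univ, mul_one]
      refine (add_le_add_left ih _).trans ?_
      rw [← ENNReal.ofReal_add (by positivity) hb]
      refine ENNReal.ofReal_le_ofReal ?_
      push_cast
      linarith

/-- The proposal covariance matrices almost surely stay in a compact set of positive definite
matrices. -/
lemma ae_exists_forall_mem_covSet (hd : 0 < d) (hκ : 0 < κ) (hX : IsAMChain p κ P ℱ X μ Γ)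
    (hM : SuperExpRegularContours p) {s : ℝ} (hs : s ∈ Set.Ioo (0 : ℝ) 1)
    (h0 : ∫⁻ ω, ENNReal.ofReal (lyap p s (X 0 ω)) ∂P < ∞) :
    ∀ᵐ ω ∂P, ∃ M : ℕ, ∀ n, 1 ≤ n →
      scaledCov (Γ n ω) ∈ covSet d ((2.38 : ℝ) ^ 2 * (d : ℝ)⁻¹ * κ) M := by
  have hd' : (0 : ℝ) < d := by exact_mod_cast hd
  have hk : 0 < (2.38 : ℝ) ^ 2 * (d : ℝ)⁻¹ * κ := by positivity
  -- With `U ^ 4 = V`, the truncated square is at most `√V / N ^ 2`. The arithmetic–geometric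
  -- inequality bounds it by `N ^ (-3/2) + N ^ (-5/2) * V`, which is summable under linear growth of
  -- the moments.
  have ht : s / 4 ∈ Set.Ioo (0 : ℝ) 1 := ⟨by linarith [hs.1], by linarith [hs.2, hs.1]⟩
  obtain ⟨c, b, hc, hb, hdrift⟩ := hM.exists_drift hd ht hk
  obtain ⟨C, hC, hmom⟩ := hX.exists_lintegral_lyap_le hd hκ hM hs h0
  obtain ⟨C₁, hC₁, hpow⟩ := hM.exists_pow_norm_le_lyap ht.1 (4 * d)
  have hU0 : ∀ x, 0 ≤ lyap p (s / 4) x := fun x => (lyap_pos hM.pos _ x).le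
  have hsum := tsum_setLIntegral_sq_min_ne_top (P := P) (Y := fun n => X (n + 1))
    (A := fun _ => Set.univ) (U := lyap p (s / 4)) (V := lyap p s)
    (α := fun n => ((n : ℝ) + 1) ^ (-(3 / 2) : ℝ)) (β := fun n => ((n : ℝ) + 1) ^ (-(5 / 2) : ℝ))
    (v := fun n => C * ((n : ℝ) + 2))
    (fun n => by positivity) (fun n => by positivity) (fun n => by positivity)
    (fun x => (lyap_pos hM.pos _ x).le)
    (fun n => by
      rw [Measure.restrict_univ]
      refine (hmom (n + 1)).trans (ENNReal.ofReal_le_ofReal ?_)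
      push_cast
      linarith)
    (fun n x => by
      set N : ℝ := (n : ℝ) + 1 with hN
      have hN0 : 0 < N := by positivity
      have e : lyap p s x = lyap p (s / 4) x ^ 4 := by
        rw [lyap_pow hM.pos]
        congr 1
        push_cast
        ring
      set u := lyap p (s / 4) x
      have h1 : min u N / N ≤ u / N := by gcongr; exact min_le_left _ _
      have h2 : 0 ≤ min u N / N := div_nonneg (le_min (hU0 x) hN0.le) hN0.le
      refine (pow_le_pow_left₀ h2 h1 2).trans ?_
      rw [e]
      have e1 : N ^ (-(3 / 2) : ℝ) = (N ^ (-(3 / 4) : ℝ)) ^ 2 := by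
        rw [← Real.rpow_natCast, ← Real.rpow_mul hN0.le]; norm_num
      have e2 : N ^ (-(5 / 2) : ℝ) = (N ^ (-(5 / 4) : ℝ)) ^ 2 := by
        rw [← Real.rpow_natCast, ← Real.rpow_mul hN0.le]; norm_num
      have e3 : N ^ (-(3 / 4) : ℝ) * N ^ (-(5 / 4) : ℝ) = (N ^ 2)⁻¹ := by
        rw [← Real.rpow_add hN0, ← Real.rpow_natCast, ← Real.rpow_neg hN0.le]; norm_num
      rw [e1, e2, div_pow, div_eq_mul_inv, ← e3]
      have h3 : 0 ≤ u ^ 2 * (N ^ (-(3 / 4) : ℝ) * N ^ (-(5 / 4) : ℝ)) := by positivity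
      linarith [sq_nonneg (N ^ (-(3 / 4) : ℝ) - u ^ 2 * N ^ (-(5 / 4) : ℝ))])
    (by
      have h1 : Summable fun n : ℕ => ((n : ℝ) + 1) ^ (-(3 / 2) : ℝ) := by
        have := (summable_nat_add_iff 1).2 (Real.summable_nat_rpow (p := -(3 / 2)).2 (by norm_num))
        simpa using this
      refine Summable.of_nonneg_of_le (fun n => by positivity) (fun n => ?_)
        (h1.mul_left (1 + 2 * C))
      set N : ℝ := (n : ℝ) + 1 with hN
      have hN0 : 0 < N := by positivity
      have e : N ^ (-(5 / 2) : ℝ) * N = N ^ (-(3 / 2) : ℝ) := by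
        rw [← Real.rpow_add_one hN0.ne']; norm_num
      have h2 : (n : ℝ) + 2 ≤ 2 * N := by rw [hN]; linarith [Nat.cast_nonneg (α := ℝ) n]
      calc N ^ (-(3 / 2) : ℝ) + N ^ (-(5 / 2) : ℝ) * (C * (n + 2))
          ≤ N ^ (-(3 / 2) : ℝ) + N ^ (-(5 / 2) : ℝ) * (C * (2 * N)) := by gcongr
        _ = (1 + 2 * C) * N ^ (-(3 / 2) : ℝ) := by rw [← e]; ring)
  have hprob : ∀ n ω, IsProbabilityMeasure (metropolis p (Γ n ω) (X n ω)) := fun n ω =>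
    isProbabilityMeasure_metro hM.pos hM.continuous _ _
  have hA := ae_sum_le_mul_of_drift (P := P) (ℱ := ℱ) hX.adapted_state
    (K := fun n ω => metropolis p (Γ n ω) (X n ω)) hX.markov (A := fun _ => Set.univ)
    (fun n => MeasurableSet.univ) (continuous_lyap hM.pos hM.continuous (s / 4)).measurable hU0
    (δ := fun n ω => c * gaussPeak (Matrix.of (scaledCov (Γ n ω)))) hb
    (fun n hn ω _ => ⟨integrable_lyap_metro hM.pos hM.continuous _ ht _,
      (hdrift _ (hX.uniformlyElliptic_scaledCov hd hn ω)).2 (X n ω)⟩) hsum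
  filter_upwards [hA] with ω hω
  obtain ⟨C₂, hC₂⟩ := hω fun _ _ => Set.mem_univ _
  exact hX.exists_forall_mem_covSet hd hκ hU0 hC₁ hpow hc hC₂

end IsAMChain

lemma covSet_mono {d : ℕ} {k M M' : ℝ} (h : M ≤ M') : covSet d k M ⊆ covSet d k M' :=
  fun _ ha => ⟨ha.1, fun i j => (ha.2 i j).trans h⟩

/-! ### Bounded averages of the drift function on compact sets of covariances -/

namespace IsAMChain

variable {d : ℕ} {Ω : Type*} {mΩ : MeasurableSpace Ω} {p : State d → ℝ} {κ : ℝ}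
  {P : Measure Ω} [IsProbabilityMeasure P] {ℱ : Filtration ℕ mΩ} {X : ℕ → Ω → State d}
  {μ : ℕ → Ω → State d} {Γ : ℕ → Ω → Matrix (Fin d) (Fin d) ℝ}

/-- On the event that the covariance matrices stay in a given compact set, the drift function has
bounded time averages. -/
lemma ae_sum_lyap_le_of_mem_covSet (hd : 0 < d) (hκ : 0 < κ) (hX : IsAMChain p κ P ℱ X μ Γ)
    (hM : SuperExpRegularContours p) {s : ℝ} (hs : s ∈ Set.Ioo (0 : ℝ) 1)
    (h0 : ∫⁻ ω, ENNReal.ofReal (lyap p s (X 0 ω)) ∂P < ∞) {q : ℝ} (hq : q ∈ Set.Ioo (1 : ℝ) 2)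
    {M : ℝ} (hM0 : 0 < M) :
    ∀ᵐ ω ∂P, (∀ n, 1 ≤ n →
      scaledCov (Γ n ω) ∈ covSet d ((2.38 : ℝ) ^ 2 * (d : ℝ)⁻¹ * κ) M) →
      ∃ C : ℝ, ∀ N : ℕ, 1 ≤ N → ∑ k ∈ Finset.Ico 1 N, lyap p (s / q) (X k ω) ≤ C * N := by
  have hd' : (0 : ℝ) < d := by exact_mod_cast hd
  have hk : 0 < (2.38 : ℝ) ^ 2 * (d : ℝ)⁻¹ * κ := by positivity
  set k : ℝ := (2.38 : ℝ) ^ 2 * (d : ℝ)⁻¹ * κ with hkdef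
  have hq0 : 0 < q := by linarith [hq.1]
  have ht : s / q ∈ Set.Ioo (0 : ℝ) 1 :=
    ⟨div_pos hs.1 hq0, (div_lt_one hq0).2 (hs.2.trans hq.1)⟩
  obtain ⟨c, b, hc, hb, hdrift⟩ := hM.exists_drift hd hs hk
  obtain ⟨c₂, b₂, hc₂, hb₂, hdrift₂⟩ := hM.exists_drift hd ht hk
  obtain ⟨C, hC, hmom⟩ := hX.exists_lintegral_lyap_le hd hκ hM hs h0
  obtain ⟨c', hc', hpeak⟩ := SuperExpRegularContours.exists_gaussPeak_ge (d := d) hk hM0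
  have hV0 : ∀ t x, 0 ≤ lyap p t x := fun t x => (lyap_pos hM.pos t x).le
  -- Confinement up to time `n` only, so that the event belongs to the past; `A 0` is everything.
  set A : ℕ → Set Ω := fun n => ⋂ (j : ℕ) (_ : 1 ≤ j) (_ : j ≤ n),
    (fun ω => scaledCov (Γ j ω)) ⁻¹' covSet d k M with hA
  have hAmem : ∀ n ω, ω ∈ A n ↔ ∀ j, 1 ≤ j → j ≤ n → scaledCov (Γ j ω) ∈ covSet d k M :=
    fun n ω => by simp [hA]
  have hAm : ∀ n, MeasurableSet[ℱ n] (A n) := fun n =>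
    MeasurableSet.iInter fun j => MeasurableSet.iInter fun _ => MeasurableSet.iInter fun hj =>
      ((hX.measurable_scaledCov j).mono (ℱ.mono hj) le_rfl)
        (isCompact_covSet k M).isClosed.measurableSet
  have hAanti : ∀ n, A (n + 1) ⊆ A n := fun n ω hω =>
    (hAmem n ω).2 fun j h1 h2 => (hAmem (n + 1) ω).1 hω j h1 (by omega)
  set γ : ℝ := max (1 - c * c') 0 with hγ
  have hγ0 : 0 ≤ γ := le_max_right _ _
  have hγ1 : γ < 1 := max_lt (by have := mul_pos hc hc'; linarith) one_pos
  -- A level preserved by `x ↦ γ * x + b`; the `2 * C` covers the moment at time `1`.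
  set D : ℝ := 2 * C + b / (1 - γ) with hD
  have h1γ : 0 < 1 - γ := by linarith
  have hD0 : 0 ≤ D := by positivity
  have hDfix : γ * D + b ≤ D := by
    have h1 : (1 - γ) * (b / (1 - γ)) = b := by field_simp
    have h2 : 0 ≤ (1 - γ) * (2 * C) := by positivity
    have h3 : (1 - γ) * D = (1 - γ) * (2 * C) + b := by rw [hD, mul_add, h1]
    linarith
  have hw : ∀ n : ℕ, ∫⁻ ω in A n, ENNReal.ofReal (lyap p s (X (n + 1) ω)) ∂P
      ≤ ENNReal.ofReal D := by
    intro n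
    induction n with
    | zero =>
      refine (setLIntegral_le_lintegral _ _).trans ((hmom 1).trans
        (ENNReal.ofReal_le_ofReal ?_))
      have : 0 ≤ b / (1 - γ) := by positivity
      rw [hD]
      push_cast
      linarith
    | succ n ih =>
      have h := hX.setLIntegral_lyap_le hM hs (n + 1) (hAm (n + 1))
        (g := fun ω => γ * lyap p s (X (n + 1) ω) + b) fun ω hω => by
          have hmem := (hAmem _ _).1 hω (n + 1) (by omega) le_rfl
          have h1 := (hdrift _ hmem.1).2 (X (n + 1) ω)
          have h2 := hpeak _ hmem
          have h3 : c * c' * lyap p s (X (n + 1) ω) ≤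
              c * gaussPeak (Matrix.of (scaledCov (Γ (n + 1) ω))) * lyap p s (X (n + 1) ω) := by
            have := hV0 s (X (n + 1) ω)
            gcongr
          have h4 : (1 - c * c') * lyap p s (X (n + 1) ω) ≤ γ * lyap p s (X (n + 1) ω) :=
            mul_le_mul_of_nonneg_right (le_max_left _ _) (hV0 _ _)
          linarith
      refine h.trans ((lintegral_mono_set (hAanti n)).trans ?_)
      have e : ∀ ω, ENNReal.ofReal (γ * lyap p s (X (n + 1) ω) + b)
          = ENNReal.ofReal γ * ENNReal.ofReal (lyap p s (X (n + 1) ω)) + ENNReal.ofReal b :=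
        fun ω => by
          rw [ENNReal.ofReal_add (mul_nonneg hγ0 (hV0 _ _)) hb, ENNReal.ofReal_mul hγ0]
      simp_rw [e]
      rw [lintegral_add_right _ measurable_const, lintegral_const,
        lintegral_const_mul' _ _ ENNReal.ofReal_ne_top, Measure.restrict_apply_univ]
      refine (add_le_add (mul_le_mul_right ih _)
        ((mul_le_mul_right prob_le_one _).trans (mul_one _).le)).trans ?_
      rw [← ENNReal.ofReal_mul hγ0, ← ENNReal.ofReal_add (by positivity) hb]
      exact ENNReal.ofReal_le_ofReal hDfix
  have hsum := tsum_setLIntegral_sq_min_ne_top (P := P) (Y := fun n => X (n + 1))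
    (A := A) (U := lyap p (s / q)) (V := lyap p s)
    (α := fun _ => 0) (β := fun n => ((n : ℝ) + 1) ^ (-q)) (v := fun _ => D)
    (fun n => le_rfl) (fun n => by positivity) (fun n => hD0) (hV0 s) hw
    (fun n x => by
      set N : ℝ := (n : ℝ) + 1 with hN
      have hN0 : 0 < N := by positivity
      have e : lyap p s x = lyap p (s / q) x ^ q := by
        rw [lyap, lyap, ← Real.rpow_mul (hM.pos x).le]
        congr 1
        field_simp
      set u := lyap p (s / q) x with hu
      have hu0 : 0 ≤ u := hV0 _ x
      have h1 : min u N / N ≤ u / N := by gcongr; exact min_le_left _ _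
      have h2 : 0 ≤ min u N / N := div_nonneg (le_min hu0 hN0.le) hN0.le
      have h3 : min u N / N ≤ 1 := (div_le_one hN0).2 (min_le_right _ _)
      rw [e, zero_add, Real.rpow_neg hN0.le, ← div_eq_inv_mul, ← Real.div_rpow hu0 hN0.le,
        ← Real.rpow_natCast]
      -- The truncated ratio is at most `1`, so its square is at most its `q`-th power as `q < 2`.
      -- The condition `q > 1` makes `N ^ (-q)` summable.
      exact (Real.rpow_le_rpow_of_exponent_ge_of_imp h2 h3 (by exact_mod_cast hq.2.le)
        (fun _ h => absurd h (by push_cast; norm_num))).trans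
        (Real.rpow_le_rpow h2 h1 hq0.le))
    (by
      have h1 : Summable fun n : ℕ => ((n : ℝ) + 1) ^ (-q) := by
        have := (summable_nat_add_iff 1).2 (Real.summable_nat_rpow.2 (by linarith [hq.1] : -q < -1))
        simpa using this
      simpa using h1.mul_right D)
  have hprob : ∀ n ω, IsProbabilityMeasure (metropolis p (Γ n ω) (X n ω)) := fun n ω =>
    isProbabilityMeasure_metro hM.pos hM.continuous _ _
  have hav := ae_sum_le_mul_of_drift (P := P) (ℱ := ℱ) hX.adapted_state
    (K := fun n ω => metropolis p (Γ n ω) (X n ω)) hX.markov (A := A) hAm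
    (continuous_lyap hM.pos hM.continuous (s / q)).measurable (hV0 _)
    (δ := fun n ω => c₂ * gaussPeak (Matrix.of (scaledCov (Γ n ω)))) hb₂
    (fun n hn ω _ => ⟨integrable_lyap_metro hM.pos hM.continuous _ ht _,
      (hdrift₂ _ (hX.uniformlyElliptic_scaledCov hd hn ω)).2 (X n ω)⟩) hsum
  filter_upwards [hav] with ω hω hmem
  obtain ⟨C', hC'⟩ := hω fun n _ => (hAmem n ω).2 fun j hj _ => hmem j hj
  refine ⟨(c₂ * c')⁻¹ * C', fun N hN => ?_⟩
  have hcc : 0 < c₂ * c' := by positivity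
  rw [mul_assoc, ← div_eq_inv_mul, le_div_iff₀' hcc]
  refine le_trans ?_ (hC' N hN)
  rw [Finset.mul_sum]
  refine Finset.sum_le_sum fun j hj => mul_le_mul_of_nonneg_right ?_ (hV0 _ _)
  exact mul_le_mul_of_nonneg_left (hpeak _ (hmem j (Finset.mem_Ico.1 hj).1)) hc₂.le

end IsAMChain

lemma tendsto_of_forall_approx {u : ℕ → ℝ} {l : ℝ}
    (h : ∀ ε > 0, ∃ R : ℕ → ℝ, Tendsto R atTop (𝓝 0) ∧ ∀ᶠ n in atTop, |u n - l - R n| ≤ ε) :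
    Tendsto u atTop (𝓝 l) := by
  refine Metric.tendsto_atTop'.2 fun ε hε => ?_
  obtain ⟨R, hR, hu⟩ := h (ε / 2) (by positivity)
  have h1 : ∀ᶠ n in atTop, |R n| < ε / 2 := by
    have := (Metric.tendsto_nhds.1 hR) (ε / 2) (by positivity)
    simpa [Real.dist_eq] using this
  obtain ⟨N, hN⟩ := eventually_atTop.1 (h1.and hu)
  refine ⟨N, fun n hn => ?_⟩
  obtain ⟨h2, h3⟩ := hN n hn.le
  rw [Real.dist_eq]
  have h4 := abs_add_le (u n - l - R n) (R n)
  rw [sub_add_cancel] at h4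
  linarith

/-! ### The approximate Poisson equation and the bounded case -/

section Operators

variable {d : ℕ} {p : State d → ℝ}

lemma metroOp_eq_integral_of_bound (hp : ∀ x, 0 < p x) (hc : Continuous p)
    {S : Matrix (Fin d) (Fin d) ℝ} (hS : S.PosDef) {f : State d → ℝ} (hf : Measurable f) {B : ℝ}
    (hB : ∀ x, |f x| ≤ B) (x : State d) : metroOp p S f x = ∫ y, f y ∂(metro p S x) :=
  metroOp_eq_integral hp hc hS (integrable_accept_mul hp hc S x hf hB)

/-- The Metropolis kernel, as a function of the covariance matrix and of the state. -/
noncomputable def metroKernel (hp : ∀ x, 0 < p x) (hc : Continuous p) {k : ℝ} (hk : 0 < k) :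
    Kernel ({a : Fin d → Fin d → ℝ // UniformlyElliptic k (Matrix.of a)} × State d) (State d) where
  toFun q := metro p (Matrix.of q.1.1) q.2
  measurable' := by
    refine Measure.measurable_of_measurable_coe _ fun D hD => ?_
    have hind : Measurable (D.indicator fun _ => (1 : ℝ)) := measurable_const.indicator hD
    have h1 := measurable_metroOp_uncurry hp hc
      (F := fun q : (Fin d → Fin d → ℝ) × State d => D.indicator (fun _ => (1 : ℝ)) q.2)
      (hind.comp measurable_snd)
    have h2 : Measurable fun q : {a : Fin d → Fin d → ℝ // UniformlyElliptic k (Matrix.of a)}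
        × State d => ((q.1.1, q.2) : (Fin d → Fin d → ℝ) × State d) :=
      (measurable_subtype_coe.comp measurable_fst).prodMk measurable_snd
    have h3 : (fun q : {a : Fin d → Fin d → ℝ // UniformlyElliptic k (Matrix.of a)} × State d =>
        metro p (Matrix.of q.1.1) q.2 D) = fun q => ENNReal.ofReal
          (metroOp p (Matrix.of q.1.1) (D.indicator fun _ => (1 : ℝ)) q.2) := by
      funext q
      have := isProbabilityMeasure_metro hp hc (Matrix.of q.1.1) q.2
      rw [metroOp_eq_integral_of_bound hp hc (q.1.2.posDef hk) hind (B := 1)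
        (fun x => by by_cases h : x ∈ D <;> simp [h]), integral_indicator_const _ hD]
      simp
    rw [h3]
    exact (h1.comp h2).ennreal_ofReal

lemma isMarkovKernel_metroKernel (hp : ∀ x, 0 < p x) (hc : Continuous p) {k : ℝ} (hk : 0 < k) :
    IsMarkovKernel (metroKernel (d := d) hp hc hk) :=
  ⟨fun q => isProbabilityMeasure_metro hp hc (Matrix.of q.1.1) q.2⟩

lemma measurable_iterate_metroOp_uncurry (hp : ∀ x, 0 < p x) (hc : Continuous p)
    {f : State d → ℝ} (hf : Measurable f) (j : ℕ) :
    Measurable fun q : (Fin d → Fin d → ℝ) × State d => (metroOp p (Matrix.of q.1))^[j] f q.2 := by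
  induction j with
  | zero => exact hf.comp measurable_snd
  | succ j ih =>
    simp only [Function.iterate_succ']
    exact measurable_metroOp_uncurry hp hc
      (F := fun q : (Fin d → Fin d → ℝ) × State d => (metroOp p (Matrix.of q.1))^[j] f q.2) ih

lemma measurable_iterate_metroOp (hp : ∀ x, 0 < p x) (hc : Continuous p)
    (S : Matrix (Fin d) (Fin d) ℝ) {f : State d → ℝ} (hf : Measurable f) (j : ℕ) :
    Measurable ((metroOp p S)^[j] f) := by
  induction j with
  | zero => exact hf
  | succ j ih =>
    rw [Function.iterate_succ']
    exact measurable_metroOp hp hc S ih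

lemma abs_iterate_metroOp_le (hp : ∀ x, 0 < p x) (hc : Continuous p)
    {S : Matrix (Fin d) (Fin d) ℝ} (hS : S.PosDef) {f : State d → ℝ} (hf : Measurable f) {B : ℝ}
    (hB : ∀ x, |f x| ≤ B) (j : ℕ) (x : State d) : |(metroOp p S)^[j] f x| ≤ B := by
  induction j generalizing x with
  | zero => exact hB x
  | succ j ih =>
    rw [Function.iterate_succ']
    exact abs_metroOp_le hp hc hS (measurable_iterate_metroOp hp hc S hf j) ih x

/-- Write `P ^ (j+1) f - P' ^ (j+1) f` as `(P - P') P ^ j f` plus `P' (P ^ j f - P' ^ j f)`; each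
step adds one multiple of the `L¹` distance. -/
lemma abs_iterate_metroOp_sub_le (hp : ∀ x, 0 < p x) (hc : Continuous p)
    {S S' : Matrix (Fin d) (Fin d) ℝ} (hS : S.PosDef) (hS' : S'.PosDef) {f : State d → ℝ}
    (hf : Measurable f) {B : ℝ} (hB : ∀ x, |f x| ≤ B) (j : ℕ) (x : State d) :
    |(metroOp p S)^[j] f x - (metroOp p S')^[j] f x| ≤
      j * (2 * B * ∫ z, |gaussDens S z - gaussDens S' z|) := by
  induction j generalizing x with
  | zero => simp
  | succ j ih =>
    have m1 := measurable_iterate_metroOp hp hc S hf j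
    have m2 := measurable_iterate_metroOp hp hc S' hf j
    have b1 := abs_iterate_metroOp_le hp hc hS hf hB j
    have b2 := abs_iterate_metroOp_le hp hc hS' hf hB j
    rw [Function.iterate_succ', Function.iterate_succ', Function.comp_apply, Function.comp_apply]
    have h1 := abs_metroOp_sub_le hp hc hS hS' m1 b1 x
    have h2 := abs_metroOp_le hp hc hS'
      (f := fun y => (metroOp p S)^[j] f y - (metroOp p S')^[j] f y) (m1.sub m2) ih x
    rw [metroOp_sub hp hc hS' m1 m2 b1 b2] at h2
    have h3 := abs_sub_le (metroOp p S ((metroOp p S)^[j] f) x)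
      (metroOp p S' ((metroOp p S)^[j] f) x) (metroOp p S' ((metroOp p S')^[j] f) x)
    push_cast
    linarith

/-- The partial sum `∑_{j < N} P_S^j f` of the series solving the Poisson equation. -/
noncomputable def poissonSum (p : State d → ℝ) (S : Matrix (Fin d) (Fin d) ℝ) (f : State d → ℝ)
    (N : ℕ) (x : State d) : ℝ :=
  ∑ j ∈ Finset.range N, (metroOp p S)^[j] f x

lemma abs_poissonSum_le (hp : ∀ x, 0 < p x) (hc : Continuous p)
    {S : Matrix (Fin d) (Fin d) ℝ} (hS : S.PosDef) {f : State d → ℝ} (hf : Measurable f) {B : ℝ}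
    (hB : ∀ x, |f x| ≤ B) (N : ℕ) (x : State d) : |poissonSum p S f N x| ≤ N * B := by
  refine (Finset.abs_sum_le_sum_abs _ _).trans ?_
  refine (Finset.sum_le_sum fun j _ => abs_iterate_metroOp_le hp hc hS hf hB j x).trans ?_
  simp

lemma abs_poissonSum_sub_le (hp : ∀ x, 0 < p x) (hc : Continuous p)
    {S S' : Matrix (Fin d) (Fin d) ℝ} (hS : S.PosDef) (hS' : S'.PosDef) {f : State d → ℝ}
    (hf : Measurable f) {B : ℝ} (hB : ∀ x, |f x| ≤ B) (N : ℕ) (x : State d) :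
    |poissonSum p S f N x - poissonSum p S' f N x| ≤
      (∑ j ∈ Finset.range N, (j : ℝ)) * (2 * B * ∫ z, |gaussDens S z - gaussDens S' z|) := by
  rw [poissonSum, poissonSum, ← Finset.sum_sub_distrib, Finset.sum_mul]
  refine (Finset.abs_sum_le_sum_abs _ _).trans ?_
  exact Finset.sum_le_sum fun j _ => abs_iterate_metroOp_sub_le hp hc hS hS' hf hB j x

/-- The approximate Poisson equation. -/
lemma integral_poissonSum (hp : ∀ x, 0 < p x) (hc : Continuous p)
    {S : Matrix (Fin d) (Fin d) ℝ} (hS : S.PosDef) {f : State d → ℝ} (hf : Measurable f) {B : ℝ}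
    (hB : ∀ x, |f x| ≤ B) (N : ℕ) (x : State d) :
    ∫ y, poissonSum p S f N y ∂(metro p S x) =
      poissonSum p S f N x - f x + (metroOp p S)^[N] f x := by
  have := isProbabilityMeasure_metro hp hc S x
  have hm := measurable_iterate_metroOp hp hc S hf
  have hb := abs_iterate_metroOp_le hp hc hS hf hB
  simp only [poissonSum]
  rw [integral_finsetSum _ fun j _ => Integrable.of_bound (hm j).aestronglyMeasurable B
    (ae_of_all _ fun y => hb j y)]
  have e : ∀ j, ∫ y, (metroOp p S)^[j] f y ∂(metro p S x) = (metroOp p S)^[j + 1] f x := fun j => by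
    rw [Function.iterate_succ', Function.comp_apply,
      metroOp_eq_integral_of_bound hp hc hS (hm j) (hb j)]
  simp_rw [e]
  have h1 := Finset.sum_range_succ (fun j => (metroOp p S)^[j] f x) N
  rw [Finset.sum_range_succ'] at h1
  simp only [Function.iterate_zero, id_eq] at h1
  linarith

end Operators

namespace IsAMChain

variable {d : ℕ} {Ω : Type*} {mΩ : MeasurableSpace Ω} {p : State d → ℝ} {κ : ℝ}
  {P : Measure Ω} [IsProbabilityMeasure P] {ℱ : Filtration ℕ mΩ} {X : ℕ → Ω → State d}
  {μ : ℕ → Ω → State d} {Γ : ℕ → Ω → Matrix (Fin d) (Fin d) ℝ}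

/-- Law of large numbers for the innovations of a function of the chain and of the covariance. -/
lemma ae_tendsto_average_innovation (hd : 0 < d) (hκ : 0 < κ) (hX : IsAMChain p κ P ℱ X μ Γ)
    (hM : SuperExpRegularContours p) {F : (Fin d → Fin d → ℝ) × State d → ℝ} (hF : Measurable F)
    {B : ℝ} (hB : ∀ a, UniformlyElliptic ((2.38 : ℝ) ^ 2 * (d : ℝ)⁻¹ * κ) (Matrix.of a) →
      ∀ y, |F (a, y)| ≤ B) :
    ∀ᵐ ω ∂P, Tendsto (fun n : ℕ => (n : ℝ)⁻¹ * ∑ j ∈ Finset.range n,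
      (F (scaledCov (Γ (j + 1) ω), X (j + 2) ω) - ∫ y, F (scaledCov (Γ (j + 1) ω), y)
        ∂(metro p (Matrix.of (scaledCov (Γ (j + 1) ω))) (X (j + 1) ω)))) atTop (𝓝 0) := by
  have hd' : (0 : ℝ) < d := by exact_mod_cast hd
  have hk : 0 < (2.38 : ℝ) ^ 2 * (d : ℝ)⁻¹ * κ := by positivity
  set k : ℝ := (2.38 : ℝ) ^ 2 * (d : ℝ)⁻¹ * κ with hkdef
  have hell : ∀ n ω, UniformlyElliptic k (Matrix.of (scaledCov (Γ (n + 1) ω))) := fun n ω =>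
    hX.uniformlyElliptic_scaledCov hd (by omega) ω
  set β := {a : Fin d → Fin d → ℝ // UniformlyElliptic k (Matrix.of a)} × State d with hβ
  set T : ℕ → Ω → β := fun n ω => (⟨scaledCov (Γ (n + 1) ω), hell n ω⟩, X (n + 1) ω) with hT
  have hTm : ∀ n, Measurable[ℱ (n + 1)] (T n) := fun n =>
    ((hX.measurable_scaledCov (n + 1)).subtype_mk).prodMk (hX.adapted_state (n + 1))
  -- Time starts at `1`, since only from there on is the covariance elliptic and the kernel given by
  -- a density.
  set ℱ' : Filtration ℕ mΩ :=
    { seq := fun n => ℱ (n + 1)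
      mono' := fun i j h => ℱ.mono (Nat.succ_le_succ h)
      le' := fun n => ℱ.le (n + 1) } with hℱ'
  set F' : β × State d → ℝ := fun q => F (q.1.1.1, q.2) with hF'
  have hF'm : Measurable F' := hF.comp
    ((measurable_subtype_coe.comp (measurable_fst.comp measurable_fst)).prodMk measurable_snd)
  have hF'b : ∀ q, |F' q| ≤ B := fun q => hB _ q.1.1.2 _
  set Z : ℕ → Ω → ℝ := fun n ω => F' (T n ω, X (n + 2) ω) with hZ
  have hZm : ∀ n, StronglyMeasurable[ℱ' (n + 1)] (Z n) := fun n =>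
    (hF'm.comp (((hTm n).mono (ℱ.mono (by omega)) le_rfl).prodMk
      (hX.adapted_state (n + 2)))).stronglyMeasurable
  have hZ2 : ∀ n, MemLp (Z n) 2 P := fun n =>
    MemLp.of_bound ((hZm n).mono (ℱ'.le _)).aestronglyMeasurable B
      (ae_of_all _ fun ω => hF'b _)
  have hsum : Summable fun n : ℕ => (∫ ω, Z n ω ^ 2 ∂P) / ((n : ℝ) + 1) ^ 2 := by
    have h1 : Summable fun n : ℕ => B ^ 2 * (1 / ((n : ℝ) + 1) ^ 2) := by
      have := (summable_nat_add_iff 1).2 (Real.summable_one_div_nat_pow.2 one_lt_two)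
      refine Summable.mul_left _ ?_
      simpa using this
    refine Summable.of_nonneg_of_le (fun n => by positivity) (fun n => ?_) h1
    rw [mul_one_div]
    gcongr
    refine (integral_mono (hZ2 n).integrable_sq (integrable_const (B ^ 2)) fun ω => ?_).trans
      (by simp)
    exact sq_le_sq' (abs_le.1 (hF'b _)).1 (abs_le.1 (hF'b _)).2
  have hmk := isMarkovKernel_metroKernel (d := d) hM.pos hM.continuous hk
  have hcond : ∀ᵐ ω ∂P, ∀ n, (P[Z n | ℱ' n]) ω = ∫ y, F (scaledCov (Γ (n + 1) ω), y)
      ∂(metro p (Matrix.of (scaledCov (Γ (n + 1) ω))) (X (n + 1) ω)) :=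
    ae_all_iff.2 fun n => condExp_prodMk_ae_eq (ℱ.le (n + 1)) (hTm n) (hX.measurable_state (n + 2))
      (k := metroKernel hM.pos hM.continuous hk) (hX.markov (n + 1)) hF'm hF'b
  filter_upwards [ae_tendsto_average_sub_condExp hZm hZ2 hsum, hcond] with ω h1 h2
  simp only [h2] at h1
  exact h1

end IsAMChain

/-- Pathwise form of the law of large numbers for bounded functions. -/
lemma tendsto_average_of_innovation {d : ℕ} {p : State d → ℝ} (hM : SuperExpRegularContours p)
    (hp : IsProbDensity p) (hd : 0 < d) {k M t : ℝ} (hk : 0 < k) (hM0 : 0 < M)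
    (ht : t ∈ Set.Ioo (0 : ℝ) 1) {f : State d → ℝ} (hf : Measurable f) {B : ℝ}
    (hB : ∀ x, |f x| ≤ B) {S : ℕ → Fin d → Fin d → ℝ} {x : ℕ → State d}
    (hS : ∀ n, S n ∈ covSet d k M) {C : ℝ}
    (hU : ∀ n : ℕ, 1 ≤ n → ∑ j ∈ Finset.range n, lyap p t (x j) ≤ C * n)
    (hdist : Tendsto (fun n => dist (S (n + 1)) (S n)) atTop (𝓝 0))
    (hinn : ∀ N, Tendsto (fun n : ℕ => (n : ℝ)⁻¹ * ∑ j ∈ Finset.range n,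
      (poissonSum p (Matrix.of (S j)) f N (x (j + 1)) -
        ∫ y, poissonSum p (Matrix.of (S j)) f N y ∂(metro p (Matrix.of (S j)) (x j))))
      atTop (𝓝 0)) :
    Tendsto (fun n : ℕ => (n : ℝ)⁻¹ * ∑ j ∈ Finset.range n, f (x j)) atTop
      (𝓝 (∫ y, f y ∂(target p))) := by
  have hpos := hM.pos
  have hcont := hM.continuous
  have hpd : ∀ n, (Matrix.of (S n)).PosDef := fun n => (hS n).1.posDef hk
  obtain ⟨Ce, q, hCe, hq0, hq1, herg⟩ := hM.exists_uniform_ergodicity hp hd hk hM0 ht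
  have hB0 : 0 ≤ B := (abs_nonneg _).trans (hB 0)
  set π : ℝ := ∫ y, f y ∂(target p) with hπ
  refine tendsto_of_forall_approx fun ε hε => ?_
  set K : ℝ := |B * Ce * (1 + C)| with hK
  -- `K` bounds the averaged ergodicity error apart from `q ^ N`. The length `N` is fixed before `n
  -- → ∞`, so a finite partial sum of the Poisson series suffices.
  obtain ⟨N, hN⟩ := exists_pow_lt_of_lt_one (show 0 < ε / (K + 1) by positivity) hq1
  set D : ℕ → ℝ := fun j => poissonSum p (Matrix.of (S j)) f N (x (j + 1)) -
        ∫ y, poissonSum p (Matrix.of (S j)) f N y ∂(metro p (Matrix.of (S j)) (x j)) with hD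
  set H : ℕ → ℝ := fun j => poissonSum p (Matrix.of (S j)) f N (x j) with hH
  set g : ℕ → ℝ := fun j => poissonSum p (Matrix.of (S (j + 1))) f N (x (j + 1)) -
    poissonSum p (Matrix.of (S j)) f N (x (j + 1)) with hg
  set Q : ℕ → ℝ := fun j => (metroOp p (Matrix.of (S j)))^[N] f (x j) with hQ
  -- `D` is the innovation, `H` telescopes, `g` is the effect of adaptation and `Q` is the remainder
  -- of the Poisson equation.
  have hdec : ∀ n, ∑ j ∈ Finset.range n, f (x j) = ∑ j ∈ Finset.range n, D j + (H 0 - H n)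
      + ∑ j ∈ Finset.range n, g j + ∑ j ∈ Finset.range n, Q j := fun n => by
    rw [← Finset.sum_range_sub' H n, ← Finset.sum_add_distrib, ← Finset.sum_add_distrib,
      ← Finset.sum_add_distrib]
    refine Finset.sum_congr rfl fun j _ => ?_
    simp only [hD, hH, hg, hQ]
    rw [integral_poissonSum hpos hcont (hpd j) hf hB]
    ring
  have hI : Tendsto (fun j => ∫ z, |gaussDens (Matrix.of (S (j + 1))) z -
      gaussDens (Matrix.of (S j)) z|) atTop (𝓝 0) := by
    refine Metric.tendsto_nhds.2 fun η hη => ?_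
    obtain ⟨δ, hδ, h1⟩ := exists_integral_abs_sub_lt hd hk hM0 hη
    filter_upwards [Metric.tendsto_nhds.1 hdist δ hδ] with j hj
    rw [Real.dist_eq, sub_zero, abs_of_nonneg dist_nonneg] at hj
    rw [Real.dist_eq, sub_zero, abs_of_nonneg (integral_nonneg fun z => abs_nonneg _)]
    exact h1 _ (hS _) _ (hS _) hj
  have hg0 : Tendsto g atTop (𝓝 0) := by
    refine squeeze_zero_norm (fun j => ?_)
      (by simpa using (hI.const_mul (2 * B)).const_mul (∑ j ∈ Finset.range N, (j : ℝ)))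
    rw [Real.norm_eq_abs]
    exact abs_poissonSum_sub_le hpos hcont (hpd _) (hpd _) hf hB N _
  have hHb : ∀ j, |H j| ≤ N * B := fun j => abs_poissonSum_le hpos hcont (hpd j) hf hB N _
  have hH0 : Tendsto (fun n : ℕ => (n : ℝ)⁻¹ * (H 0 - H n)) atTop (𝓝 0) := by
    refine squeeze_zero_norm (fun n => ?_)
      (by simpa using (tendsto_inv_atTop_nhds_zero_nat (𝕜 := ℝ)).mul_const (N * B + N * B))
    rw [norm_mul, Real.norm_eq_abs, Real.norm_eq_abs, abs_of_nonneg (by positivity : (0 : ℝ) ≤ (n : ℝ)⁻¹)]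
    gcongr
    exact (abs_sub _ _).trans (add_le_add (hHb 0) (hHb n))
  refine ⟨fun n => (n : ℝ)⁻¹ * ∑ j ∈ Finset.range n, D j + (n : ℝ)⁻¹ * (H 0 - H n)
    + (n : ℝ)⁻¹ * ∑ j ∈ Finset.range n, g j, ?_, ?_⟩
  · have h := ((hinn N).add hH0).add hg0.cesaro
    rw [add_zero, add_zero] at h
    exact h
  · filter_upwards [eventually_ge_atTop 1] with n hn
    have hn' : (0 : ℝ) < n := by exact_mod_cast hn
    have e : (n : ℝ)⁻¹ * ∑ j ∈ Finset.range n, f (x j) - π -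
        ((n : ℝ)⁻¹ * ∑ j ∈ Finset.range n, D j + (n : ℝ)⁻¹ * (H 0 - H n)
          + (n : ℝ)⁻¹ * ∑ j ∈ Finset.range n, g j) =
        (n : ℝ)⁻¹ * ∑ j ∈ Finset.range n, (Q j - π) := by
      have e0 : ∑ j ∈ Finset.range n, (Q j - π) = ∑ j ∈ Finset.range n, Q j - n * π := by
        rw [Finset.sum_sub_distrib]
        simp
      rw [hdec, e0]
      field_simp
      ring
    rw [e, abs_mul, abs_of_nonneg (by positivity : (0 : ℝ) ≤ (n : ℝ)⁻¹)]
    have h1 : |∑ j ∈ Finset.range n, (Q j - π)| ≤ B * Ce * q ^ N * ((1 + C) * n) := by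
      refine (Finset.abs_sum_le_sum_abs _ _).trans ?_
      refine (Finset.sum_le_sum fun j _ => herg _ (hS j) f B hf hB N (x j)).trans ?_
      rw [← Finset.mul_sum, Finset.sum_add_distrib]
      refine mul_le_mul_of_nonneg_left ?_ (by positivity)
      have := hU n hn
      simp only [Finset.sum_const, Finset.card_range, nsmul_eq_mul, mul_one]
      linarith
    rw [← div_eq_inv_mul, div_le_iff₀ hn']
    refine h1.trans ?_
    have h2 : q ^ N * (K + 1) < ε := (lt_div_iff₀ (by positivity)).1 hN
    calc B * Ce * q ^ N * ((1 + C) * n) = (B * Ce * (1 + C)) * (q ^ N * n) := by ring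
      _ ≤ (K + 1) * (q ^ N * n) := by
          refine mul_le_mul_of_nonneg_right ?_ (by positivity)
          exact (le_abs_self _).trans (by linarith)
      _ = q ^ N * (K + 1) * n := by ring
      _ ≤ ε * n := by gcongr

namespace IsAMChain

variable {d : ℕ} {Ω : Type*} {mΩ : MeasurableSpace Ω} {p : State d → ℝ} {κ : ℝ}
  {P : Measure Ω} {ℱ : Filtration ℕ mΩ} {X : ℕ → Ω → State d} {μ : ℕ → Ω → State d}
  {Γ : ℕ → Ω → Matrix (Fin d) (Fin d) ℝ}

/-- The adaptation diminishes along paths with bounded averages of the drift function. -/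
lemma tendsto_dist_scaledCov (hd : 0 < d) (hκ : 0 < κ) (hX : IsAMChain p κ P ℱ X μ Γ) {ω : Ω}
    {k M : ℝ} (hS : ∀ n, 1 ≤ n → scaledCov (Γ n ω) ∈ covSet d k M) (hM0 : 0 ≤ M)
    {U : State d → ℝ} (hU0 : ∀ x, 0 ≤ U x) {C₁ C : ℝ} (hC₁ : 0 < C₁)
    (hU : ∀ x, ‖x‖ ^ 4 ≤ C₁ * U x)
    (hsum : ∀ N : ℕ, 1 ≤ N → ∑ k ∈ Finset.Ico 1 N, U (X k ω) ≤ C * N) :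
    Tendsto (fun n => dist (scaledCov (Γ (n + 1 + 1) ω)) (scaledCov (Γ (n + 1) ω)))
      atTop (𝓝 0) := by
  have hd' : (0 : ℝ) < d := by exact_mod_cast hd
  set r : ℝ := (2.38 : ℝ) ^ 2 * (d : ℝ)⁻¹ with hr
  have hr0 : 0 < r := by positivity
  have hC0 : 0 ≤ C := by simpa using hsum 1 le_rfl
  set B₁ : ℝ := 1 + 2 * C₁ * C with hB₁
  set K : ℝ := √(2 * C₁ * C) with hK
  have hbound : ∀ n : ℕ, dist (scaledCov (Γ (n + 1 + 1) ω)) (scaledCov (Γ (n + 1) ω)) ≤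
      2 * r * K * (√((n : ℝ) + 2))⁻¹ + (r * (2 * B₁ + κ) + M) * ((n : ℝ) + 2)⁻¹ := by
    intro n
    set m : ℕ := n + 1 with hm
    have hm1 : 1 ≤ m := by omega
    have hm' : (1 : ℝ) ≤ m := by exact_mod_cast hm1
    have hmn : (n : ℝ) + 2 = (m : ℝ) + 1 := by rw [hm]; push_cast; ring
    rw [hmn]
    set N : ℝ := (m : ℝ) + 1 with hN
    have hN0 : 0 < N := by positivity
    set v : State d := X (m + 1) ω - μ m ω with hv
    have hmean : ‖μ m ω‖ ^ 2 ≤ B₁ := by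
      refine (hX.norm_sq_mean_le m ω).trans ?_
      rw [inv_mul_le_iff₀ (by linarith)]
      have h1 : ∀ x : State d, ‖x‖ ^ 2 ≤ 1 + C₁ * U x := fun x => by
        have h2 := hU x
        have h3 : ‖x‖ ^ 4 = (‖x‖ ^ 2) ^ 2 := by ring
        rw [h3] at h2
        linarith [sq_nonneg (‖x‖ ^ 2 - 1), sq_nonneg (‖x‖ ^ 2)]
      refine (Finset.sum_le_sum fun j _ => h1 (X j ω)).trans ?_
      rw [Finset.sum_add_distrib, ← Finset.mul_sum]
      have h4 := hsum (m + 1) (by omega)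
      have e : Finset.Ico 1 (m + 1) = Finset.Icc 1 m := by ext; simp
      rw [e] at h4
      push_cast at h4
      have h5 : C₁ * ∑ j ∈ Finset.Icc 1 m, U (X j ω) ≤ C₁ * (C * (m + m)) := by
        refine mul_le_mul_of_nonneg_left (h4.trans ?_) hC₁.le
        gcongr
      simp only [Finset.sum_const, Nat.card_Icc, Nat.add_sub_cancel, nsmul_eq_mul, mul_one]
      rw [hB₁]
      linarith
    -- A single term of the sum is at most the whole sum, which is linear in time. Fourth-power
    -- control then gives growth like `√N`, negligible against the step size `N⁻¹`.
    have hnext : ‖X (m + 1) ω‖ ^ 2 ≤ K * √N := by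
      rw [hK, ← Real.sqrt_mul (by positivity)]
      refine Real.le_sqrt_of_sq_le ?_
      have h4 := hsum (m + 1 + 1) (by omega)
      have h5 : U (X (m + 1) ω) ≤ C * ((m + 1 + 1 : ℕ) : ℝ) :=
        (Finset.single_le_sum (f := fun j => U (X j ω)) (fun j _ => hU0 _)
          (Finset.mem_Ico.2 ⟨by omega, by omega⟩)).trans h4
      have h6 : ((m + 1 + 1 : ℕ) : ℝ) ≤ 2 * N := by rw [hN]; push_cast; linarith
      calc (‖X (m + 1) ω‖ ^ 2) ^ 2 = ‖X (m + 1) ω‖ ^ 4 := by ring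
        _ ≤ C₁ * U (X (m + 1) ω) := hU _
        _ ≤ C₁ * (C * (2 * N)) := by gcongr; exact h5.trans (by gcongr)
        _ = 2 * C₁ * C * N := by ring
    have hvb : ‖v‖ ^ 2 ≤ 2 * (K * √N) + 2 * B₁ := by
      have h := pow_le_pow_left₀ (norm_nonneg _) (norm_sub_le (X (m + 1) ω) (μ m ω)) 2
      rw [hv]
      nlinarith [sq_nonneg (‖X (m + 1) ω‖ - ‖μ m ω‖)]
    have hKs : 2 * r * K * (√N)⁻¹ = r * (2 * (K * √N)) * N⁻¹ := by
      have h1 : √N * √N = N := Real.mul_self_sqrt hN0.le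
      have h2 : √N ≠ 0 := (Real.sqrt_pos.2 hN0).ne'
      have h3 : N⁻¹ = (√N)⁻¹ * (√N)⁻¹ := by rw [← mul_inv, h1]
      rw [h3]
      field_simp
    have hK0 : 0 ≤ K := Real.sqrt_nonneg _
    have hB0 : 0 ≤ B₁ := by positivity
    refine (dist_pi_le_iff (by positivity)).2 fun i => (dist_pi_le_iff (by positivity)).2 fun j => ?_
    have e : scaledCov (Γ (m + 1) ω) i j - scaledCov (Γ m ω) i j =
        (r * (Matrix.vecMulVec v.ofLp v.ofLp i j + κ * (1 : Matrix (Fin d) (Fin d) ℝ) i j)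
          - scaledCov (Γ m ω) i j) * N⁻¹ := by
      simp only [scaledCov]
      rw [hX.cov_succ]
      simp only [Matrix.add_apply, Matrix.smul_apply, smul_eq_mul, ← hN, ← hr, ← hv]
      have : (m : ℝ) = N - 1 := by rw [hN]; ring
      rw [this]
      field_simp
      ring
    have h2 : |κ * (1 : Matrix (Fin d) (Fin d) ℝ) i j| ≤ κ := by
      rw [abs_mul, abs_of_pos hκ]
      refine mul_le_of_le_one_right hκ.le ?_
      rw [Matrix.one_apply]
      split_ifs <;> simp
    rw [Real.dist_eq, e, abs_mul, abs_of_pos (inv_pos.2 hN0), hKs, ← add_mul]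
    refine mul_le_mul_of_nonneg_right ?_ (by positivity)
    refine (abs_sub _ _).trans ?_
    rw [abs_mul, abs_of_pos hr0]
    have h5 : |Matrix.vecMulVec v.ofLp v.ofLp i j + κ * (1 : Matrix (Fin d) (Fin d) ℝ) i j|
        ≤ 2 * (K * √N) + 2 * B₁ + κ :=
      (abs_add_le _ _).trans (add_le_add ((abs_vecMulVec_self_le v i j).trans hvb) h2)
    have h6 := mul_le_mul_of_nonneg_left h5 hr0.le
    have h7 := (hS m hm1).2 i j
    linarith
  have hlim1 : Tendsto (fun n : ℕ => (n : ℝ) + 2) atTop atTop :=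
    tendsto_atTop_add_const_right _ _ tendsto_natCast_atTop_atTop
  refine squeeze_zero (fun n => dist_nonneg) hbound ?_
  have h1 := (tendsto_inv_atTop_zero.comp (Real.tendsto_sqrt_atTop.comp hlim1)).const_mul
    (2 * r * K)
  have h2 := (tendsto_inv_atTop_zero.comp hlim1).const_mul (r * (2 * B₁ + κ) + M)
  simpa using h1.add h2

end IsAMChain

/-! ### Truncation and conclusion -/

lemma exists_mul_rpow_le {θ : ℝ} (hθ : θ ∈ Set.Ioo (0 : ℝ) 1) {C η : ℝ} (hC : 0 ≤ C) (hη : 0 < η) :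
    ∃ K : ℝ, 0 ≤ K ∧ ∀ u : ℝ, 0 < u → C * u ^ θ ≤ η * u + K := by
  have h1 := tendsto_rpow_neg_atTop (y := 1 - θ) (by linarith [hθ.2])
  obtain ⟨L, hL⟩ := eventually_atTop.1
    (h1.eventually_le_const (show (0 : ℝ) < η / (C + 1) by positivity))
  refine ⟨C * |L| ^ θ, by positivity, fun u hu => ?_⟩
  rcases le_total L u with h | h
  · have h2 := hL u h
    have e : u ^ θ = u ^ (-(1 - θ)) * u := by
      rw [← Real.rpow_add_one hu.ne']; congr 1; ring
    have h3 : C * u ^ (-(1 - θ)) ≤ η := by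
      calc C * u ^ (-(1 - θ)) ≤ (C + 1) * (η / (C + 1)) :=
            mul_le_mul (by linarith) h2 (by positivity) (by positivity)
        _ = η := by field_simp
    have h4 : 0 ≤ C * |L| ^ θ := by positivity
    calc C * u ^ θ = C * u ^ (-(1 - θ)) * u := by rw [e]; ring
      _ ≤ η * u := mul_le_mul_of_nonneg_right h3 hu.le
      _ ≤ _ := by linarith
  · have h2 : u ^ θ ≤ |L| ^ θ := Real.rpow_le_rpow hu.le (h.trans (le_abs_self L)) hθ.1.le
    have h3 := mul_le_mul_of_nonneg_left h2 hC
    have h4 : 0 ≤ η * u := by positivity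
    linarith

lemma abs_clamp_le {K : ℝ} (hK : 0 ≤ K) (y : ℝ) : |max (-K) (min K y)| ≤ K :=
  abs_le.2 ⟨le_max_left _ _, max_le (by linarith) (min_le_left _ _)⟩

lemma abs_sub_clamp_le {K u y : ℝ} (hu : 0 ≤ u) (h : |y| ≤ u + K) :
    |y - max (-K) (min K y)| ≤ u := by
  obtain ⟨h1, h2⟩ := abs_le.1 h
  rcases max_cases (-K) (min K y) with ⟨e1, _⟩ | ⟨e1, _⟩ <;>
    rcases min_cases K y with ⟨e2, _⟩ | ⟨e2, _⟩ <;>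
    refine abs_le.2 ⟨?_, ?_⟩ <;> linarith

/-- Approximation of an unbounded function by bounded ones in the law of large numbers. -/
lemma tendsto_average_of_approx {E : Type*} [MeasurableSpace E] {ν : Measure E} {f U : E → ℝ}
    (hf : Integrable f ν) (hU : Integrable U ν) {g : ℕ → E → ℝ} (hg : ∀ m, Integrable (g m) ν)
    (hfg : ∀ m x, |f x - g m x| ≤ 1 / ((m : ℝ) + 1) * U x) {x : ℕ → E} {C : ℝ}
    (hC : ∀ n : ℕ, 1 ≤ n → ∑ j ∈ Finset.range n, U (x j) ≤ C * n)
    (hlim : ∀ m, Tendsto (fun n : ℕ => (n : ℝ)⁻¹ * ∑ j ∈ Finset.range n, g m (x j)) atTop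
      (𝓝 (∫ y, g m y ∂ν))) :
    Tendsto (fun n : ℕ => (n : ℝ)⁻¹ * ∑ j ∈ Finset.range n, f (x j)) atTop
      (𝓝 (∫ y, f y ∂ν)) := by
  refine tendsto_of_forall_approx fun ε hε => ?_
  set u : ℝ := ∫ y, U y ∂ν with hu
  obtain ⟨m, hm⟩ := exists_nat_gt ((C + u) / ε)
  have hm0 : (0 : ℝ) < (m : ℝ) + 1 := by positivity
  refine ⟨fun n => (n : ℝ)⁻¹ * ∑ j ∈ Finset.range n, g m (x j) - ∫ y, g m y ∂ν, ?_, ?_⟩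
  · simpa using (hlim m).sub_const (∫ y, g m y ∂ν)
  · filter_upwards [eventually_ge_atTop 1] with n hn
    have hn' : (0 : ℝ) < n := by exact_mod_cast hn
    have h1 : |∑ j ∈ Finset.range n, (f (x j) - g m (x j))| ≤ 1 / ((m : ℝ) + 1) * (C * n) := by
      refine (Finset.abs_sum_le_sum_abs _ _).trans
        ((Finset.sum_le_sum fun j _ => hfg m (x j)).trans ?_)
      rw [← Finset.mul_sum]
      exact mul_le_mul_of_nonneg_left (hC n hn) (by positivity)
    have h2 : |∫ y, (f y - g m y) ∂ν| ≤ 1 / ((m : ℝ) + 1) * u := by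
      rw [← Real.norm_eq_abs, hu, ← integral_const_mul]
      exact norm_integral_le_of_norm_le (hU.const_mul _) (ae_of_all _ fun y => hfg m y)
    have e : (n : ℝ)⁻¹ * ∑ j ∈ Finset.range n, f (x j) - ∫ y, f y ∂ν -
        ((n : ℝ)⁻¹ * ∑ j ∈ Finset.range n, g m (x j) - ∫ y, g m y ∂ν) =
        (n : ℝ)⁻¹ * ∑ j ∈ Finset.range n, (f (x j) - g m (x j)) - ∫ y, (f y - g m y) ∂ν := by
      rw [integral_sub hf (hg m), Finset.sum_sub_distrib]
      ring
    rw [e]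
    refine (abs_sub _ _).trans ?_
    have h3 : |(n : ℝ)⁻¹ * ∑ j ∈ Finset.range n, (f (x j) - g m (x j))|
        ≤ 1 / ((m : ℝ) + 1) * C := by
      rw [abs_mul, abs_of_pos (inv_pos.2 hn'), inv_mul_le_iff₀ hn']
      linarith
    have h4 : C + u ≤ ε * ((m : ℝ) + 1) := by
      rw [div_lt_iff₀ hε] at hm
      linarith
    calc _ ≤ 1 / ((m : ℝ) + 1) * C + 1 / ((m : ℝ) + 1) * u := add_le_add h3 h2
      _ = (C + u) / ((m : ℝ) + 1) := by ring
      _ ≤ ε := (div_le_iff₀ hm0).2 h4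

namespace IsAMChain

variable {d : ℕ} {Ω : Type*} {mΩ : MeasurableSpace Ω} {p : State d → ℝ} {κ : ℝ}
  {P : Measure Ω} [IsProbabilityMeasure P] {ℱ : Filtration ℕ mΩ} {X : ℕ → Ω → State d}
  {μ : ℕ → Ω → State d} {Γ : ℕ → Ω → Matrix (Fin d) (Fin d) ℝ}

/-- Strong law of large numbers for the adaptive Metropolis chain. -/
theorem ae_tendsto_average (hd : 0 < d) (hκ : 0 < κ) (hX : IsAMChain p κ P ℱ X μ Γ)
    (hM : SuperExpRegularContours p) (hp : IsProbDensity p) {s : ℝ} (hs : s ∈ Set.Ioo (0 : ℝ) 1)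
    (h0 : ∫⁻ ω, ENNReal.ofReal (lyap p s (X 0 ω)) ∂P < ∞) {a : ℝ} (ha : a ∈ Set.Ioo (0 : ℝ) 1)
    {f : State d → ℝ} (hf : Measurable f) (hfi : Integrable f (target p)) {C₀ : ℝ} (hC₀ : 0 ≤ C₀)
    (hfb : ∀ x, |f x| ≤ C₀ * lyap p (s * a) x) :
    ∀ᵐ ω ∂P, Tendsto (fun n : ℕ => (n : ℝ)⁻¹ * ∑ k ∈ Finset.Icc 1 n, f (X k ω)) atTop
      (𝓝 (∫ x, f x ∂(target p))) := by
  have hd' : (0 : ℝ) < d := by exact_mod_cast hd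
  have hk : 0 < (2.38 : ℝ) ^ 2 * (d : ℝ)⁻¹ * κ := by positivity
  have hpos := hM.pos
  have hcont := hM.continuous
  have hprob := isProbabilityMeasure_target hp
  -- `q < 2` is needed for the bounded averages, and `q < a⁻¹` makes the bound on `f` a power `a * q
  -- < 1` of `lyap p (s / q)`.
  obtain ⟨q, hq1, hq2⟩ := exists_between (lt_min one_lt_two ((one_lt_inv₀ ha.1).2 ha.2))
  have hq : q ∈ Set.Ioo (1 : ℝ) 2 := ⟨hq1, hq2.trans_le (min_le_left _ _)⟩
  have hq0 : 0 < q := one_pos.trans hq1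
  have hθ : a * q ∈ Set.Ioo (0 : ℝ) 1 := by
    refine ⟨mul_pos ha.1 hq0, ?_⟩
    have h1 := hq2.trans_le (min_le_right _ _)
    rwa [lt_inv_comm₀ hq0 ha.1, ← one_div, lt_div_iff₀ hq0] at h1
  have ht : s / q ∈ Set.Ioo (0 : ℝ) 1 :=
    ⟨div_pos hs.1 hq0, (div_lt_one hq0).2 (hs.2.trans hq1)⟩
  have hU0 : ∀ x, 0 < lyap p (s / q) x := lyap_pos hpos _
  have hUθ : ∀ x, lyap p (s * a) x = lyap p (s / q) x ^ (a * q) := fun x => by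
    rw [lyap, lyap, ← Real.rpow_mul (hpos x).le]
    congr 1
    field_simp
  choose K hK0 hK using fun m : ℕ =>
    exists_mul_rpow_le hθ hC₀ (show (0 : ℝ) < 1 / ((m : ℝ) + 1) by positivity)
  set g : ℕ → State d → ℝ := fun m x => max (-K m) (min (K m) (f x)) with hg
  have hgm : ∀ m, Measurable (g m) := fun m => measurable_const.max (measurable_const.min hf)
  have hgb : ∀ m x, |g m x| ≤ K m := fun m x => abs_clamp_le (hK0 m) _
  have hgi : ∀ m, Integrable (g m) (target p) := fun m =>
    Integrable.of_bound (hgm m).aestronglyMeasurable (K m) (ae_of_all _ (hgb m))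
  have hfg : ∀ m x, |f x - g m x| ≤ 1 / ((m : ℝ) + 1) * lyap p (s / q) x := fun m x => by
    refine abs_sub_clamp_le (mul_nonneg (by positivity) (hU0 x).le) ((hfb x).trans ?_)
    rw [hUθ]
    exact hK m _ (hU0 x)
  obtain ⟨C₁, hC₁, hpow⟩ := hM.exists_pow_norm_le_lyap ht.1 4
  -- The exceptional null set depends on the compact set, so integer bounds are used; `M + 1` keeps
  -- the bound positive.
  have hsum : ∀ᵐ ω ∂P, ∀ M : ℕ, (∀ n, 1 ≤ n →
      scaledCov (Γ n ω) ∈ covSet d ((2.38 : ℝ) ^ 2 * (d : ℝ)⁻¹ * κ) ((M : ℝ) + 1)) →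
      ∃ C : ℝ, ∀ N : ℕ, 1 ≤ N → ∑ k ∈ Finset.Ico 1 N, lyap p (s / q) (X k ω) ≤ C * N :=
    ae_all_iff.2 fun M => hX.ae_sum_lyap_le_of_mem_covSet hd hκ hM hs h0 hq (by positivity)
  have hinn : ∀ᵐ ω ∂P, ∀ m N : ℕ, Tendsto (fun n : ℕ => (n : ℝ)⁻¹ * ∑ j ∈ Finset.range n,
      (poissonSum p (Matrix.of (scaledCov (Γ (j + 1) ω))) (g m) N (X (j + 2) ω) -
        ∫ y, poissonSum p (Matrix.of (scaledCov (Γ (j + 1) ω))) (g m) N y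
          ∂(metro p (Matrix.of (scaledCov (Γ (j + 1) ω))) (X (j + 1) ω)))) atTop (𝓝 0) := by
    refine ae_all_iff.2 fun m => ae_all_iff.2 fun N => ?_
    refine hX.ae_tendsto_average_innovation hd hκ hM
      (F := fun q => poissonSum p (Matrix.of q.1) (g m) N q.2) ?_ (B := N * K m) fun a ha y =>
        abs_poissonSum_le hpos hcont (ha.posDef hk) (hgm m) (hgb m) N y
    exact Finset.measurable_sum _ fun j _ => measurable_iterate_metroOp_uncurry hpos hcont (hgm m) j
  filter_upwards [hX.ae_exists_forall_mem_covSet hd hκ hM hs h0, hsum, hinn] with ω h1 h2 h3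
  obtain ⟨M, hMc⟩ := h1
  have hS : ∀ n, 1 ≤ n → scaledCov (Γ n ω) ∈ covSet d ((2.38 : ℝ) ^ 2 * (d : ℝ)⁻¹ * κ)
      ((M : ℝ) + 1) := fun n hn => covSet_mono (by linarith) (hMc n hn)
  obtain ⟨C, hC⟩ := h2 M hS
  have hC0 : 0 ≤ C := by simpa using hC 1 le_rfl
  have hshift : ∀ (F : State d → ℝ) (n : ℕ), ∑ k ∈ Finset.Ico 1 (n + 1), F (X k ω)
      = ∑ j ∈ Finset.range n, F (X (j + 1) ω) := fun F n => by
    rw [Finset.sum_Ico_eq_sum_range, Nat.add_sub_cancel]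
    simp only [add_comm 1]
  have hCr : ∀ n : ℕ, 1 ≤ n →
      ∑ j ∈ Finset.range n, lyap p (s / q) (X (j + 1) ω) ≤ (2 * C) * n := fun n hn => by
    rw [← hshift]
    refine (hC (n + 1) (by omega)).trans ?_
    have hn' : (1 : ℝ) ≤ n := by exact_mod_cast hn
    have h5 := mul_le_mul_of_nonneg_left hn' hC0
    push_cast
    linarith
  have hdist := hX.tendsto_dist_scaledCov hd hκ hS (by positivity) (fun x => (hU0 x).le) hC₁ hpow hC
  have hlim := tendsto_average_of_approx hfi (hM.integrable_lyap_target ht) hgi hfg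
    (x := fun j => X (j + 1) ω) hCr fun m =>
      tendsto_average_of_innovation hM hp hd hk (by positivity) ht (hgm m) (hgb m)
        (S := fun n => scaledCov (Γ (n + 1) ω)) (fun n => hS (n + 1) (by omega)) hCr hdist (h3 m)
  refine hlim.congr fun n => ?_
  rw [← hshift]
  rfl

end IsAMChain

end AdaptiveMetropolis

theorem theorem2p10 {d : ℕ} (hd : 0 < d)
    (p : AdaptiveMetropolis.State d → ℝ)
    (hp : AdaptiveMetropolis.IsProbDensity p)
    (hM : AdaptiveMetropolis.SuperExpRegularContours p)
    (s : ℝ) (hs : s ∈ Set.Ioo (0 : ℝ) 1)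
    (κ : ℝ) (hκ : 0 < κ)
    {Ω : Type*} {mΩ : MeasurableSpace Ω} (P : Measure Ω) [IsProbabilityMeasure P]
    (ℱ : Filtration ℕ mΩ)
    (X : ℕ → Ω → AdaptiveMetropolis.State d) (μ : ℕ → Ω → AdaptiveMetropolis.State d)
    (Γ : ℕ → Ω → Matrix (Fin d) (Fin d) ℝ)
    (hX : AdaptiveMetropolis.IsAMChain p κ P ℱ X μ Γ)
    (hW : ∫⁻ ω, ENNReal.ofReal (AdaptiveMetropolis.weight p s (X 0 ω)) ∂P < ∞)
    (a : ℝ) (ha : a ∈ Set.Ioo (0 : ℝ) 1)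
    (f : AdaptiveMetropolis.State d → ℝ) (hf : Measurable f)
    (hfW : AdaptiveMetropolis.vNorm
      (fun x => AdaptiveMetropolis.weight p s x ^ a) f < ∞) :
    Integrable f (AdaptiveMetropolis.target p) ∧
    ∀ᵐ ω ∂P, Tendsto (fun n : ℕ => (n : ℝ)⁻¹ * ∑ k ∈ Finset.Icc 1 n, f (X k ω)) atTop
      (𝓝 (∫ x, f x ∂(AdaptiveMetropolis.target p))) := by
  obtain ⟨w, hw, hweight⟩ := AdaptiveMetropolis.weight_eq hM hs.1
  have hpos := hM.pos
  have hlyap : ∀ x, AdaptiveMetropolis.weight p s x ^ a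
      = w ^ a * AdaptiveMetropolis.lyap p (s * a) x := fun x => by
    rw [hweight, Real.mul_rpow hw.le (AdaptiveMetropolis.lyap_pos hpos s x).le,
      AdaptiveMetropolis.lyap, AdaptiveMetropolis.lyap, ← Real.rpow_mul (hpos x).le, neg_mul]
  have hwa : 0 < w ^ a := Real.rpow_pos_of_pos hw a
  set C : ℝ := (AdaptiveMetropolis.vNorm (fun x => AdaptiveMetropolis.weight p s x ^ a) f).toReal
    with hC
  have hC0 : 0 ≤ C := ENNReal.toReal_nonneg
  have hfb : ∀ x, |f x| ≤ (C * w ^ a) * AdaptiveMetropolis.lyap p (s * a) x := fun x => by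
    have hl := AdaptiveMetropolis.lyap_pos hpos (s * a) x
    have h1 : ENNReal.ofReal (|f x| / AdaptiveMetropolis.weight p s x ^ a)
        ≤ AdaptiveMetropolis.vNorm (fun x => AdaptiveMetropolis.weight p s x ^ a) f :=
      le_iSup (fun x => ENNReal.ofReal (|f x| / AdaptiveMetropolis.weight p s x ^ a)) x
    have h2 := (ENNReal.ofReal_le_iff_le_toReal hfW.ne).1 h1
    rw [hlyap, div_le_iff₀ (mul_pos hwa hl)] at h2
    rw [mul_assoc]
    exact h2
  have hsa : s * a ∈ Set.Ioo (0 : ℝ) 1 :=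
    ⟨mul_pos hs.1 ha.1, (mul_lt_of_lt_one_right hs.1 ha.2).trans hs.2⟩
  have hfi : Integrable f (AdaptiveMetropolis.target p) :=
    ((hM.integrable_lyap_target hsa).const_mul (C * w ^ a)).mono' hf.aestronglyMeasurable
      (ae_of_all _ hfb)
  have h0 : ∫⁻ ω, ENNReal.ofReal (AdaptiveMetropolis.lyap p s (X 0 ω)) ∂P < ∞ := by
    simp_rw [hweight, ENNReal.ofReal_mul hw.le] at hW
    rw [lintegral_const_mul' _ _ ENNReal.ofReal_ne_top] at hW
    exact ENNReal.lt_top_of_mul_ne_top_right hW.ne (ENNReal.ofReal_pos.2 hw).ne'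
  exact ⟨hfi, hX.ae_tendsto_average hd hκ hM hp hs h0 ha hf hfi (by positivity) hfb⟩
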